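/- **Conventions.** Let $\Lambda$ be a unital ring with involution which is weakly finite, i.e. the rank of finitely generated free $\Lambda$-modules is well defined. Fix a $*$-invariant subgroup $Z\subset\widetilde K_1(\Lambda)=\operatorname{coker}(K_1(\mathbb Z)\to K_1(\Lambda))$. A *based module* is a stably finitely generated free left $\Lambda$-module $M$ with a $Z$-equivalence class of $s$-bases, i.e. of bases of some $M\oplus\Lambda^m$. An isomorphism of based modules is *simple* if its torsion lies in $Z$. Sums and duals of based modules are based in the usual way. Let $\epsilon=(-1)^q$. *Forms.* $Q_\epsilon(M)=\operatorname{coker}(1-T_\epsilon)$, where $T_\epsilon\phi=\epsilon\phi^*$ on $\operatorname{Hom}_\Lambda(M,M^*)$. An $\epsilon$-quadratic form is a pair $(M,\psi)$ with $M$ a based module and $\psi\in Q_\epsilon(M)$. Its symmetrisation is $\phi=\psi+\epsilon\psi^*:M\to M^*$, and the form is *simple* if $\phi$ is a simple isomorphism. All isometries are simple. $H_\epsilon(P)$ is the hyperbolic form on $P\oplus P^*$. A Lagrangian $i:L\hookrightarrow M$ is a based direct summand with $L=L^\perp=\operatorname{Ker}(i^*\phi)$ and $i^*\psi i=0\in Q_\epsilon(L)$.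 It is *simple* if $0\to L\to M\xrightarrow{i^*\phi}L^*\to 0$ is a based exact sequence. $\mathcal F^{zs}_{2q}(\Lambda)$ is the set of classes $[v]$ of forms, where $[v]=[w]$ if $v\oplus(P,0)\cong w\oplus(Q,0)$ for some based modules $P,Q$. Write $v\sim v'$ if $v,v'$ have the same rank and $[v\oplus H_\epsilon(\Lambda^k)]=[v'\oplus H_\epsilon(\Lambda^k)]$ for some $k$. $L^s_{2q}(\Lambda)$ is the set of stable isometry classes of simple forms ($v$ and $w$ are identified if $v\oplus H_\epsilon(P)\cong w\oplus H_\epsilon(Q)$ for some $P,Q$), and $0$ is the class of the hyperbolic forms. *Quasi-formations.* A quasi-formation $(M,\psi;L,V)$ consists of a simple form $(M,\psi)$, a simple Lagrangian $L$ and a based direct summand $V$ with $2\operatorname{rk}V=\operatorname{rk}M$. It is a simple formation if $V$ is also a simple Lagrangian. $l_{2q+1}(\Lambda)$ is the abelian monoid of quasi-formations under $\oplus$ modulo the congruence generated by isomorphism, by the addition of trivial formations $(H_\epsilon(P);P,P^*)$, and by $(M,\psi;K,L)\oplus(M,\psi;L,V)\sim(M,\psi;K,V)$ for simple Lagrangians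 $K,L$. $L^s_{2q+1}(\Lambda)\subset l_{2q+1}(\Lambda)$ is the subset of classes of simple formations. For a quasi-formation with inclusions $j:V\to M$ and $k:V^\perp\to M$, base $V^\perp=\operatorname{Ker}(j^*\phi)$ so that $0\to V^\perp\to M\to V^*\to0$ is based exact, and put $\theta=j^*\psi j$, $\theta^\perp=k^*\psi k$. Then $$b:l_{2q+1}(\Lambda)\to\mathcal F^{zs}_{2q}(\Lambda)^2,\qquad [M,\psi;L,V]\mapsto([V,\theta],[V^\perp,-\theta^\perp]),\qquad l_{2q+1}(v,v')=b^{-1}([v],[v']).$$ *Boundaries.* A simple split $(-\epsilon)$-quadratic formation $(F,(\binom{\gamma}{\mu},\theta)G)$ consists of a simple Lagrangian $\binom\gamma\mu:G\to F\oplus F^*$ of $H_{-\epsilon}(F)$ and $\theta\in Q_\epsilon(G)$ with $\gamma^*\mu=\theta+\epsilon\theta^*$. Examples are the trivial ones $(P,P^*)=(P,(\binom01,0)P^*)$ and the boundary $\partial(V,\theta)=(V,(\binom{1}{\theta+\epsilon\theta^*},\theta)V)$ of a form. An isomorphism to $(F',(\binom{\gamma'}{\mu'},\theta')G')$ is a triple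 $(\alpha,\beta,\nu)$ of simple isomorphisms $\alpha:F\to F'$, $\beta:G\to G'$ and $\nu\in Q_\epsilon(F^*)$ with $\alpha(\gamma+(\nu+\epsilon\nu^*)^*\mu)=\gamma'\beta$, $\alpha^{-*}\mu=\mu'\beta$ and $\theta+\mu^*\nu\mu=\beta^*\theta'\beta$. Composition is $(\alpha',\beta',\nu')(\alpha,\beta,\nu)=(\alpha'\alpha,\beta'\beta,\nu+\alpha^{-1}\nu'\alpha^{-*})$, and an isometry $h$ has boundary $\partial h=(h,h,0)$. Two isomorphisms $(\alpha,\beta,\nu)$, $(\alpha',\beta',\nu')$ with the same source and target are homotopic if there is $\Delta:G^*\to F'$ with $\beta'^{-*}-\beta^{-*}=\mu'^*\Delta$, $\alpha'-\alpha=\Delta\mu^*$ and $\alpha'\nu'\alpha'^*-\alpha\nu\alpha^*=(-\epsilon\alpha'\gamma+\Delta\theta)\Delta^*\in Q_\epsilon(F'^*)$. Stable isomorphisms and stable homotopies are isomorphisms and homotopies after adding trivial split formations, which may be re-identified by isomorphisms. $\mathrm{bIso}(v,v')$ is the set of orbits of $\mathrm{Aut}(v)\times\mathrm{Aut}(v')$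 on stable homotopy classes of stable isomorphisms $f:\partial v\to\partial v'$, under $(g,h)\cdot[f]=[\partial h\circ f\circ\partial g^{-1}]$. $\mathrm{sbIso}(v,v')$ is the direct limit of the sets $\mathrm{bIso}(v\oplus(\Lambda^k,0),v'\oplus(\Lambda^k,0))$ under $[f]\mapsto[f\oplus\partial\mathrm{id}]$. *The map $\kappa$.* For a stable isomorphism $f=(\alpha,\beta,\nu):\partial(V,\theta)\oplus(P,P^*)\to\partial(V',\theta')\oplus(P',P'^*)$ let $a:V\to V'$ and $s\in Q_\epsilon(V'^*)$ be the components of $\alpha$ and of $\alpha\nu\alpha^*$. The union $v\cup_f-v'$ is the form $\left(V\oplus V'^*,\left(\begin{smallmatrix}\theta&0\\ \epsilon a&-s\end{smallmatrix}\right)\right)$, and $\kappa:\mathrm{sbIso}(v,v')\to L^s_{2q}(\Lambda)$ sends $[f]$ to $[v\cup_f-v']$. *The map $\delta$.* For a quasi-formation $(M,\psi;L,W)$ choose a representative $\rho$ of $\psi$ and a section $\sigma$ of $k^*\phi:M\to(W^\perp)^*$. They define the isometry $h:(W,\theta)\oplus H_\epsilon(W^\perp)\to(W^\perp,-\theta^\perp)\oplus(M,\psi)$,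 $h(x,u,w)=(t,\ k(t)+\sigma(w)+j(x))$ with $t=-\sigma^*\phi^*j(x)+u-\sigma^*\rho^*\sigma(w)$. For a simple form $(N,\chi)$ with symmetrisation $\lambda$ there is the isomorphism $(1,\lambda,-\lambda^{-*}\chi\lambda^{-1}):\partial(N,\chi)\to(N,N^*)$. Applying this to $H_\epsilon(W^\perp)$ and $(M,\psi)$, $\partial h$ becomes a stable isomorphism $f_j:\partial(W,\theta)\to\partial(W^\perp,-\theta^\perp)$. For $[M,\psi;L,W]\in l_{2q+1}(v,v')$ choose isometries $k':(W,\theta)\oplus(Q,0)\cong v\oplus(\Lambda^p,0)$ and $l':(W^\perp,-\theta^\perp)\oplus(Q,0)\cong v'\oplus(\Lambda^p,0)$, and put $$\delta([M,\psi;L,W])=[\partial l'\circ(f_j\oplus\partial\mathrm{id}_Q)\circ\partial k'^{-1}]\in\mathrm{sbIso}(v,v').$$ **Theorem.** Let $v\sim v'$ be $\epsilon$-quadratic forms over $\Lambda$. Then $L^s_{2q+1}(\Lambda)$ is a group under the addition of $l_{2q+1}(\Lambda)$, the maps $b$, $\delta$ and $\kappa$ are well defined, and $\rho([x],[z])=[x]+[z]$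 defines an action $\rho$ of $L^s_{2q+1}(\Lambda)$ on $l_{2q+1}(v,v')$. The sequence of sets $$L^s_{2q+1}(\Lambda)\xrightarrow{\ \rho\ }l_{2q+1}(v,v')\xrightarrow{\ \delta\ }\mathrm{sbIso}(v,v')\xrightarrow{\ \kappa\ }L^s_{2q}(\Lambda)$$ is exact in the following sense: the orbits of $\rho$ are exactly the (non-empty) fibres of $\delta$, and $\operatorname{im}(\delta)=\kappa^{-1}(0)$. -/

import Mathlib

universe u

namespace EpsQuad

noncomputable section

set_option linter.unusedSectionVars false

/-! ### Duals and sesquilinear forms over a ring with involution -/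

section Dual

variable (Λ : Type u) [Ring Λ] [StarRing Λ]

/-- The dual `M^* = Hom_Λ(M, Λ)` of a left `Λ`-module. It is again a left `Λ`-module, by
`(a • f) x = f x * star a`, where `star` is the involution of `Λ`. -/
def Dual (M : Type u) [AddCommGroup M] [Module Λ M] : Type u := M →ₗ[Λ] Λ

variable {Λ}
variable {M N P : Type u} [AddCommGroup M] [Module Λ M] [AddCommGroup N] [Module Λ N]
  [AddCommGroup P] [Module Λ P]

instance : AddCommGroup (Dual Λ M) := inferInstanceAs (AddCommGroup (M →ₗ[Λ] Λ))

instance : FunLike (Dual Λ M) M Λ := inferInstanceAs (FunLike (M →ₗ[Λ] Λ) M Λ)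

instance : LinearMapClass (Dual Λ M) Λ M Λ := inferInstanceAs (LinearMapClass (M →ₗ[Λ] Λ) Λ M Λ)

@[ext] theorem Dual.ext {f g : Dual Λ M} (h : ∀ x, f x = g x) : f = g := DFunLike.ext f g h

/-- A linear functional as an element of the dual. -/
def Dual.ofLin (f : M →ₗ[Λ] Λ) : Dual Λ M := f

@[simp] theorem Dual.ofLin_apply (f : M →ₗ[Λ] Λ) (x : M) : Dual.ofLin f x = f x := rfl
@[simp] theorem Dual.add_apply (f g : Dual Λ M) (x : M) : (f + g) x = f x + g x := rfl
@[simp] theorem Dual.sub_apply (f g : Dual Λ M) (x : M) : (f - g) x = f x - g x := rfl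
@[simp] theorem Dual.neg_apply (f : Dual Λ M) (x : M) : (-f) x = -f x := rfl
@[simp] theorem Dual.zero_apply (x : M) : (0 : Dual Λ M) x = 0 := rfl

instance : SMul Λ (Dual Λ M) where
  smul a f := Dual.ofLin
    { toFun := fun x => f x * star a
      map_add' := fun x y => by simp [add_mul]
      map_smul' := fun c x => by simp [mul_assoc] }

@[simp] theorem Dual.smul_apply (a : Λ) (f : Dual Λ M) (x : M) : (a • f) x = f x * star a := rfl

instance : Module Λ (Dual Λ M) where
  one_smul f := by ext; simp
  mul_smul a b f := by ext; simp [mul_assoc]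
  smul_zero a := by ext; simp
  smul_add a f g := by ext; simp [add_mul]
  add_smul a b f := by ext; simp [mul_add]
  zero_smul f := by ext; simp

@[simp] theorem Dual.zsmul_apply (n : ℤ) (f : Dual Λ M) (x : M) : (n • f) x = n • f x := rfl

/-- The dual `f^* : N^* → M^*` of a linear map `f : M → N`. -/
def dualMap (f : M →ₗ[Λ] N) : Dual Λ N →ₗ[Λ] Dual Λ M where
  toFun g := Dual.ofLin
    { toFun := fun x => g (f x)
      map_add' := fun x y => by simp
      map_smul' := fun c x => by simp }
  map_add' g h := by ext; simp
  map_smul' a g := by ext; simp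

@[simp] theorem dualMap_apply (f : M →ₗ[Λ] N) (g : Dual Λ N) (x : M) : dualMap f g x = g (f x) := rfl

/-- The dual of a linear map `f : M → N^*`, regarded as a map `f^* : N → M^*`:
`f^*(y)(x)` is the conjugate of `f(x)(y)`. -/
def adj (f : M →ₗ[Λ] Dual Λ N) : N →ₗ[Λ] Dual Λ M where
  toFun y := Dual.ofLin
    { toFun := fun x => star (f x y)
      map_add' := fun x y => by simp
      map_smul' := fun c x => by simp }
  map_add' g h := by ext; simp
  map_smul' a g := by ext; simp

@[simp] theorem adj_apply (f : M →ₗ[Λ] Dual Λ N) (y : N) (x : M) : adj f y x = star (f x y) := rfl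

/-- The canonical map `M → M^{**}`. -/
def ev : M →ₗ[Λ] Dual Λ (Dual Λ M) where
  toFun x := Dual.ofLin
    { toFun := fun f => star (f x)
      map_add' := fun f g => by simp
      map_smul' := fun c f => by simp }
  map_add' g h := by ext; simp
  map_smul' a g := by ext; simp

@[simp] theorem ev_apply (x : M) (f : Dual Λ M) : ev x f = star (f x) := rfl

/-- The dual of an isomorphism. -/
def dualEquiv (e : M ≃ₗ[Λ] N) : Dual Λ M ≃ₗ[Λ] Dual Λ N :=
  LinearEquiv.ofLinearMap (dualMap e.symm.toLinearMap) (dualMap e.toLinearMap)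
    (by ext; simp) (by ext; simp)

@[simp] theorem dualEquiv_apply (e : M ≃ₗ[Λ] N) (f : Dual Λ M) (y : N) :
    dualEquiv e f y = f (e.symm y) := rfl

variable (M N) in
/-- `M^* ⊕ N^* = (M ⊕ N)^*`. -/
def dualProd : (Dual Λ M × Dual Λ N) ≃ₗ[Λ] Dual Λ (M × N) :=
  LinearEquiv.ofLinearMap
    ((dualMap (LinearMap.fst Λ M N)).coprod (dualMap (LinearMap.snd Λ M N)))
    ((dualMap (LinearMap.inl Λ M N)).prod (dualMap (LinearMap.inr Λ M N)))
    (by ext f x; simp [← map_add]) (by ext <;> simp)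

@[simp] theorem dualProd_apply (f : Dual Λ M × Dual Λ N) (x : M × N) :
    dualProd M N f x = f.1 x.1 + f.2 x.2 := rfl

/-- The dual of `Λ^κ` is `Λ^κ`, by means of the dual basis. -/
def dualFree (κ : Type) [Fintype κ] [DecidableEq κ] : Dual Λ (κ → Λ) ≃ₗ[Λ] (κ → Λ) where
  toFun f k := star (f (Pi.single k 1))
  map_add' f g := by ext; simp
  map_smul' a f := by ext; simp
  invFun c := Dual.ofLin
    { toFun := fun x => ∑ k, x k * star (c k)
      map_add' := fun x y => by simp [add_mul, Finset.sum_add_distrib]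
      map_smul' := fun a x => by simp [mul_assoc, Finset.mul_sum] }
  left_inv f := by
    ext x
    simp only [star_star, Dual.ofLin_apply, LinearMap.coe_mk, AddHom.coe_mk]
    conv_rhs => rw [pi_eq_sum_univ' x]
    rw [map_sum]
    exact Finset.sum_congr rfl fun k _ => by
      rw [← smul_eq_mul, ← map_smul]
  right_inv c := by
    ext k
    simp [Pi.single_apply]

@[simp] theorem dualFree_apply (κ : Type) [Fintype κ] [DecidableEq κ] (f : Dual Λ (κ → Λ)) (k : κ) :
    dualFree κ f k = star (f (Pi.single k 1)) := rfl

@[simp] theorem dualFree_symm_apply (κ : Type) [Fintype κ] [DecidableEq κ] (c x : κ → Λ) :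
    (dualFree κ).symm c x = ∑ k, x k * star (c k) := rfl

end Dual

/-! ### The reduced group `K₁` -/

section K1

variable (Λ : Type u) [Ring Λ]

/-- Automorphisms of the left module `Λ^n`. -/
abbrev GLn (n : ℕ) := (Fin n → Λ) ≃ₗ[Λ] (Fin n → Λ)

variable {Λ} in
/-- Reindexing coordinates along a bijection. -/
def reindex {ι κ : Type} (s : ι ≃ κ) : (ι → Λ) ≃ₗ[Λ] (κ → Λ) :=
  LinearEquiv.funCongrLeft Λ Λ s.symm

variable {Λ} in
/-- The block sum of two isomorphisms. -/
def blockSum {ι κ ι' κ' : Type} (f : (ι → Λ) ≃ₗ[Λ] (κ → Λ)) (g : (ι' → Λ) ≃ₗ[Λ] (κ' → Λ)) :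
    (ι ⊕ ι' → Λ) ≃ₗ[Λ] (κ ⊕ κ' → Λ) :=
  (LinearEquiv.sumArrowLequivProdArrow ι ι' Λ Λ).trans
    ((f.prodCongr g).trans (LinearEquiv.sumArrowLequivProdArrow κ κ' Λ Λ).symm)

variable {Λ} in
/-- The stabilisation `f ⊕ id` of an automorphism. -/
def stabGL {n : ℕ} (m : ℕ) (f : GLn Λ n) : GLn Λ (n + m) :=
  (reindex finSumFinEquiv.symm).trans
    ((blockSum f (LinearEquiv.refl Λ (Fin m → Λ))).trans (reindex finSumFinEquiv))

/-- The relations `[f g] = [f] + [g]` and `[f ⊕ id] = [f]` that define `K₁`. -/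
inductive K1Rel : FreeAbelianGroup (Σ n, GLn Λ n) → Prop
  | mul {n : ℕ} (f g : GLn Λ n) : K1Rel (.of ⟨n, f * g⟩ - .of ⟨n, f⟩ - .of ⟨n, g⟩)
  | stab {n : ℕ} (m : ℕ) (f : GLn Λ n) : K1Rel (.of ⟨n + m, stabGL m f⟩ - .of ⟨n, f⟩)

/-- `K₁(Λ)`, the abelianisation of the stable general linear group `GL(Λ) = ⋃ GL_n(Λ)`. -/
def K1 : Type u := FreeAbelianGroup (Σ n, GLn Λ n) ⧸ AddSubgroup.closure (Set.ofPred (K1Rel Λ))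

instance : AddCommGroup (K1 Λ) := inferInstanceAs (AddCommGroup
  (FreeAbelianGroup (Σ n, GLn Λ n) ⧸ AddSubgroup.closure (Set.ofPred (K1Rel Λ))))

variable {Λ} in
/-- The class of an automorphism in `K₁(Λ)`. -/
def K1.mk {n : ℕ} (f : GLn Λ n) : K1 Λ :=
  QuotientAddGroup.mk (s := AddSubgroup.closure (Set.ofPred (K1Rel Λ))) (FreeAbelianGroup.of ⟨n, f⟩)

/-- The image of `K₁(ℤ) → K₁(Λ)`. -/
def K1.intImage : AddSubgroup (K1 Λ) := AddSubgroup.closure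
  {k | ∃ (n : ℕ) (f : GLn Λ n) (A : Matrix.GeneralLinearGroup (Fin n) ℤ),
    (∀ i j, f (Pi.single i 1) j = ((A.1 i j : ℤ) : Λ)) ∧ k = K1.mk f}

/-- The reduced group `K̃₁(Λ) = coker(K₁(ℤ) → K₁(Λ))`. -/
def ReducedK1 : Type u := K1 Λ ⧸ K1.intImage Λ

instance : AddCommGroup (ReducedK1 Λ) := inferInstanceAs (AddCommGroup (K1 Λ ⧸ K1.intImage Λ))

variable {Λ}

/-- The class of an automorphism in `K̃₁(Λ)`. -/
def ReducedK1.mk {n : ℕ} (f : GLn Λ n) : ReducedK1 Λ :=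
  QuotientAddGroup.mk (s := K1.intImage Λ) (K1.mk f)

/-- A subgroup of `K̃₁(Λ)` is `*`-invariant if it is closed under `[f] ↦ [f^*]`; the matrix of `f^*`
with respect to the dual basis is the conjugate transpose of the matrix of `f`. -/
def StarInvariant [StarRing Λ] (Z : AddSubgroup (ReducedK1 Λ)) : Prop :=
  ∀ (n : ℕ) (f g : GLn Λ n), (∀ i j, g (Pi.single i 1) j = star (f (Pi.single j 1) i)) →
    ReducedK1.mk f ∈ Z → ReducedK1.mk g ∈ Z

theorem K1.mk_mul {n : ℕ} (f g : GLn Λ n) : K1.mk (f * g) = K1.mk f + K1.mk g := by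
  have h := (QuotientAddGroup.eq_zero_iff _).2
    (AddSubgroup.subset_closure (K1Rel.mul f g : _ ∈ Set.ofPred (K1Rel Λ)))
  rw [QuotientAddGroup.mk_sub, QuotientAddGroup.mk_sub, sub_sub, sub_eq_zero] at h
  exact h

theorem K1.mk_stab {n : ℕ} (m : ℕ) (f : GLn Λ n) : K1.mk (stabGL m f) = K1.mk f := by
  have h := (QuotientAddGroup.eq_zero_iff _).2
    (AddSubgroup.subset_closure (K1Rel.stab m f : _ ∈ Set.ofPred (K1Rel Λ)))
  rw [QuotientAddGroup.mk_sub, sub_eq_zero] at h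
  exact h

theorem ReducedK1.mk_mul {n : ℕ} (f g : GLn Λ n) :
    ReducedK1.mk (f * g) = ReducedK1.mk f + ReducedK1.mk g := by
  unfold ReducedK1.mk
  rw [K1.mk_mul]; rfl

theorem ReducedK1.mk_stab {n : ℕ} (m : ℕ) (f : GLn Λ n) :
    ReducedK1.mk (stabGL m f) = ReducedK1.mk f := by
  unfold ReducedK1.mk
  rw [K1.mk_stab]

theorem ReducedK1.mk_int {n : ℕ} (f : GLn Λ n) (A : Matrix.GeneralLinearGroup (Fin n) ℤ)
    (h : ∀ i j, f (Pi.single i 1) j = ((A.1 i j : ℤ) : Λ)) : ReducedK1.mk f = 0 :=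
  (QuotientAddGroup.eq_zero_iff _).2 (AddSubgroup.subset_closure ⟨n, f, A, h, rfl⟩)

theorem ReducedK1.mk_perm {n : ℕ} (s : Equiv.Perm (Fin n)) :
    ReducedK1.mk (reindex s : GLn Λ n) = 0 := by
  refine ReducedK1.mk_int _ ⟨s.permMatrix ℤ, (s⁻¹).permMatrix ℤ, ?_, ?_⟩ ?_
  · rw [← Matrix.permMatrix_mul]; simp
  · rw [← Matrix.permMatrix_mul]; simp
  · intro i j
    simp only [reindex, LinearEquiv.funCongrLeft_apply, LinearMap.funLeft_apply, Pi.single_apply,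
      Equiv.Perm.permMatrix, PEquiv.toMatrix_apply]
    simp [Equiv.eq_symm_apply, eq_comm]

end K1

/-! ### Based modules and torsion -/

section Torsion

variable {Λ : Type u} [Ring Λ]

section tau

variable {ι κ ο ι' κ' : Type} [Fintype ι] [Fintype κ] [Fintype ο] [Fintype ι'] [Fintype κ']

@[simp] theorem reindex_apply (s : ι ≃ κ) (x : ι → Λ) (k : κ) : reindex s x k = x (s.symm k) := rfl

@[simp] theorem blockSum_inl (f : (ι → Λ) ≃ₗ[Λ] (κ → Λ)) (g : (ι' → Λ) ≃ₗ[Λ] (κ' → Λ))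
    (x : ι ⊕ ι' → Λ) (k : κ) : blockSum f g x (.inl k) = f (fun i => x (.inl i)) k := rfl

@[simp] theorem blockSum_inr (f : (ι → Λ) ≃ₗ[Λ] (κ → Λ)) (g : (ι' → Λ) ≃ₗ[Λ] (κ' → Λ))
    (x : ι ⊕ ι' → Λ) (k : κ') : blockSum f g x (.inr k) = g (fun i => x (.inr i)) k := rfl

/-- The class in `K̃₁(Λ)` of an isomorphism `Λ^ι ≅ Λ^κ`, after an enumeration of `ι` and `κ`. -/
def tauAux (g : (ι → Λ) ≃ₗ[Λ] (κ → Λ)) {n : ℕ} (s : ι ≃ Fin n) (t : κ ≃ Fin n) : ReducedK1 Λ :=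
  ReducedK1.mk ((reindex s.symm).trans (g.trans (reindex t)))

theorem tauAux_eq (g : (ι → Λ) ≃ₗ[Λ] (κ → Λ)) {n n' : ℕ} (s : ι ≃ Fin n) (t : κ ≃ Fin n)
    (s' : ι ≃ Fin n') (t' : κ ≃ Fin n') : tauAux g s t = tauAux g s' t' := by
  obtain rfl : n = n' := by simpa using Fintype.card_congr (s.symm.trans s')
  have : ((reindex s.symm).trans (g.trans (reindex t)) : GLn Λ n) =
      (reindex (t'.symm.trans t) : GLn Λ n) * ((reindex s'.symm).trans (g.trans (reindex t'))) *
        (reindex (s.symm.trans s') : GLn Λ n) := by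
    ext x k
    simp only [LinearEquiv.mul_apply, LinearEquiv.trans_apply, reindex_apply]
    have e : reindex s'.symm (reindex (s.symm.trans s') x) = reindex s.symm x := by
      ext i; simp
    simp [e]
  unfold tauAux
  rw [this, ReducedK1.mk_mul, ReducedK1.mk_mul, ReducedK1.mk_perm, ReducedK1.mk_perm, add_zero, zero_add]

variable [InvariantBasisNumber Λ]

/-- The class in `K̃₁(Λ)` of an isomorphism `Λ^ι ≅ Λ^κ`. It does not depend on the enumeration of the
finite sets `ι` and `κ`, because permutation matrices vanish in `K̃₁(Λ)`. -/
def tau (g : (ι → Λ) ≃ₗ[Λ] (κ → Λ)) : ReducedK1 Λ :=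
  tauAux g (Fintype.equivFin ι)
    ((Fintype.equivFin κ).trans (finCongr (card_eq_of_linearEquiv Λ g).symm))

theorem tau_eq (g : (ι → Λ) ≃ₗ[Λ] (κ → Λ)) {n : ℕ} (s : ι ≃ Fin n) (t : κ ≃ Fin n) :
    tau g = tauAux g s t := tauAux_eq _ _ _ _ _

theorem tau_trans (g : (ι → Λ) ≃ₗ[Λ] (κ → Λ)) (h : (κ → Λ) ≃ₗ[Λ] (ο → Λ)) :
    tau (g.trans h) = tau g + tau h := by
  let s := Fintype.equivFin ι
  let t := (Fintype.equivFin κ).trans (finCongr (card_eq_of_linearEquiv Λ g).symm)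
  let r := (Fintype.equivFin ο).trans (finCongr (card_eq_of_linearEquiv Λ (g.trans h)).symm)
  rw [tau_eq _ s r, tau_eq _ s t, tau_eq _ t r, add_comm]
  unfold tauAux
  rw [← ReducedK1.mk_mul]
  refine congrArg ReducedK1.mk (LinearEquiv.ext fun x => funext fun k => ?_)
  have e : reindex t.symm (reindex t (g (reindex s.symm x))) = g (reindex s.symm x) := by
    ext i; simp
  simp only [LinearEquiv.mul_apply, LinearEquiv.trans_apply, e]

theorem tau_reindex (s : ι ≃ κ) : tau (reindex s : (ι → Λ) ≃ₗ[Λ] (κ → Λ)) = 0 := by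
  rw [tau_eq _ (s.trans (Fintype.equivFin κ)) (Fintype.equivFin κ)]
  have : ((reindex (s.trans (Fintype.equivFin κ)).symm).trans
      ((reindex s).trans (reindex (Fintype.equivFin κ))) : GLn Λ _) =
      reindex (Equiv.refl (Fin (Fintype.card κ))) := by
    ext x k
    simp
  unfold tauAux
  rw [this]
  exact ReducedK1.mk_perm _

theorem tau_blockSum_refl (g : (ι → Λ) ≃ₗ[Λ] (κ → Λ)) :
    tau (blockSum g (LinearEquiv.refl Λ (ο → Λ))) = tau g := by
  let s := Fintype.equivFin ι
  let t := (Fintype.equivFin κ).trans (finCongr (card_eq_of_linearEquiv Λ g).symm)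
  let r := Fintype.equivFin ο
  rw [tau_eq _ ((s.sumCongr r).trans finSumFinEquiv) ((t.sumCongr r).trans finSumFinEquiv),
    tau_eq g s t]
  unfold tauAux
  rw [← ReducedK1.mk_stab (Fintype.card ο) ((reindex s.symm).trans (g.trans (reindex t)))]
  refine congrArg (ReducedK1.mk (Λ := Λ)) (LinearEquiv.ext fun x => funext fun k => ?_)
  obtain ⟨k, rfl⟩ := finSumFinEquiv.surjective k
  rcases k with k | k <;> simp only [stabGL, LinearEquiv.trans_apply, reindex_apply,
    Equiv.symm_trans_apply, Equiv.symm_apply_apply, Equiv.sumCongr_symm, Equiv.sumCongr_apply,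
    Sum.map_inl, Sum.map_inr, blockSum_inl, blockSum_inr, LinearEquiv.refl_apply,
    Equiv.symm_symm, Equiv.trans_apply, Equiv.apply_symm_apply]
  rfl

theorem tau_blockSum (g : (ι → Λ) ≃ₗ[Λ] (κ → Λ)) (h : (ι' → Λ) ≃ₗ[Λ] (κ' → Λ)) :
    tau (blockSum g h) = tau g + tau h := by
  have h1 : blockSum g h = (blockSum g (LinearEquiv.refl Λ (ι' → Λ))).trans
      ((reindex (Equiv.sumComm κ ι')).trans ((blockSum h (LinearEquiv.refl Λ (κ → Λ))).trans
        (reindex (Equiv.sumComm κ' κ)))) := by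
    ext x k
    rcases k with k | k <;> simp
  rw [h1, tau_trans, tau_trans, tau_trans, tau_reindex, tau_reindex, tau_blockSum_refl,
    tau_blockSum_refl]
  simp

end tau

end Torsion

/-- A stably finitely generated free module with a preferred `s`-basis, that is, with a basis of
`M ⊕ Λ^ι` for some finite set `ι`, written as an isomorphism `M ⊕ Λ^ι ≅ Λ^κ`. The `Z`-equivalence
class of the `s`-basis is what matters below: two `s`-bases of `M` are `Z`-equivalent precisely
when the identity of `M` is a `Z`-simple isomorphism between the two based modules. -/
class Based (Λ : Type u) [Ring Λ] (M : Type u) [AddCommGroup M] [Module Λ M] where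
  ι : Type
  κ : Type
  [finι : Fintype ι]
  [finκ : Fintype κ]
  [decι : DecidableEq ι]
  [decκ : DecidableEq κ]
  basis : (M × (ι → Λ)) ≃ₗ[Λ] (κ → Λ)

attribute [reducible, instance] Based.finι Based.finκ Based.decι Based.decκ

section Based

variable {Λ : Type u} [Ring Λ]
variable {M N P M' N' : Type u} [AddCommGroup M] [Module Λ M] [AddCommGroup N] [Module Λ N]
  [AddCommGroup P] [Module Λ P] [AddCommGroup M'] [Module Λ M'] [AddCommGroup N'] [Module Λ N']

/-- `Λ^κ` with its standard basis. -/
instance Based.free (κ : Type) [Fintype κ] [DecidableEq κ] : Based Λ (κ → Λ) where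
  ι := Empty
  κ := κ
  basis := LinearEquiv.prodUnique

/-- The sum of two based modules. -/
instance Based.prod [Based Λ M] [Based Λ N] : Based Λ (M × N) where
  ι := Based.ι Λ M ⊕ Based.ι Λ N
  κ := Based.κ Λ M ⊕ Based.κ Λ N
  basis :=
    ((LinearEquiv.refl Λ (M × N)).prodCongr (LinearEquiv.sumArrowLequivProdArrow _ _ Λ Λ)).trans
      ((LinearEquiv.prodProdProdComm Λ M N (Based.ι Λ M → Λ) (Based.ι Λ N → Λ)).trans
        ((Based.basis.prodCongr Based.basis).trans
          (LinearEquiv.sumArrowLequivProdArrow _ _ Λ Λ).symm))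

/-- The dual of a based module, with the dual `s`-basis. -/
instance Based.dual [StarRing Λ] [Based Λ M] : Based Λ (Dual Λ M) where
  ι := Based.ι Λ M
  κ := Based.κ Λ M
  basis := ((LinearEquiv.refl Λ (Dual Λ M)).prodCongr (dualFree (Based.ι Λ M)).symm).trans
    ((dualProd M (Based.ι Λ M → Λ)).trans
      ((dualEquiv Based.basis).trans (dualFree (Based.κ Λ M))))

variable (Λ M) in
/-- The rank of a based module, an integer. -/
def rank [Based Λ M] : ℤ := Fintype.card (Based.κ Λ M) - Fintype.card (Based.ι Λ M)

/-- The isomorphism `f ⊕ id : (M ⊕ Λ^ι) ⊕ Λ^ι' ≅ (N ⊕ Λ^ι') ⊕ Λ^ι` that compares the stabilisations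
of `M` and `N` on which their `s`-bases live. -/
def shuffle (A B : Type u) [AddCommGroup A] [Module Λ A] [AddCommGroup B] [Module Λ B]
    (f : M ≃ₗ[Λ] N) : ((M × A) × B) ≃ₗ[Λ] ((N × B) × A) where
  toFun x := ((f x.1.1, x.2), x.1.2)
  invFun y := ((f.symm y.1.1, y.2), y.1.2)
  map_add' x y := by simp
  map_smul' a x := by simp
  left_inv x := by simp
  right_inv x := by simp

/-- The matrix of (a stabilisation of) `f` with respect to the preferred `s`-bases. -/
def torsionIso [Based Λ M] [Based Λ N] (f : M ≃ₗ[Λ] N) :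
    (Based.κ Λ M ⊕ Based.ι Λ N → Λ) ≃ₗ[Λ] (Based.κ Λ N ⊕ Based.ι Λ M → Λ) :=
  (LinearEquiv.sumArrowLequivProdArrow _ _ Λ Λ).trans
    ((Based.basis.symm.prodCongr (LinearEquiv.refl Λ _)).trans
      ((shuffle (Based.ι Λ M → Λ) (Based.ι Λ N → Λ) f).trans
        ((Based.basis.prodCongr (LinearEquiv.refl Λ _)).trans
          (LinearEquiv.sumArrowLequivProdArrow _ _ Λ Λ).symm)))

@[simp] theorem torsionIso_inl [Based Λ M] [Based Λ N] (f : M ≃ₗ[Λ] N)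
    (x : Based.κ Λ M ⊕ Based.ι Λ N → Λ) (k : Based.κ Λ N) :
    torsionIso f x (.inl k) = Based.basis
      (f (Based.basis.symm fun i => x (.inl i)).1, fun i => x (.inr i)) k := rfl

@[simp] theorem torsionIso_inr [Based Λ M] [Based Λ N] (f : M ≃ₗ[Λ] N)
    (x : Based.κ Λ M ⊕ Based.ι Λ N → Λ) (k : Based.ι Λ M) :
    torsionIso f x (.inr k) = (Based.basis.symm fun i => x (.inl i)).2 k := rfl

variable [InvariantBasisNumber Λ]

/-- The torsion in `K̃₁(Λ)` of an isomorphism of based modules. -/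
def torsion [Based Λ M] [Based Λ N] (f : M ≃ₗ[Λ] N) : ReducedK1 Λ := tau (torsionIso f)

/-- A `Z`-simple isomorphism of based modules: one whose torsion lies in `Z`. -/
def IsSimple (Z : AddSubgroup (ReducedK1 Λ)) [Based Λ M] [Based Λ N] (f : M ≃ₗ[Λ] N) : Prop :=
  torsion f ∈ Z

theorem torsion_trans [Based Λ M] [Based Λ N] [Based Λ P] (f : M ≃ₗ[Λ] N) (g : N ≃ₗ[Λ] P) :
    torsion (f.trans g) = torsion f + torsion g := by
  let w (A B C : Type) : (A ⊕ B) ⊕ C ≃ (A ⊕ C) ⊕ B :=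
    (Equiv.sumAssoc A B C).trans (((Equiv.refl A).sumCongr (Equiv.sumComm B C)).trans
      (Equiv.sumAssoc A C B).symm)
  have h : ((blockSum (torsionIso f) (LinearEquiv.refl Λ (Based.ι Λ P → Λ))).trans
      ((reindex (w _ _ _)).trans ((blockSum (torsionIso g) (LinearEquiv.refl Λ (Based.ι Λ M → Λ))).trans
        (reindex (w _ _ _))))) =
      (reindex (w _ _ _)).trans (blockSum (torsionIso (f.trans g))
        (LinearEquiv.refl Λ (Based.ι Λ N → Λ))) := by
    ext x k
    rcases k with (k | k) | k <;> simp [w]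
  have h2 := congrArg tau h
  simpa [tau_trans, tau_blockSum_refl, tau_reindex, torsion, eq_comm] using h2

theorem torsion_refl [Based Λ M] : torsion (LinearEquiv.refl Λ M) = 0 := by
  have := torsion_trans (LinearEquiv.refl Λ M) (LinearEquiv.refl Λ M)
  simpa using this

theorem torsion_symm [Based Λ M] [Based Λ N] (f : M ≃ₗ[Λ] N) : torsion f.symm = -torsion f := by
  have := torsion_trans f f.symm
  rw [LinearEquiv.self_trans_symm, torsion_refl] at this
  exact (neg_eq_of_add_eq_zero_right this.symm).symm

theorem Based.prod_basis_inl [Based Λ M] [Based Λ N]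
    (x : (M × N) × (Based.ι Λ M ⊕ Based.ι Λ N → Λ)) (k : Based.κ Λ M) :
    (Based.basis (Λ := Λ) (M := M × N) x : Based.κ Λ M ⊕ Based.κ Λ N → Λ) (.inl k) =
      Based.basis (x.1.1, fun i => x.2 (.inl i)) k := rfl

theorem Based.prod_basis_inr [Based Λ M] [Based Λ N]
    (x : (M × N) × (Based.ι Λ M ⊕ Based.ι Λ N → Λ)) (k : Based.κ Λ N) :
    (Based.basis (Λ := Λ) (M := M × N) x : Based.κ Λ M ⊕ Based.κ Λ N → Λ) (.inr k) =
      Based.basis (x.1.2, fun i => x.2 (.inr i)) k := rfl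

/-- An isomorphism that carries the preferred `s`-basis to the preferred `s`-basis, up to
enumeration, has trivial torsion. -/
theorem torsion_of_compat [Based Λ M] [Based Λ N] (f : M ≃ₗ[Λ] N)
    (s : Based.ι Λ M ≃ Based.ι Λ N) (t : Based.κ Λ M ≃ Based.κ Λ N)
    (h : ∀ m a, Based.basis (f m, reindex s a) = reindex t (Based.basis (m, a))) :
    torsion f = 0 := by
  have h1 : torsionIso f = (reindex ((Equiv.refl _).sumCongr s.symm)).trans
      ((torsionIso (LinearEquiv.refl Λ M)).trans (reindex (t.sumCongr (Equiv.refl _)))) := by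
    ext x k
    rcases k with k | k
    · have : (fun i => x (.inr i)) = reindex s (fun i => x (.inr (s i))) := by ext i; simp
      rw [torsionIso_inl, this, h]
      simp
    · simp
  unfold torsion
  rw [h1, tau_trans, tau_trans, tau_reindex, tau_reindex]
  rw [zero_add, add_zero]
  exact torsion_refl (Λ := Λ) (M := M)

theorem torsion_prod [Based Λ M] [Based Λ N] [Based Λ M'] [Based Λ N'] (f : M ≃ₗ[Λ] M')
    (g : N ≃ₗ[Λ] N') : torsion (f.prodCongr g) = torsion f + torsion g := by
  have h : torsionIso (f.prodCongr g) = (reindex (Equiv.sumSumSumComm _ _ _ _)).trans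
      ((blockSum (torsionIso f) (torsionIso g)).trans (reindex (Equiv.sumSumSumComm _ _ _ _))) := by
    ext x k
    rcases k with (k | k) | (k | k) <;> rfl
  unfold torsion
  rw [h, tau_trans, tau_trans, tau_reindex, tau_reindex, tau_blockSum]
  simp

end Based

section Coherence

variable {Λ : Type u} [Ring Λ] [InvariantBasisNumber Λ]
variable {M N P M' N' : Type u} [AddCommGroup M] [Module Λ M] [AddCommGroup N] [Module Λ N]
  [AddCommGroup P] [Module Λ P] [AddCommGroup M'] [Module Λ M'] [AddCommGroup N'] [Module Λ N']
  [Based Λ M] [Based Λ N] [Based Λ P] [Based Λ M'] [Based Λ N']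
variable {Z : AddSubgroup (ReducedK1 Λ)}

theorem IsSimple.refl : IsSimple Z (LinearEquiv.refl Λ M) := by
  rw [IsSimple, torsion_refl]; exact Z.zero_mem

theorem IsSimple.trans {f : M ≃ₗ[Λ] N} {g : N ≃ₗ[Λ] P} (hf : IsSimple Z f) (hg : IsSimple Z g) :
    IsSimple Z (f.trans g) := by
  rw [IsSimple, torsion_trans]; exact Z.add_mem hf hg

theorem IsSimple.symm {f : M ≃ₗ[Λ] N} (hf : IsSimple Z f) : IsSimple Z f.symm := by
  rw [IsSimple, torsion_symm]; exact Z.neg_mem hf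

theorem IsSimple.prod {f : M ≃ₗ[Λ] M'} {g : N ≃ₗ[Λ] N'} (hf : IsSimple Z f) (hg : IsSimple Z g) :
    IsSimple Z (f.prodCongr g) := by
  rw [IsSimple, torsion_prod]; exact Z.add_mem hf hg

theorem IsSimple.of_compat (f : M ≃ₗ[Λ] N)
    (s : Based.ι Λ M ≃ Based.ι Λ N) (t : Based.κ Λ M ≃ Based.κ Λ N)
    (h : ∀ m a, Based.basis (f m, reindex s a) = reindex t (Based.basis (m, a))) :
    IsSimple Z f := by
  rw [IsSimple, torsion_of_compat f s t h]; exact Z.zero_mem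

theorem IsSimple.prodComm : IsSimple Z (LinearEquiv.prodComm Λ M N) := by
  refine .of_compat _ (Equiv.sumComm _ _) (Equiv.sumComm _ _) fun m a => ?_
  ext (k | k) <;> rfl

theorem IsSimple.prodAssoc : IsSimple Z (LinearEquiv.prodAssoc Λ M N P) := by
  refine .of_compat _ (Equiv.sumAssoc _ _ _) (Equiv.sumAssoc _ _ _) fun m a => ?_
  ext (k | k | k) <;> rfl

theorem IsSimple.prodProdProdComm : IsSimple Z (LinearEquiv.prodProdProdComm Λ M N M' N') := by
  refine .of_compat _ (Equiv.sumSumSumComm _ _ _ _) (Equiv.sumSumSumComm _ _ _ _) fun m a => ?_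
  ext ((k | k) | (k | k)) <;> rfl

variable [StarRing Λ]

theorem Dual.sum_apply {α : Type*} (s : Finset α) (f : α → Dual Λ M) (m : M) :
    (∑ k ∈ s, f k) m = ∑ k ∈ s, f k m := by
  classical
  induction s using Finset.induction_on with
  | empty => simp
  | insert a s ha ih => simp [Finset.sum_insert ha, ih]

/-- The dual `s`-basis, characterised by the pairing of `M ⊕ Λ^ι` with its dual. -/
theorem Based.dual_basis (y : Dual Λ M × (Based.ι Λ M → Λ)) (x : M × (Based.ι Λ M → Λ)) :
    ∑ k, Based.basis x k * star ((Based.basis (Λ := Λ) (M := Dual Λ M) y : Based.κ Λ M → Λ) k) =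
      y.1 x.1 + ∑ i, x.2 i * star (y.2 i) := by
  have h2 : (dualFree (Based.κ Λ M)).symm (Based.basis (Λ := Λ) (M := Dual Λ M) y : Based.κ Λ M → Λ) =
      dualEquiv Based.basis (dualProd M (Based.ι Λ M → Λ) (y.1, (dualFree _).symm y.2)) := by
    rw [LinearEquiv.symm_apply_eq]; rfl
  have h3 := DFunLike.congr_fun h2 (Based.basis x)
  simpa using h3

theorem Based.eq_of_pairing (c c' : Based.κ Λ M → Λ)
    (h : ∀ x : M × (Based.ι Λ M → Λ), ∑ k, Based.basis x k * star (c k) =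
      ∑ k, Based.basis x k * star (c' k)) : c = c' := by
  ext k
  have := h (Based.basis.symm (Pi.single k 1))
  simpa [Pi.single_apply] using this

theorem ev_bijective : Function.Bijective (ev (Λ := Λ) (M := M)) := by
  let x (k : Based.κ Λ M) : M := (Based.basis.symm (Pi.single k 1)).1
  let f (k : Based.κ Λ M) : Dual Λ M := Dual.ofLin
    ((LinearMap.proj k).comp (Based.basis.toLinearMap.comp (LinearMap.inl Λ M (Based.ι Λ M → Λ))))
  have key (m : M) : ∑ k, f k m • x k = m := by
    have h1 : ∑ k, Based.basis (m, (0 : Based.ι Λ M → Λ)) k • Pi.single k (1 : Λ) =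
        Based.basis (m, (0 : Based.ι Λ M → Λ)) := by
      conv_rhs => rw [pi_eq_sum_univ' (Based.basis (m, (0 : Based.ι Λ M → Λ)))]
    have h2 := congrArg (fun z => (Based.basis.symm z : M × (Based.ι Λ M → Λ)).1) h1
    simp only [map_sum, map_smul, Prod.fst_sum, Prod.smul_fst, LinearEquiv.symm_apply_apply] at h2
    exact h2
  constructor
  · rw [injective_iff_map_eq_zero]
    intro m hm
    rw [← key m]
    refine Finset.sum_eq_zero fun k _ => ?_
    have : star (f k m) = 0 := DFunLike.congr_fun hm (f k)
    rw [star_eq_zero.1 this, zero_smul]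
  · intro Φ
    refine ⟨∑ k, star (Φ (f k)) • x k, ?_⟩
    ext g
    have hg : g = ∑ k, star (g (x k)) • f k := by
      ext m
      rw [Dual.sum_apply]
      conv_lhs => rw [← key m]
      simp
    conv_rhs => rw [hg]
    simp [Dual.sum_apply]

variable (Λ M) in
/-- The identification `M = M^{**}` for a based module. -/
def evEquiv : M ≃ₗ[Λ] Dual Λ (Dual Λ M) := LinearEquiv.ofBijective ev ev_bijective

@[simp] theorem evEquiv_apply (x : M) : evEquiv Λ M x = ev x := rfl

theorem IsSimple.dualProd : IsSimple Z (dualProd (Λ := Λ) M N) := by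
  refine .of_compat _ (Equiv.refl _) (Equiv.refl _) fun m a => ?_
  refine Based.eq_of_pairing (M := M × N) _ _ fun x => ?_
  refine (Based.dual_basis (M := M × N) _ x).trans ?_
  have h1 := Based.dual_basis (Λ := Λ) (M := M) (m.1, fun i => a (.inl i)) (x.1.1, fun i => x.2 (.inl i))
  have h2 := Based.dual_basis (Λ := Λ) (M := N) (m.2, fun i => a (.inr i)) (x.1.2, fun i => x.2 (.inr i))
  refine Eq.trans ?_ (Fintype.sum_sum_type (α₁ := Based.κ Λ M) (α₂ := Based.κ Λ N)
    fun k => Based.basis (Λ := Λ) (M := M × N) x k *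
      star (Based.basis (Λ := Λ) (M := Dual Λ M × Dual Λ N) (m, a) k)).symm
  refine Eq.trans ?_ (congrArg₂ (· + ·) h1 h2).symm
  refine (congrArg₂ (· + ·) rfl (Fintype.sum_sum_type (α₁ := Based.ι Λ M) (α₂ := Based.ι Λ N)
    fun i => x.2 i * star (a i))).trans ?_
  exact add_add_add_comm _ _ _ _

theorem IsSimple.evEquiv : IsSimple Z (evEquiv Λ M) := by
  refine .of_compat _ (Equiv.refl _) (Equiv.refl _) fun m a => ?_
  refine Based.eq_of_pairing (M := Dual Λ M) _ _ fun x => ?_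
  refine (Based.dual_basis (M := Dual Λ M) _ x).trans ?_
  have h := congrArg star (Based.dual_basis (Λ := Λ) (M := M) x (m, a))
  simp only [star_add, star_sum, star_mul, star_star] at h
  exact h.symm

theorem torsion_neg_free (κ : Type) [Fintype κ] [DecidableEq κ] :
    torsion (LinearEquiv.neg Λ : (κ → Λ) ≃ₗ[Λ] (κ → Λ)) = 0 := by
  let s := Fintype.equivFin κ
  let t : Based.κ Λ (κ → Λ) ⊕ Based.ι Λ (κ → Λ) ≃ Fin (Fintype.card κ) := (Equiv.sumEmpty κ Empty).trans s
  unfold torsion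
  rw [tau_eq _ t t]
  have h : ((reindex t.symm).trans ((torsionIso (LinearEquiv.neg Λ : (κ → Λ) ≃ₗ[Λ] (κ → Λ))).trans
      (reindex t)) : GLn Λ _) = LinearEquiv.neg Λ := by
    refine LinearEquiv.ext fun x => funext fun k => ?_
    obtain ⟨k | k, rfl⟩ := t.surjective k
    · simp only [LinearEquiv.trans_apply, reindex_apply, Equiv.symm_apply_apply, torsionIso_inl]
      exact congrArg (fun z => -x z) rfl
    · exact k.elim
  unfold tauAux
  rw [h]
  refine ReducedK1.mk_int _ (-1) fun i j => ?_
  simp [Matrix.one_apply, Pi.single_apply, eq_comm]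

theorem IsSimple.neg : IsSimple Z (LinearEquiv.neg Λ : M ≃ₗ[Λ] M) := by
  let e : (M × (Based.ι Λ M → Λ)) ≃ₗ[Λ] (Based.κ Λ M → Λ) := Based.basis
  have h : (LinearEquiv.neg Λ : M ≃ₗ[Λ] M).prodCongr
      (LinearEquiv.neg Λ : (Based.ι Λ M → Λ) ≃ₗ[Λ] (Based.ι Λ M → Λ)) =
      e.trans ((LinearEquiv.neg Λ).trans e.symm) := by
    refine LinearEquiv.ext fun x => ?_
    simp [Prod.ext_iff]
  have h2 := congrArg torsion h
  rw [torsion_prod, torsion_trans, torsion_trans, torsion_symm, torsion_neg_free, torsion_neg_free]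
    at h2
  rw [IsSimple]
  simp only [add_zero, zero_add, add_neg_cancel] at h2
  rw [h2]
  exact Z.zero_mem

end Coherence

/-! ### Quadratic forms -/

section QGroup

variable (Λ : Type u) [Ring Λ] [StarRing Λ]

/-- Sesquilinear (asymmetric) forms on `M`, that is, elements of `Hom_Λ(M, M^*)`. -/
abbrev Sesq (M : Type u) [AddCommGroup M] [Module Λ M] := M →ₗ[Λ] Dual Λ M

variable {Λ} (ε : ℤˣ)
variable {M N P : Type u} [AddCommGroup M] [Module Λ M] [AddCommGroup N] [Module Λ N]
  [AddCommGroup P] [Module Λ P]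

/-- The `ε`-duality involution `φ ↦ ε φ^*`. -/
def Teps : Sesq Λ M →+ Sesq Λ M where
  toFun φ := (ε : ℤ) • adj φ
  map_zero' := by ext; simp
  map_add' φ χ := by ext; simp

@[simp] theorem Teps_apply (φ : Sesq Λ M) (x y : M) : Teps ε φ x y = (ε : ℤ) • star (φ y x) := rfl

theorem Teps_Teps (φ : Sesq Λ M) : Teps ε (Teps ε φ) = φ := by
  ext x y
  rcases Int.units_eq_one_or ε with rfl | rfl <;> simp

variable (Λ M) in
/-- `Q_ε(M) = coker(1 - T_ε : Hom_Λ(M, M^*) → Hom_Λ(M, M^*))`. -/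
def QGroup : Type u := Sesq Λ M ⧸ (AddMonoidHom.id (Sesq Λ M) - Teps ε).range

instance : AddCommGroup (QGroup Λ ε M) :=
  inferInstanceAs (AddCommGroup (Sesq Λ M ⧸ (AddMonoidHom.id (Sesq Λ M) - Teps ε).range))

/-- The class of a sesquilinear form in `Q_ε(M)`. -/
def QGroup.mk : Sesq Λ M →+ QGroup Λ ε M := QuotientAddGroup.mk' _

theorem QGroup.mk_surjective : Function.Surjective (QGroup.mk ε : Sesq Λ M →+ QGroup Λ ε M) :=
  QuotientAddGroup.mk'_surjective _

variable {ε}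

/-- The pullback `ψ ↦ f^* ψ f` on sesquilinear forms. -/
def Sesq.pull (f : M →ₗ[Λ] N) : Sesq Λ N →+ Sesq Λ M where
  toFun ψ := (dualMap f).comp (ψ.comp f)
  map_zero' := by ext; simp
  map_add' φ χ := by ext; simp

@[simp] theorem Sesq.pull_apply (f : M →ₗ[Λ] N) (ψ : Sesq Λ N) (x y : M) :
    Sesq.pull f ψ x y = ψ (f x) (f y) := rfl

/-- The pullback `ψ ↦ f^* ψ f`, as a map `Q_ε(N) → Q_ε(M)`. -/
def QGroup.pull (f : M →ₗ[Λ] N) : QGroup Λ ε N →+ QGroup Λ ε M :=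
  QuotientAddGroup.map _ _ (Sesq.pull f) (by
    rintro _ ⟨χ, rfl⟩
    refine ⟨Sesq.pull f χ, ?_⟩
    ext x y
    simp)

@[simp] theorem QGroup.pull_mk (f : M →ₗ[Λ] N) (ψ : Sesq Λ N) :
    QGroup.pull f (QGroup.mk ε ψ) = QGroup.mk ε (Sesq.pull f ψ) := rfl

theorem QGroup.pull_pull (f : M →ₗ[Λ] N) (g : N →ₗ[Λ] P) (ψ : QGroup Λ ε P) :
    QGroup.pull f (QGroup.pull g ψ) = QGroup.pull (g.comp f) ψ := by
  obtain ⟨ψ, rfl⟩ := QGroup.mk_surjective ε ψ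
  rfl

/-- The symmetrisation `1 + T_ε : Q_ε(M) → Hom_Λ(M, M^*)`. -/
def QGroup.sym : QGroup Λ ε M →+ Sesq Λ M :=
  QuotientAddGroup.lift _ (AddMonoidHom.id (Sesq Λ M) + Teps ε) (by
    rintro _ ⟨χ, rfl⟩
    simp [Teps_Teps])

@[simp] theorem QGroup.sym_mk (ψ : Sesq Λ M) : QGroup.sym (QGroup.mk ε ψ) = ψ + Teps ε ψ := rfl

theorem QGroup.sym_pull (f : M →ₗ[Λ] N) (ψ : QGroup Λ ε N) :
    QGroup.sym (QGroup.pull f ψ) = Sesq.pull f (QGroup.sym ψ) := by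
  obtain ⟨ψ, rfl⟩ := QGroup.mk_surjective ε ψ
  ext x y
  simp

end QGroup

/-- A based module over `Λ`: a stably finitely generated free module with a preferred `s`-basis. -/
structure BasedModule (Λ : Type u) [Ring Λ] where
  carrier : Type u
  [grp : AddCommGroup carrier]
  [mod : Module Λ carrier]
  [based : Based Λ carrier]

attribute [instance] BasedModule.grp BasedModule.mod BasedModule.based

instance (Λ : Type u) [Ring Λ] : CoeSort (BasedModule Λ) (Type u) := ⟨BasedModule.carrier⟩

/-- Bundle a based module. -/
abbrev BasedModule.of (Λ : Type u) [Ring Λ] (M : Type u) [AddCommGroup M] [Module Λ M]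
    [Based Λ M] : BasedModule Λ := ⟨M⟩

/-- An `ε`-quadratic form `(M, ψ)` with `ψ ∈ Q_ε(M)`. -/
structure QuadForm (Λ : Type u) [Ring Λ] [StarRing Λ] (ε : ℤˣ) where
  mod : BasedModule Λ
  ψ : QGroup Λ ε mod

section Forms

variable {Λ : Type u} [Ring Λ] [StarRing Λ] {ε : ℤˣ}

namespace QuadForm

/-- The symmetrisation `φ = (1 + T_ε) ψ : M → M^*`. -/
def sym (v : QuadForm Λ ε) : v.mod →ₗ[Λ] Dual Λ v.mod := v.ψ.sym

/-- The orthogonal sum of two forms. -/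
abbrev sum (v w : QuadForm Λ ε) : QuadForm Λ ε where
  mod := .of Λ (v.mod × w.mod)
  ψ := v.ψ.pull (LinearMap.fst Λ v.mod w.mod) + w.ψ.pull (LinearMap.snd Λ v.mod w.mod)

/-- The zero form `(P, 0)`. -/
abbrev zero (P : BasedModule Λ) : QuadForm Λ ε := ⟨P, 0⟩

/-- The asymmetric form `((x, f), (y, g)) ↦ f y` on `P ⊕ P^*`. -/
def hypSesq (P : Type u) [AddCommGroup P] [Module Λ P] : Sesq Λ (P × Dual Λ P) :=
  (dualMap (LinearMap.fst Λ P (Dual Λ P))).comp (LinearMap.snd Λ P (Dual Λ P))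

@[simp] theorem hypSesq_apply (P : Type u) [AddCommGroup P] [Module Λ P] (x y : P × Dual Λ P) :
    hypSesq P x y = x.2 y.1 := rfl

variable (ε) in
/-- The hyperbolic form `H_ε(P)` on `P ⊕ P^*`. -/
abbrev hyp (P : BasedModule Λ) : QuadForm Λ ε where
  mod := .of Λ (P × Dual Λ P)
  ψ := QGroup.mk ε (hypSesq P)

/-- The rank of a form. -/
def rank (v : QuadForm Λ ε) : ℤ := EpsQuad.rank Λ v.mod

/-- `L ⊂ M`, given by the inclusion `i`, is a Lagrangian: it is a direct summand, it equals its
annihilator `Ker(i^* φ : M → L^*)`, and `i^* ψ i = 0 ∈ Q_ε(L)`. -/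
structure IsLagrangian (v : QuadForm Λ ε) {L : BasedModule Λ} (i : L →ₗ[Λ] v.mod) : Prop where
  split : ∃ r : v.mod →ₗ[Λ] L, r.comp i = LinearMap.id
  eq_annihilator : LinearMap.range i = LinearMap.ker ((dualMap i).comp v.sym)
  pull_eq_zero : v.ψ.pull i = 0

theorem sum_sym_apply (v w : QuadForm Λ ε) (x : v.mod × w.mod) :
    (v.sum w).sym x = dualProd v.mod w.mod (v.sym x.1, w.sym x.2) := by
  ext y
  simp [sym, sum, QGroup.sym_pull]

theorem hyp_sym_apply (P : BasedModule Λ) (x : P × Dual Λ P) :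
    (hyp ε P).sym x = dualProd P (Dual Λ P) (x.2, (ε : ℤ) • ev x.1) := by
  ext y
  simp [sym, hyp]

variable [InvariantBasisNumber Λ] (Z : AddSubgroup (ReducedK1 Λ))

/-- A form is simple if its symmetrisation `M → M^*` is a simple isomorphism. -/
def IsSimple (v : QuadForm Λ ε) : Prop :=
  ∃ φ : v.mod ≃ₗ[Λ] Dual Λ v.mod, φ.toLinearMap = v.sym ∧ EpsQuad.IsSimple Z φ

end QuadForm

variable [InvariantBasisNumber Λ] (Z : AddSubgroup (ReducedK1 Λ))

/-- The sequence `0 → A → M → C → 0` is a based short exact sequence: it is exact, and for a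
splitting the resulting isomorphism `A ⊕ C ≅ M` is simple. -/
def IsBasedExact {A M C : Type u} [AddCommGroup A] [Module Λ A] [AddCommGroup M] [Module Λ M]
    [AddCommGroup C] [Module Λ C] [Based Λ A] [Based Λ M] [Based Λ C]
    (i : A →ₗ[Λ] M) (p : M →ₗ[Λ] C) : Prop :=
  ∃ e : (A × C) ≃ₗ[Λ] M, IsSimple Z e ∧ (∀ a, e (a, 0) = i a) ∧ ∀ a c, p (e (a, c)) = c

/-- A simple Lagrangian of a simple form: the Hamiltonian `s`-basis that it defines is preferred,
that is, `0 → L → M → L^* → 0` is based. -/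
structure QuadForm.IsSimpleLagrangian (v : QuadForm Λ ε) {L : BasedModule Λ} (i : L →ₗ[Λ] v.mod) :
    Prop where
  isLagrangian : v.IsLagrangian i
  based : IsBasedExact Z i ((dualMap i).comp v.sym)

/-- A (simple) isometry of forms. -/
structure Isometry (v w : QuadForm Λ ε) where
  toEquiv : v.mod ≃ₗ[Λ] w.mod
  simple : IsSimple Z toEquiv
  pull_eq : w.ψ.pull toEquiv.toLinearMap = v.ψ

/-- An `ε`-quadratic quasi-formation `(M, ψ; L, V)`: a simple form with a simple Lagrangian `L` and a
based direct summand `V` of half rank. The based submodules `L` and `V` are given by based modules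
together with their inclusions into `M`. -/
structure QuasiFormation (Z : AddSubgroup (ReducedK1 Λ)) (ε : ℤˣ) where
  form : QuadForm Λ ε
  simple : form.IsSimple Z
  L : BasedModule Λ
  i : L →ₗ[Λ] form.mod
  lagr : form.IsSimpleLagrangian Z i
  V : BasedModule Λ
  j : V →ₗ[Λ] form.mod
  split : ∃ r : form.mod →ₗ[Λ] V, r.comp j = LinearMap.id
  half : 2 * rank Λ V = form.rank

variable {Z}

theorem QuadForm.IsSimple.sum {v w : QuadForm Λ ε} (hv : v.IsSimple Z) (hw : w.IsSimple Z) :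
    (v.sum w).IsSimple Z := by
  obtain ⟨φ, h, hs⟩ := hv
  obtain ⟨φ', h', hs'⟩ := hw
  refine ⟨(φ.prodCongr φ').trans (dualProd v.mod w.mod), ?_, (hs.prod hs').trans .dualProd⟩
  refine LinearMap.ext fun x => ?_
  rw [QuadForm.sum_sym_apply, ← h, ← h']
  rfl

theorem IsSimple.units (P : Type u) [AddCommGroup P] [Module Λ P] [Based Λ P] (ε : ℤˣ) :
    ∃ e : P ≃ₗ[Λ] P, IsSimple Z e ∧ ∀ x, e x = (ε : ℤ) • x := by
  rcases Int.units_eq_one_or ε with rfl | rfl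
  · exact ⟨.refl Λ P, .refl, by simp⟩
  · exact ⟨.neg Λ, .neg, by simp⟩

theorem QuadForm.hyp_isSimple (P : BasedModule Λ) : (QuadForm.hyp ε P).IsSimple Z := by
  obtain ⟨e, he, h⟩ := IsSimple.units (Z := Z) P ε
  refine ⟨(LinearEquiv.prodComm Λ P (Dual Λ P)).trans
    (((LinearEquiv.refl Λ (Dual Λ P)).prodCongr (e.trans (evEquiv Λ P))).trans
      (dualProd P (Dual Λ P))), ?_, IsSimple.prodComm.trans
        ((IsSimple.refl.prod (he.trans .evEquiv)).trans .dualProd)⟩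
  refine LinearMap.ext fun x => ?_
  rw [QuadForm.hyp_sym_apply]
  simp [h]

theorem QuadForm.IsSimpleLagrangian.sum {v w : QuadForm Λ ε} {L L' : BasedModule Λ}
    {i : L →ₗ[Λ] v.mod} {i' : L' →ₗ[Λ] w.mod} (h : v.IsSimpleLagrangian Z i)
    (h' : w.IsSimpleLagrangian Z i') :
    (v.sum w).IsSimpleLagrangian Z (L := .of Λ (L × L')) (i.prodMap i') := by
  obtain ⟨⟨⟨r, hr⟩, ha, hz⟩, e, hs, he, hp⟩ := h
  obtain ⟨⟨⟨r', hr'⟩, ha', hz'⟩, e', hs', he', hp'⟩ := h'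
  have hsym : ∀ x : v.mod × w.mod, (dualMap (i.prodMap i')) ((v.sum w).sym x) =
      dualProd L L' (dualMap i (v.sym x.1), dualMap i' (w.sym x.2)) := by
    intro x
    rw [QuadForm.sum_sym_apply]
    ext y
    rfl
  refine ⟨⟨⟨r.prodMap r', ?_⟩, ?_, ?_⟩, ?_⟩
  · rw [LinearMap.prodMap_comp, hr, hr']; rfl
  · ext x
    have h1 : x.1 ∈ LinearMap.range i ↔ dualMap i (v.sym x.1) = 0 := by rw [ha]; rfl
    have h2 : x.2 ∈ LinearMap.range i' ↔ dualMap i' (w.sym x.2) = 0 := by rw [ha']; rfl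
    rw [LinearMap.mem_ker, LinearMap.comp_apply, hsym, LinearEquiv.map_eq_zero_iff,
      Prod.mk_eq_zero, ← h1, ← h2, LinearMap.range_prodMap]
    rfl
  · have h1 : (LinearMap.fst Λ v.mod w.mod).comp (i.prodMap i') = i.comp (LinearMap.fst Λ L L') := rfl
    have h2 : (LinearMap.snd Λ v.mod w.mod).comp (i.prodMap i') = i'.comp (LinearMap.snd Λ L L') := rfl
    refine (map_add (QGroup.pull (i.prodMap i')) _ _).trans ?_
    rw [QGroup.pull_pull, QGroup.pull_pull, h1, h2, ← QGroup.pull_pull, ← QGroup.pull_pull, hz, hz']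
    simp
  · refine ⟨((LinearEquiv.refl Λ (L × L')).prodCongr (dualProd L L').symm).trans
      ((LinearEquiv.prodProdProdComm Λ L L' (Dual Λ L) (Dual Λ L')).trans (e.prodCongr e')),
      (IsSimple.refl.prod IsSimple.dualProd.symm).trans (IsSimple.prodProdProdComm.trans (hs.prod hs')),
      ?_, ?_⟩
    · intro a
      refine Prod.ext ?_ ?_
      · refine Eq.trans ?_ (he a.1)
        simp
      · refine Eq.trans ?_ (he' a.2)
        simp
    · intro a c
      obtain ⟨c, rfl⟩ := (dualProd L L').surjective c
      rw [LinearMap.comp_apply, hsym]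
      have h1 := hp a.1 c.1
      have h2 := hp' a.2 c.2
      rw [LinearMap.comp_apply] at h1 h2
      simp [h1, h2]

theorem rank_prod {M N : Type u} [AddCommGroup M] [Module Λ M] [AddCommGroup N] [Module Λ N]
    [Based Λ M] [Based Λ N] : rank Λ (M × N) = rank Λ M + rank Λ N := by
  have h1 : Fintype.card (Based.κ Λ (M × N)) =
    Fintype.card (Based.κ Λ M) + Fintype.card (Based.κ Λ N) := Fintype.card_sum
  have h2 : Fintype.card (Based.ι Λ (M × N)) =
    Fintype.card (Based.ι Λ M) + Fintype.card (Based.ι Λ N) := Fintype.card_sum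
  unfold rank
  rw [h1, h2]
  push_cast
  ring

theorem rank_dual {M : Type u} [AddCommGroup M] [Module Λ M] [Based Λ M] :
    rank Λ (Dual Λ M) = rank Λ M := rfl

namespace QuasiFormation

/-- The sum of two quasi-formations. -/
abbrev sum (x y : QuasiFormation Z ε) : QuasiFormation Z ε where
  form := x.form.sum y.form
  simple := x.simple.sum y.simple
  L := .of Λ (x.L × y.L)
  i := x.i.prodMap y.i
  lagr := x.lagr.sum y.lagr
  V := .of Λ (x.V × y.V)
  j := x.j.prodMap y.j
  split := by
    obtain ⟨r, hr⟩ := x.split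
    obtain ⟨r', hr'⟩ := y.split
    exact ⟨r.prodMap r', by rw [LinearMap.prodMap_comp, hr, hr']; rfl⟩
  half := by
    refine (congrArg (2 * ·) rank_prod).trans (Eq.trans ?_ rank_prod.symm)
    have h1 := x.half
    have h2 := y.half
    unfold QuadForm.rank at h1 h2
    linarith

theorem hyp_isSimpleLagrangian (P : BasedModule Λ) :
    (QuadForm.hyp ε P).IsSimpleLagrangian Z (LinearMap.inl Λ P (Dual Λ P)) := by
  have hsym : ∀ x : P × Dual Λ P,
      dualMap (LinearMap.inl Λ P (Dual Λ P)) ((QuadForm.hyp ε P).sym x) = x.2 := by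
    intro x
    rw [QuadForm.hyp_sym_apply]
    ext y
    simp
  refine ⟨⟨⟨LinearMap.fst Λ P (Dual Λ P), rfl⟩, ?_, ?_⟩, LinearEquiv.refl Λ _, .refl, fun a => rfl, ?_⟩
  · ext x
    rw [LinearMap.mem_ker, LinearMap.comp_apply, hsym, LinearMap.range_inl]
    rfl
  · have : Sesq.pull (LinearMap.inl Λ P (Dual Λ P)) (QuadForm.hypSesq P) = 0 := by
      ext x y
      simp
    refine (QGroup.pull_mk _ _).trans ?_
    rw [this, map_zero]
  · intro a c
    exact hsym (a, c)

/-- The trivial formation `(P, P^*) = (H_ε(P); P, P^*)`. -/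
abbrev triv (P : BasedModule Λ) : QuasiFormation Z ε where
  form := .hyp ε P
  simple := QuadForm.hyp_isSimple P
  L := P
  i := LinearMap.inl Λ P (Dual Λ P)
  lagr := hyp_isSimpleLagrangian P
  V := .of Λ (Dual Λ P)
  j := LinearMap.inr Λ P (Dual Λ P)
  split := ⟨LinearMap.snd Λ P (Dual Λ P), rfl⟩
  half := by
    refine Eq.trans ?_ (rank_prod (Λ := Λ) (M := P) (N := Dual Λ P)).symm
    change 2 * rank Λ (Dual Λ P) = _
    rw [rank_dual]
    ring

/-- Isomorphism of quasi-formations: an isometry that carries `L` to `L'` and `V` to `V'` and induces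
simple isomorphisms `L ≅ L'` and `V ≅ V'`. -/
def IsIsomorphic (x y : QuasiFormation Z ε) : Prop :=
  ∃ (f : Isometry Z x.form y.form) (g : x.L ≃ₗ[Λ] y.L) (h : x.V ≃ₗ[Λ] y.V),
    IsSimple Z g ∧ IsSimple Z h ∧
    (∀ a, f.toEquiv (x.i a) = y.i (g a)) ∧ ∀ a, f.toEquiv (x.j a) = y.j (h a)

/-- A simple formation: `V` is a simple Lagrangian too. -/
def IsSimpleFormation (x : QuasiFormation Z ε) : Prop := x.form.IsSimpleLagrangian Z x.j

/-- The congruence, with respect to direct sums, generated by isomorphisms, the addition of trivial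
formations, and `(M, ψ; K, L) ⊕ (M, ψ; L, V) ∼ (M, ψ; K, V)` for simple Lagrangians `K` and `L`. -/
inductive Rel : QuasiFormation Z ε → QuasiFormation Z ε → Prop
  | iso {x y : QuasiFormation Z ε} : x.IsIsomorphic y → Rel x y
  | stab (x : QuasiFormation Z ε) (P : BasedModule Λ) : Rel (x.sum (triv P)) x
  | shift (v : QuadForm Λ ε) (hv : v.IsSimple Z) {K L V : BasedModule Λ}
      (k : K →ₗ[Λ] v.mod) (hk : v.IsSimpleLagrangian Z k)
      (i : L →ₗ[Λ] v.mod) (hi : v.IsSimpleLagrangian Z i)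
      (j : V →ₗ[Λ] v.mod) (hj : ∃ r : v.mod →ₗ[Λ] V, r.comp j = LinearMap.id)
      (hL : 2 * rank Λ L = v.rank) (hV : 2 * rank Λ V = v.rank) :
      Rel ((QuasiFormation.mk v hv K k hk L i hi.isLagrangian.split hL).sum
        (QuasiFormation.mk v hv L i hi V j hj hV)) (QuasiFormation.mk v hv K k hk V j hj hV)
  | sum {x x' y y' : QuasiFormation Z ε} : Rel x x' → Rel y y' → Rel (x.sum y) (x'.sum y')
  | refl (x : QuasiFormation Z ε) : Rel x x
  | symm {x y : QuasiFormation Z ε} : Rel x y → Rel y x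
  | trans {x y z : QuasiFormation Z ε} : Rel x y → Rel y z → Rel x z

theorem sum_comm (x y : QuasiFormation Z ε) : (x.sum y).IsIsomorphic (y.sum x) := by
  refine ⟨⟨LinearEquiv.prodComm Λ x.form.mod y.form.mod, .prodComm, ?_⟩,
    LinearEquiv.prodComm Λ x.L y.L, LinearEquiv.prodComm Λ x.V y.V, .prodComm, .prodComm,
    fun a => rfl, fun a => rfl⟩
  refine (map_add (QGroup.pull _) _ _).trans ?_
  rw [QGroup.pull_pull, QGroup.pull_pull, add_comm]
  rfl

theorem sum_assoc (x y z : QuasiFormation Z ε) :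
    ((x.sum y).sum z).IsIsomorphic (x.sum (y.sum z)) := by
  refine ⟨⟨LinearEquiv.prodAssoc Λ x.form.mod y.form.mod z.form.mod, .prodAssoc, ?_⟩,
    LinearEquiv.prodAssoc Λ x.L y.L z.L, LinearEquiv.prodAssoc Λ x.V y.V z.V, .prodAssoc,
    .prodAssoc, fun a => rfl, fun a => rfl⟩
  simp only [sum, QuadForm.sum, map_add, QGroup.pull_pull, add_assoc]
  rfl

end QuasiFormation

/-- The equivalence relation that defines `l_{2q+1}(Λ)`. -/
def lSetoid (Z : AddSubgroup (ReducedK1 Λ)) (ε : ℤˣ) : Setoid (QuasiFormation Z ε) :=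
  ⟨QuasiFormation.Rel, .refl, .symm, .trans⟩

/-- The monoid `l_{2q+1}(Λ)`, with `ε = (-1)^q`. -/
def LMonoid (Z : AddSubgroup (ReducedK1 Λ)) (ε : ℤˣ) : Type (u + 1) := Quotient (lSetoid Z ε)

/-- The class `[x] ∈ l_{2q+1}(Λ)` of a quasi-formation. -/
def LMonoid.mk (x : QuasiFormation Z ε) : LMonoid Z ε := Quotient.mk (lSetoid Z ε) x

instance : Add (LMonoid Z ε) :=
  ⟨Quotient.map₂ QuasiFormation.sum fun _ _ h _ _ h' => QuasiFormation.Rel.sum h h'⟩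

instance : Zero (LMonoid Z ε) := ⟨LMonoid.mk (QuasiFormation.triv (.of Λ (Fin 0 → Λ)))⟩

instance : AddCommMonoid (LMonoid Z ε) where
  add_assoc := by
    rintro ⟨x⟩ ⟨y⟩ ⟨z⟩
    exact Quotient.sound (.iso (QuasiFormation.sum_assoc x y z))
  add_comm := by
    rintro ⟨x⟩ ⟨y⟩
    exact Quotient.sound (.iso (QuasiFormation.sum_comm x y))
  zero_add := by
    rintro ⟨x⟩
    exact Quotient.sound (.trans (.iso (QuasiFormation.sum_comm _ x)) (.stab x _))
  add_zero := by
    rintro ⟨x⟩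
    exact Quotient.sound (.stab x _)
  nsmul := nsmulRec

theorem LMonoid.mk_add_mk (x y : QuasiFormation Z ε) :
    LMonoid.mk x + LMonoid.mk y = LMonoid.mk (x.sum y) := rfl

/-- The subset `L^s_{2q+1}(Λ)` of `l_{2q+1}(Λ)` of all classes of simple formations. -/
def LOddSimple (Z : AddSubgroup (ReducedK1 Λ)) (ε : ℤˣ) : Set (LMonoid Z ε) :=
  {ξ | ∃ x : QuasiFormation Z ε, x.IsSimpleFormation ∧ ξ = .mk x}

end Forms

/-! ### Stable classes of forms -/

section StableForms

variable {Λ : Type u} [Ring Λ] [StarRing Λ] [InvariantBasisNumber Λ]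

/-- The based module `Λ^k` with its standard basis. -/
abbrev freeMod (Λ : Type u) [Ring Λ] (k : ℕ) : BasedModule Λ := .of Λ (Fin k → Λ)

/-- The set `F^zs_{2q}(Λ)` of `0`-stabilised forms: `v` and `w` are equivalent if
`v ⊕ (P, 0) ≅ w ⊕ (Q, 0)` for some based modules `P` and `Q`. -/
def ZeroStab (Z : AddSubgroup (ReducedK1 Λ)) (ε : ℤˣ) : Type (u + 1) :=
  Quot fun v w : QuadForm Λ ε => ∃ P Q : BasedModule Λ,
    Nonempty (Isometry Z (v.sum (.zero P)) (w.sum (.zero Q)))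

/-- The `0`-stabilised form `[v]`. -/
def ZeroStab.mk (Z : AddSubgroup (ReducedK1 Λ)) {ε : ℤˣ} (v : QuadForm Λ ε) : ZeroStab Z ε :=
  Quot.mk _ v

/-- `v ∼ v'`: the forms have the same rank and `[v] + [H_ε(Λ^k)] = [v'] + [H_ε(Λ^k)]` for some `k`. -/
def StablyEquivalent (Z : AddSubgroup (ReducedK1 Λ)) {ε : ℤˣ} (v v' : QuadForm Λ ε) : Prop :=
  v.rank = v'.rank ∧
    ∃ k : ℕ, ZeroStab.mk Z (v.sum (.hyp ε (freeMod Λ k))) =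
      ZeroStab.mk Z (v'.sum (.hyp ε (freeMod Λ k)))

/-- The set `L^s_{2q}(Λ)`, with `ε = (-1)^q`, of stable isometry classes of simple forms. -/
def LEven (Z : AddSubgroup (ReducedK1 Λ)) (ε : ℤˣ) : Type (u + 1) :=
  Quot fun v w : {v : QuadForm Λ ε // v.IsSimple Z} => ∃ P Q : BasedModule Λ,
    Nonempty (Isometry Z (v.1.sum (.hyp ε P)) (w.1.sum (.hyp ε Q)))

/-- The class of a simple form in `L^s_{2q}(Λ)`. -/
def LEven.mk {Z : AddSubgroup (ReducedK1 Λ)} {ε : ℤˣ} (v : QuadForm Λ ε) (hv : v.IsSimple Z) :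
    LEven Z ε := Quot.mk _ ⟨v, hv⟩

/-- The zero element of `L^s_{2q}(Λ)` is the class of hyperbolic forms. -/
instance (Z : AddSubgroup (ReducedK1 Λ)) (ε : ℤˣ) : Zero (LEven Z ε) :=
  ⟨LEven.mk (.hyp ε (freeMod Λ 0)) (QuadForm.hyp_isSimple _)⟩

end StableForms

/-! ### Split formations, their isomorphisms and homotopies -/

section Split

variable {Λ : Type u} [Ring Λ] [StarRing Λ]

/-- The dual `Δ^* : B^* → A` of a map `Δ : A^* → B`, for a based module `A = A^{**}`. -/
def codual {A B : Type u} [AddCommGroup A] [Module Λ A] [Based Λ A] [AddCommGroup B] [Module Λ B]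
    [InvariantBasisNumber Λ] (Δ : Dual Λ A →ₗ[Λ] B) : Dual Λ B →ₗ[Λ] A :=
  (evEquiv Λ A).symm.toLinearMap.comp (dualMap Δ)

/-- The data `(F, ((γ, μ), θ) G)` of a split `(-ε)`-quadratic formation, with `θ ∈ Q_ε(G)`. (The sign
is normalised so that boundaries of `ε`-quadratic forms have parameter `ε`.) -/
structure SplitFormation (Λ : Type u) [Ring Λ] [StarRing Λ] (ε : ℤˣ) where
  F : BasedModule Λ
  G : BasedModule Λ
  γ : G →ₗ[Λ] F
  μ : G →ₗ[Λ] Dual Λ F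
  θ : QGroup Λ ε G

variable {ε : ℤˣ}

namespace SplitFormation

/-- The conditions on a simple split `(-ε)`-quadratic formation: `(γ, μ) : G → F ⊕ F^*` is the
inclusion of a simple Lagrangian of `H_{-ε}(F)`, and `γ^* μ = θ + ε θ^*`. -/
structure IsFormation [InvariantBasisNumber Λ] (Z : AddSubgroup (ReducedK1 Λ))
    (x : SplitFormation Λ ε) : Prop where
  lagr : (QuadForm.hyp (-ε) x.F).IsSimpleLagrangian Z (x.γ.prod x.μ)
  sym_eq : (dualMap x.γ).comp x.μ = x.θ.sym

/-- The direct sum of split formations. -/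
abbrev sum (x y : SplitFormation Λ ε) : SplitFormation Λ ε where
  F := .of Λ (x.F × y.F)
  G := .of Λ (x.G × y.G)
  γ := x.γ.prodMap y.γ
  μ := (dualProd x.F y.F).toLinearMap.comp (x.μ.prodMap y.μ)
  θ := x.θ.pull (LinearMap.fst Λ x.G y.G) + y.θ.pull (LinearMap.snd Λ x.G y.G)

/-- The trivial split formation `(P, P^*) = (P, ((0, 1), 0) P^*)`. -/
abbrev triv (P : BasedModule Λ) : SplitFormation Λ ε where
  F := P
  G := .of Λ (Dual Λ P)
  γ := 0
  μ := LinearMap.id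
  θ := 0

/-- The boundary `∂(V, θ) = (V, ((1, θ + ε θ^*), θ) V)` of an `ε`-quadratic form. -/
abbrev boundary (v : QuadForm Λ ε) : SplitFormation Λ ε where
  F := v.mod
  G := v.mod
  γ := LinearMap.id
  μ := v.sym
  θ := v.ψ

end SplitFormation

/-- A triple `(α, β, ν)` of isomorphisms `α : F ≅ F'`, `β : G ≅ G'` and an element
`ν ∈ Q_ε(F^*)`; see `SplitMap.IsIso` for the conditions that make it an isomorphism of split
formations. -/
structure SplitMap (x y : SplitFormation Λ ε) where
  α : x.F ≃ₗ[Λ] y.F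
  β : x.G ≃ₗ[Λ] y.G
  ν : QGroup Λ ε (Dual Λ x.F)

namespace SplitMap

variable {x y z x' y' : SplitFormation Λ ε}

/-- Isomorphisms of simple split `(-ε)`-quadratic formations. -/
structure IsIso [InvariantBasisNumber Λ] (Z : AddSubgroup (ReducedK1 Λ)) (f : SplitMap x y) :
    Prop where
  source : x.IsFormation Z
  target : y.IsFormation Z
  simple_α : IsSimple Z f.α
  simple_β : IsSimple Z f.β
  eqγ : f.α.toLinearMap.comp (x.γ + (evEquiv Λ x.F).symm.toLinearMap.comp
    ((adj f.ν.sym).comp x.μ)) = y.γ.comp f.β.toLinearMap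
  eqμ : (dualMap f.α.symm.toLinearMap).comp x.μ = y.μ.comp f.β.toLinearMap
  eqθ : x.θ + f.ν.pull x.μ = y.θ.pull f.β.toLinearMap

/-- The identity `(1, 1, 0)`. -/
def id (x : SplitFormation Λ ε) : SplitMap x x := ⟨.refl Λ _, .refl Λ _, 0⟩

/-- The composition `g ∘ f = (α' α, β' β, ν + α⁻¹ ν' α^{-*})`. -/
def comp (g : SplitMap y z) (f : SplitMap x y) : SplitMap x z where
  α := f.α.trans g.α
  β := f.β.trans g.β
  ν := f.ν + g.ν.pull (dualMap f.α.symm.toLinearMap)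

/-- The inverse `(α⁻¹, β⁻¹, -α ν α^*)`. -/
def symm (f : SplitMap x y) : SplitMap y x where
  α := f.α.symm
  β := f.β.symm
  ν := -f.ν.pull (dualMap f.α.toLinearMap)

/-- The direct sum of two maps. -/
def sum (f : SplitMap x y) (g : SplitMap x' y') : SplitMap (x.sum x') (y.sum y') where
  α := f.α.prodCongr g.α
  β := f.β.prodCongr g.β
  ν := f.ν.pull (dualMap (LinearMap.inl Λ x.F x'.F)) + g.ν.pull (dualMap (LinearMap.inr Λ x.F x'.F))

/-- The identification `(x ⊕ y) ⊕ z = x ⊕ (y ⊕ z)`. -/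
def assoc (x y z : SplitFormation Λ ε) : SplitMap ((x.sum y).sum z) (x.sum (y.sum z)) where
  α := LinearEquiv.prodAssoc Λ x.F y.F z.F
  β := LinearEquiv.prodAssoc Λ x.G y.G z.G
  ν := 0

/-- The boundary `∂h = (h, h, 0)` of an isometry. -/
def boundary {v w : QuadForm Λ ε} (h : v.mod ≃ₗ[Λ] w.mod) :
    SplitMap (SplitFormation.boundary v) (SplitFormation.boundary w) := ⟨h, h, 0⟩

/-- The reordering `(A ⊕ B) ⊕ C = (A ⊕ C) ⊕ B`. -/
def rightComm (A B C : Type u) [AddCommGroup A] [Module Λ A] [AddCommGroup B] [Module Λ B]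
    [AddCommGroup C] [Module Λ C] : ((A × B) × C) ≃ₗ[Λ] ((A × C) × B) :=
  (LinearEquiv.prodAssoc Λ A B C).trans (((LinearEquiv.refl Λ A).prodCongr
    (LinearEquiv.prodComm Λ B C)).trans (LinearEquiv.prodAssoc Λ A C B).symm)

/-- The identification `∂(w ⊕ r) ⊕ t = (∂w ⊕ t) ⊕ ∂r`. -/
def reorder (w r : QuadForm Λ ε) (t : SplitFormation Λ ε) :
    SplitMap ((SplitFormation.boundary (w.sum r)).sum t)
      (((SplitFormation.boundary w).sum t).sum (SplitFormation.boundary r)) where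
  α := rightComm w.mod r.mod t.F
  β := rightComm w.mod r.mod t.G
  ν := 0

/-- A homotopy between isomorphisms `f = (α, β, ν)` and `g = (α', β', ν')`: a homomorphism
`Δ : G^* → F'` with `β'^{-*} - β^{-*} = μ'^* Δ`, `α' - α = Δ μ^*` and
`α' ν' α'^* - α ν α^* = (-ε α' γ + Δ θ) Δ^*` in `Q_ε(F'^*)`. -/
def Homotopic [InvariantBasisNumber Λ] (f g : SplitMap x y) : Prop :=
  ∃ Δ : Dual Λ x.G →ₗ[Λ] y.F,
    dualMap g.β.symm.toLinearMap - dualMap f.β.symm.toLinearMap = (adj y.μ).comp Δ ∧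
    g.α.toLinearMap - f.α.toLinearMap = Δ.comp (adj x.μ) ∧
    g.ν.pull (dualMap g.α.toLinearMap) - f.ν.pull (dualMap f.α.toLinearMap) =
      -((ε : ℤ) • QGroup.mk ε (ev.comp (g.α.toLinearMap.comp (x.γ.comp (codual Δ))))) +
        x.θ.pull (codual Δ)

end SplitMap

variable [InvariantBasisNumber Λ] {Z : AddSubgroup (ReducedK1 Λ)}

/-- A stable isomorphism `y ⊕ (P, P^*) ≅ z ⊕ (P', P'^*)` of simple split formations. -/
structure StableIso (Z : AddSubgroup (ReducedK1 Λ)) (y z : SplitFormation Λ ε) where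
  P : BasedModule Λ
  P' : BasedModule Λ
  map : SplitMap (y.sum (.triv P)) (z.sum (.triv P'))
  isIso : map.IsIso Z

/-- For a map `f : y ⊕ u → z ⊕ w`, the map `(id_z ⊕ h) ∘ (f ⊕ id_{(R, R^*)}) ∘ (id_y ⊕ g)`. -/
def SplitMap.stabilise {y z u w t t' : SplitFormation Λ ε} (f : SplitMap (y.sum u) (z.sum w))
    (R : BasedModule Λ) (g : SplitMap t (u.sum (.triv R))) (h : SplitMap (w.sum (.triv R)) t') :
    SplitMap (y.sum t) (z.sum t') :=
  ((SplitMap.id z).sum h).comp ((SplitMap.assoc z w (.triv R)).comp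
    ((f.sum (SplitMap.id (.triv R))).comp ((SplitMap.assoc y u (.triv R)).symm.comp
      ((SplitMap.id y).sum g))))

/-- Stable homotopy of stable isomorphisms. -/
def StableIso.StablyHomotopic {y z : SplitFormation Λ ε} (f f' : StableIso Z y z) : Prop :=
  ∃ (P Q R R' : BasedModule Λ)
    (g : SplitMap (.triv P) ((SplitFormation.triv f.P).sum (.triv R)))
    (g' : SplitMap (.triv P) ((SplitFormation.triv f'.P).sum (.triv R')))
    (h : SplitMap ((SplitFormation.triv f.P').sum (.triv R)) (.triv Q))
    (h' : SplitMap ((SplitFormation.triv f'.P').sum (.triv R')) (.triv Q)),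
    g.IsIso Z ∧ g'.IsIso Z ∧ h.IsIso Z ∧ h'.IsIso Z ∧
      (f.map.stabilise R g h).Homotopic (f'.map.stabilise R' g' h')

/-! ### Boundary isomorphism sets -/

/-- Two stable isomorphisms `∂v → ∂v'` define the same boundary isomorphism if they are stably
homotopic, or if they differ by composition with `∂h` and `∂g⁻¹` for automorphisms `g` of `v` and
`h` of `v'`. -/
inductive BIsoRel (v v' : QuadForm Λ ε) : StableIso Z (.boundary v) (.boundary v') →
    StableIso Z (.boundary v) (.boundary v') → Prop
  | homotopy {f f' : StableIso Z (.boundary v) (.boundary v')} : f.StablyHomotopic f' →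
      BIsoRel v v' f f'
  | act (f : StableIso Z (.boundary v) (.boundary v')) (g : Isometry Z v v) (h : Isometry Z v' v')
      (hf : (((SplitMap.boundary h.toEquiv).sum (SplitMap.id (.triv f.P'))).comp
        (f.map.comp ((SplitMap.boundary g.toEquiv).symm.sum (SplitMap.id (.triv f.P))))).IsIso Z) :
      BIsoRel v v' f ⟨f.P, f.P', _, hf⟩

/-- The boundary isomorphism set `bIso(v, v')`: the orbits of `Aut(v) × Aut(v')` on the set of stable
homotopy classes of stable isomorphisms `∂v → ∂v'`. -/
def BIso (Z : AddSubgroup (ReducedK1 Λ)) (v v' : QuadForm Λ ε) : Type (u + 1) :=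
  Quot (BIsoRel (Z := Z) v v')

/-- The class of a stable isomorphism in `bIso(v, v')`. -/
def BIso.mk {v v' : QuadForm Λ ε} (f : StableIso Z (.boundary v) (.boundary v')) : BIso Z v v' :=
  Quot.mk _ f

/-- For a map `f : ∂w ⊕ t → ∂w' ⊕ t'`, a based module `R` and isometries `k : w ⊕ (R, 0) ≅ u` and
`l : w' ⊕ (R, 0) ≅ u'`, the map `∂l ∘ (f ⊕ ∂id_R) ∘ ∂k⁻¹ : ∂u ⊕ t → ∂u' ⊕ t'`. -/
def SplitMap.push {w w' u u' : QuadForm Λ ε} {t t' : SplitFormation Λ ε}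
    (f : SplitMap ((SplitFormation.boundary w).sum t) ((SplitFormation.boundary w').sum t'))
    (R : BasedModule Λ) (k : Isometry Z (w.sum (.zero R)) u) (l : Isometry Z (w'.sum (.zero R)) u') :
    SplitMap ((SplitFormation.boundary u).sum t) ((SplitFormation.boundary u').sum t') :=
  ((SplitMap.boundary l.toEquiv).sum (SplitMap.id t')).comp
    ((SplitMap.reorder w' (.zero R) t').symm.comp
      ((f.sum (SplitMap.id (.boundary (.zero R)))).comp
        ((SplitMap.reorder w (.zero R) t).comp
          ((SplitMap.boundary k.toEquiv).symm.sum (SplitMap.id t)))))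

/-- The form `v ⊕ (Λ^k, 0)`. -/
abbrev QuadForm.stab (v : QuadForm Λ ε) (k : ℕ) : QuadForm Λ ε := v.sum (.zero (freeMod Λ k))

/-- The stabilisation maps `bIso(v ⊕ (Λ^k, 0), v' ⊕ (Λ^k, 0)) → bIso(v ⊕ (Λ^n, 0), v' ⊕ (Λ^n, 0))`,
`[f] ↦ [f ⊕ ∂id_{Λ^m}]`, where `Λ^k ⊕ Λ^m` is identified with `Λ^n` by a simple isomorphism `e`. -/
inductive SBIsoRel (v v' : QuadForm Λ ε) : (Σ k : ℕ, BIso Z (v.stab k) (v'.stab k)) →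
    (Σ k : ℕ, BIso Z (v.stab k) (v'.stab k)) → Prop
  | stab {k m n : ℕ} (e : ((Fin k → Λ) × (Fin m → Λ)) ≃ₗ[Λ] (Fin n → Λ))
      (K : Isometry Z ((v.stab k).stab m) (v.stab n))
      (K' : Isometry Z ((v'.stab k).stab m) (v'.stab n))
      (hK : ∀ x a b, K.toEquiv ((x, a), b) = (x, e (a, b)))
      (hK' : ∀ x a b, K'.toEquiv ((x, a), b) = (x, e (a, b)))
      (f : StableIso Z (.boundary (v.stab k)) (.boundary (v'.stab k)))
      (hf : (f.map.push (freeMod Λ m) K K').IsIso Z) :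
      SBIsoRel v v' ⟨k, BIso.mk f⟩ ⟨n, BIso.mk ⟨f.P, f.P', _, hf⟩⟩

/-- The stable boundary isomorphism set `sbIso(v, v')`, the direct limit of the sets
`bIso(v ⊕ (Λ^k, 0), v' ⊕ (Λ^k, 0))`. -/
def SBIso (Z : AddSubgroup (ReducedK1 Λ)) (v v' : QuadForm Λ ε) : Type (u + 1) :=
  Quot (SBIsoRel (Z := Z) v v')

/-- The class in `sbIso(v, v')` of a stable isomorphism `∂(v ⊕ (Λ^k, 0)) → ∂(v' ⊕ (Λ^k, 0))`. -/
def SBIso.mk {v v' : QuadForm Λ ε} (k : ℕ)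
    (f : StableIso Z (.boundary (v.stab k)) (.boundary (v'.stab k))) : SBIso Z v v' :=
  Quot.mk _ ⟨k, BIso.mk f⟩

/-! ### The maps `b`, `κ` and `δ` -/

/-- The union `v ∪_f -v'` of `v = (V, θ)` and `-v' = (V', -θ')` along an isomorphism
`f = (α, β, ν) : ∂v ⊕ (P, P^*) → ∂v' ⊕ (P', P'^*)`. It is the form on `V ⊕ V'^*` with matrix
`(θ, 0; ε a, -s)`, where `a : V → V'` is the component of `α` and `s ∈ Q_ε(V'^*)` that of
`α ν α^*`. -/
def union {v v' : QuadForm Λ ε} {P P' : BasedModule Λ}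
    (f : SplitMap ((SplitFormation.boundary v).sum (.triv P))
      ((SplitFormation.boundary v').sum (.triv P'))) : QuadForm Λ ε where
  mod := .of Λ (v.mod × Dual Λ v'.mod)
  ψ := v.ψ.pull (LinearMap.fst Λ v.mod (Dual Λ v'.mod)) +
    (ε : ℤ) • QGroup.mk ε ((dualMap (LinearMap.snd Λ v.mod (Dual Λ v'.mod))).comp
      (ev.comp (((LinearMap.fst Λ v'.mod P').comp (f.α.toLinearMap.comp
        (LinearMap.inl Λ v.mod P))).comp (LinearMap.fst Λ v.mod (Dual Λ v'.mod))))) -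
    (f.ν.pull (dualMap ((LinearMap.fst Λ v'.mod P').comp f.α.toLinearMap))).pull
      (LinearMap.snd Λ v.mod (Dual Λ v'.mod))

/-- The graph of `κ : sbIso(v, v') → L^s_{2q}(Λ)`, `[f] ↦ [v ∪_f -v']`. -/
def IsKappa (v v' : QuadForm Λ ε) (η : SBIso Z v v') (c : LEven Z ε) : Prop :=
  ∃ (k : ℕ) (f : StableIso Z (.boundary (v.stab k)) (.boundary (v'.stab k)))
    (h : (union f.map).IsSimple Z), η = SBIso.mk k f ∧ c = LEven.mk (union f.map) h

/-- The annihilator `V^⊥ = Ker(j^* φ)` of `V` in a quasi-formation `(M, ψ; L, V)`, given by a based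
module `U` and the inclusion `k : U → M`. It is based so that `0 → V^⊥ → M → V^* → 0` is a based exact
sequence. -/
structure Annihilator (x : QuasiFormation Z ε) where
  U : BasedModule Λ
  k : U →ₗ[Λ] x.form.mod
  based : IsBasedExact Z k ((dualMap x.j).comp x.form.sym)

/-- The induced form `(V, θ)` of a quasi-formation `(M, ψ; L, V)`. -/
abbrev QuasiFormation.left (x : QuasiFormation Z ε) : QuadForm Λ ε := ⟨x.V, x.form.ψ.pull x.j⟩

/-- The form `(V^⊥, -θ^⊥)` of a quasi-formation `(M, ψ; L, V)`. -/
abbrev Annihilator.right {x : QuasiFormation Z ε} (A : Annihilator x) : QuadForm Λ ε :=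
  ⟨A.U, -x.form.ψ.pull A.k⟩

/-- The graph of `b : l_{2q+1}(Λ) → F^zs_{2q}(Λ) × F^zs_{2q}(Λ)`,
`[M, ψ; L, V] ↦ ([V, θ], [V^⊥, -θ^⊥])`. -/
def IsB (ξ : LMonoid Z ε) (c : ZeroStab Z ε × ZeroStab Z ε) : Prop :=
  ∃ (x : QuasiFormation Z ε) (A : Annihilator x),
    ξ = LMonoid.mk x ∧ c = (ZeroStab.mk Z x.left, ZeroStab.mk Z A.right)

/-- For a simple form `(M, ψ)` with symmetrisation `φ`, the isomorphism
`(1, φ, -φ^{-*} ψ φ^{-1}) : ∂(M, ψ) → (M, M^*)`. -/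
def SplitMap.ofSimple (m : QuadForm Λ ε) (φ : m.mod ≃ₗ[Λ] Dual Λ m.mod) :
    SplitMap (SplitFormation.boundary m) (SplitFormation.triv m.mod) :=
  ⟨.refl Λ _, φ, -m.ψ.pull φ.symm.toLinearMap⟩

/-- The choices for the construction of the isomorphism `f_j : ∂(V, θ) → ∂(V^⊥, -θ^⊥)` determined by
the inclusion `j : V → M` of a quasi-formation `(M, ψ; L, V)`: the annihilator `k : V^⊥ → M`, a
representative `ρ` of `ψ` and a section `σ` of `k^* φ : M → (V^⊥)^*`. They determine
the isometry `h : (V, θ) ⊕ H_ε(V^⊥) ≅ (V^⊥, -θ^⊥) ⊕ (M, ψ)`, which is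
`h(v, u, w) = (t, k(t) + σ(w) + j(v))` with `t = -σ^* φ^* j(v) + u - σ^* ρ^* σ(w)`. -/
structure GlueData (x : QuasiFormation Z ε) extends Annihilator x where
  ρ : Sesq Λ x.form.mod
  mk_ρ : QGroup.mk ε ρ = x.form.ψ
  σ : Dual Λ U →ₗ[Λ] x.form.mod
  section_σ : (dualMap k).comp (x.form.sym.comp σ) = LinearMap.id
  h : (x.V × (U × Dual Λ U)) ≃ₗ[Λ] (U × x.form.mod)
  h_fst : ∀ v u w, (h (v, (u, w))).1 =
    -codual σ (adj x.form.sym (x.j v)) + u - codual σ (adj ρ (σ w))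
  h_snd : ∀ v u w, (h (v, (u, w))).2 = k (h (v, (u, w))).1 + σ w + x.j v
  φ : x.form.mod ≃ₗ[Λ] Dual Λ x.form.mod
  coe_φ : φ.toLinearMap = x.form.sym
  φ' : (U × Dual Λ U) ≃ₗ[Λ] Dual Λ (U × Dual Λ U)
  coe_φ' : φ'.toLinearMap = (QuadForm.hyp ε U).sym

/-- The stable isomorphism `f_j : ∂(V, θ) ⊕ (M', M'^*) → ∂(V^⊥, -θ^⊥) ⊕ (M, M^*)`, where
`M' = V^⊥ ⊕ (V^⊥)^*`. -/
def GlueData.map {x : QuasiFormation Z ε} (d : GlueData x) :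
    SplitMap ((SplitFormation.boundary x.left).sum (.triv (.of Λ (d.U × Dual Λ d.U))))
      ((SplitFormation.boundary d.right).sum (.triv x.form.mod)) :=
  ((SplitMap.id (.boundary d.right)).sum (SplitMap.ofSimple x.form d.φ)).comp
    (SplitMap.comp
      (⟨d.h, d.h, 0⟩ : SplitMap
        ((SplitFormation.boundary x.left).sum (.boundary (.hyp ε d.U)))
        ((SplitFormation.boundary d.right).sum (.boundary x.form)))
      ((SplitMap.id (.boundary x.left)).sum (SplitMap.ofSimple (.hyp ε d.U) d.φ').symm))

/-- The graph of `δ : l_{2q+1}(v, v') → sbIso(v, v')`, which sends the class of `(M, ψ; L, W)` to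
`[∂l ∘ (f_j ⊕ ∂id_Q) ∘ ∂k⁻¹]`, for isometries `k : (W, σ) ⊕ (Q, 0) ≅ v ⊕ (Λ^p, 0)` and
`l : (W^⊥, -σ^⊥) ⊕ (Q, 0) ≅ v' ⊕ (Λ^p, 0)`. -/
def IsDelta (v v' : QuadForm Λ ε) (ξ : LMonoid Z ε) (η : SBIso Z v v') : Prop :=
  ∃ (x : QuasiFormation Z ε) (d : GlueData x) (Q : BasedModule Λ) (p : ℕ)
    (k : Isometry Z (x.left.sum (.zero Q)) (v.stab p))
    (l : Isometry Z (d.right.sum (.zero Q)) (v'.stab p)) (hf : (d.map.push Q k l).IsIso Z),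
    ξ = LMonoid.mk x ∧ η = SBIso.mk p ⟨_, _, d.map.push Q k l, hf⟩

end Split

end

end EpsQuad

/-! Quasi-formations and boundary isomorphisms are compared through one invariant: a map `j : V → M`
of a based module into a form, up to isomorphism and up to adding the standard inclusions `S ⊂
H_ε(S)`. This is the relation `Inclusion.StabIso`.

For a quasi-formation `(M, ψ; L, V)` the invariant forgets the Lagrangian. Every relation of the
monoid respects it (`QuasiFormation.Rel.stabIso`), and what is lost is exactly the action of
`L^s_{2q+1}`: if `K` and `L` are two Lagrangians next to the same `V`, the relation `(K, L) + (L, V)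
= (K, V)` writes the difference as a simple formation (`stabIso_of_add_eq`,
`exists_add_eq_of_stabIso`).

A stable isomorphism `f : ∂v → ∂v'` has as its invariant the inclusion of `V` in the union `v ∪_f
-v'`. The union is a simple form in which the annihilator of `V` is a copy of `V'` carrying `-θ'`.
Homotopic isomorphisms have unions related by a shear `(x, y) ↦ (x + δ y, y)`, and conversely an
isometry of this shape can be completed to a homotopy (`SplitMap.IsIso.homotopic_of_unionShear`). An
isometry of unions that fixes `V` and its annihilator pointwise is such a shear, so the union with
these two submodules determines `f` up to stable homotopy. Dividing by the automorphisms of `v` and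
`v'` leaves only the inclusion of `V`, and an element of `sbIso` is therefore determined by its
stable class (`SBIso.mk_eq_mk_iff`).

The union along `f_j` is `M` itself with `V` included by `j` (`GlueData.presents`), so `δ` preserves
the invariant. Hence two classes have the same image under `δ` precisely when they lie in one orbit.
The map `κ` keeps only the ambient form of the invariant. It vanishes on the image of `δ` because
`M` has a Lagrangian; conversely, if a union is stably hyperbolic, a Lagrangian of the hyperbolic
form makes the inclusion of `V` into a quasi-formation with the same invariant, which `δ` sends to
the given element. -/

namespace EpsQuad

noncomputable section

set_option linter.unusedSectionVars false

/-! ### Torsion of elementary and triangular isomorphisms; stable freeness. -/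

section Torsion

variable {Λ : Type u} [Ring Λ] [InvariantBasisNumber Λ]
variable {M N P M' N' : Type u} [AddCommGroup M] [Module Λ M] [AddCommGroup N] [Module Λ N]
  [AddCommGroup P] [Module Λ P] [AddCommGroup M'] [Module Λ M'] [AddCommGroup N'] [Module Λ N']
  [Based Λ M] [Based Λ N] [Based Λ P] [Based Λ M'] [Based Λ N']
variable {Z : AddSubgroup (ReducedK1 Λ)}

/-- The elementary automorphism `(m, n) ↦ (m, n + f m)`. -/
def shear (f : M →ₗ[Λ] N) : (M × N) ≃ₗ[Λ] (M × N) where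
  toFun x := (x.1, x.2 + f x.1)
  invFun x := (x.1, x.2 - f x.1)
  map_add' x y := by ext <;> simp; abel
  map_smul' c x := by ext <;> simp
  left_inv x := by simp
  right_inv x := by simp

@[simp] theorem shear_apply (f : M →ₗ[Λ] N) (x : M × N) : shear f x = (x.1, x.2 + f x.1) := rfl

/-- After adding a second copy of `N` the shear is a commutator of two elementary automorphisms: `a`
adds `f m` to the new coordinate and `b` adds the new coordinate to the old one. Torsion takes
values in an abelian group, so it vanishes on commutators. -/
theorem torsion_shear (f : M →ₗ[Λ] N) : torsion (shear f) = 0 := by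
  let A := LinearEquiv.prodAssoc Λ M N N
  let a : ((M × N) × N) ≃ₗ[Λ] ((M × N) × N) := shear (f.comp (LinearMap.fst Λ M N))
  let b : ((M × N) × N) ≃ₗ[Λ] ((M × N) × N) :=
    A.trans (((LinearEquiv.refl Λ M).prodCongr ((LinearEquiv.prodComm Λ N N).trans
      ((shear LinearMap.id).trans (LinearEquiv.prodComm Λ N N)))).trans A.symm)
  have h : (shear f).prodCongr (LinearEquiv.refl Λ N) =
      a.symm.trans (b.symm.trans (a.trans b)) := by
    refine LinearEquiv.ext fun x => ?_
    obtain ⟨⟨m, n⟩, n'⟩ := x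
    change ((m, n + f m), n') = _
    have h1 : a.symm ((m, n), n') = ((m, n), n' - f m) := rfl
    have h2 : b.symm ((m, n), n' - f m) = ((m, n - (n' - f m)), n' - f m) := rfl
    have h3 : a ((m, n - (n' - f m)), n' - f m) = ((m, n - (n' - f m)), n') := by simp [a]
    have h4 : b ((m, n - (n' - f m)), n') = ((m, n - (n' - f m) + n'), n') := rfl
    rw [LinearEquiv.trans_apply, LinearEquiv.trans_apply, LinearEquiv.trans_apply, h1, h2, h3, h4]
    ext <;> simp
    abel
  have h2 := congrArg torsion h
  simpa [torsion_prod, torsion_trans, torsion_symm, torsion_refl] using h2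

theorem IsSimple.shear (f : M →ₗ[Λ] N) : IsSimple Z (shear f) := by
  rw [IsSimple, torsion_shear]; exact Z.zero_mem

theorem IsSimple.of_prod_left {f : M ≃ₗ[Λ] M'} {g : N ≃ₗ[Λ] N'} (h : IsSimple Z (f.prodCongr g))
    (hg : IsSimple Z g) : IsSimple Z f := by
  rw [IsSimple, torsion_prod] at h
  exact (Z.add_mem_cancel_right hg).1 h

/-- The diagonal block of a simple triangular isomorphism is simple if the other diagonal block is. -/
theorem IsSimple.exists_of_triangular {e : (M × N) ≃ₗ[Λ] (M' × N')} (he : IsSimple Z e)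
    {d : N ≃ₗ[Λ] N'} (hd : IsSimple Z d) (h : ∀ m n, (e (m, n)).2 = d n) :
    ∃ b : M ≃ₗ[Λ] M', IsSimple Z b ∧ ∀ m, e (m, 0) = (b m, 0) := by
  have h0 (m : M) : (e (m, 0)).2 = 0 := by rw [h, map_zero]
  have h1 (m' : M') : (e.symm (m', 0)).2 = 0 := by
    have := h (e.symm (m', 0)).1 (e.symm (m', 0)).2
    rw [Prod.mk.eta, e.apply_symm_apply] at this
    exact (d.map_eq_zero_iff).1 this.symm
  let b : M ≃ₗ[Λ] M' := LinearEquiv.ofLinearMap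
    ((LinearMap.fst Λ M' N').comp (e.toLinearMap.comp (LinearMap.inl Λ M N)))
    ((LinearMap.fst Λ M N).comp (e.symm.toLinearMap.comp (LinearMap.inl Λ M' N')))
    (by
      ext m'
      have : ((e.symm (m', 0)).1, (0 : N)) = e.symm (m', 0) := Prod.ext rfl (h1 m').symm
      simp [this])
    (by
      ext m
      have : ((e (m, 0)).1, (0 : N')) = e (m, 0) := Prod.ext rfl (h0 m).symm
      simp [this])
  have hb (m : M) : e (m, 0) = (b m, 0) := Prod.ext rfl (h0 m)
  refine ⟨b, ?_, hb⟩
  let q : N →ₗ[Λ] M' := (LinearMap.fst Λ M' N').comp (e.toLinearMap.comp (LinearMap.inr Λ M N))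
  -- The off-diagonal block `q` is removed by a shear of trivial torsion, so the block diagonal map
  -- is as simple as `e`.
  have key : b.prodCongr d = e.trans ((LinearEquiv.prodComm Λ M' N').trans
      ((EpsQuad.shear (-(q.comp d.symm.toLinearMap))).trans (LinearEquiv.prodComm Λ N' M'))) := by
    refine LinearEquiv.ext fun x => ?_
    obtain ⟨m, n⟩ := x
    have hx : e (m, n) = (b m + q n, d n) := by
      refine Prod.ext ?_ (h m n)
      have : (m, n) = (m, 0) + (0, n) := by simp
      rw [this, map_add, hb]
      rfl
    simp [hx]
  refine IsSimple.of_prod_left (Z := Z) (g := d) ?_ hd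
  rw [key]
  exact he.trans (IsSimple.prodComm.trans ((IsSimple.shear _).trans .prodComm))

/-- Elimination of a common summand on which an isomorphism restricts to an isomorphism. -/
theorem IsSimple.exists_schur {e : (M × N) ≃ₗ[Λ] (M' × N')} (he : IsSimple Z e)
    {d : N ≃ₗ[Λ] N'} (hd : IsSimple Z d) (h : ∀ n, (e (0, n)).2 = d n) :
    ∃ b : M ≃ₗ[Λ] M', IsSimple Z b ∧ ∀ m, e (m, -d.symm (e (m, 0)).2) = (b m, 0) := by
  -- The shear by `p` is the column operation that clears the block `M → N'`, which reduces the
  -- claim to the triangular case.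
  let p : M →ₗ[Λ] N := -(d.symm.toLinearMap.comp ((LinearMap.snd Λ M' N').comp
    (e.toLinearMap.comp (LinearMap.inl Λ M N))))
  have hp (m : M) : p m = -d.symm (e (m, 0)).2 := rfl
  obtain ⟨b, hb, h'⟩ := IsSimple.exists_of_triangular (Z := Z) (e := (EpsQuad.shear p).trans e)
    ((IsSimple.shear p).trans he) hd (fun m n => by
      have : ((m, n + p m) : M × N) = (m, 0) + (0, n) + (0, p m) := by simp
      rw [LinearEquiv.trans_apply, shear_apply, this, map_add, map_add, Prod.snd_add, Prod.snd_add,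
        h, h, hp]
      simp)
  refine ⟨b, hb, fun m => ?_⟩
  rw [← h', ← hp]
  simp

/-- Isomorphisms preserve the rank. -/
theorem rank_eq_of_equiv (f : M ≃ₗ[Λ] N) : rank Λ M = rank Λ N := by
  have h := card_eq_of_linearEquiv Λ (torsionIso f)
  simp only [Fintype.card_sum] at h
  unfold rank
  omega

theorem rank_free (n : ℕ) : rank Λ (Fin n → Λ) = n := by
  have h1 : Fintype.card (Based.κ Λ (Fin n → Λ)) = n := Fintype.card_fin n
  have h2 : Fintype.card (Based.ι Λ (Fin n → Λ)) = 0 := Fintype.card_empty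
  unfold rank
  rw [h1, h2]
  simp

theorem torsion_reindex {κ κ' : Type} [Fintype κ] [DecidableEq κ] [Fintype κ'] [DecidableEq κ']
    (s : κ ≃ κ') : torsion (reindex s : (κ → Λ) ≃ₗ[Λ] (κ' → Λ)) = 0 := by
  refine torsion_of_compat _ (Equiv.refl Empty) s fun m a => ?_
  rfl

theorem torsion_sumArrow (κ κ' : Type) [Fintype κ] [DecidableEq κ] [Fintype κ'] [DecidableEq κ'] :
    torsion (LinearEquiv.sumArrowLequivProdArrow κ κ' Λ Λ) = 0 := by
  refine torsion_of_compat _ (Equiv.equivOfIsEmpty Empty (Empty ⊕ Empty)) (Equiv.refl _) fun m a => ?_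
  ext (k | k) <;> rfl

/-- The preferred `s`-basis is a simple isomorphism. -/
theorem torsion_basis :
    torsion (Based.basis : (M × (Based.ι Λ M → Λ)) ≃ₗ[Λ] (Based.κ Λ M → Λ)) = 0 := by
  let b : (M × (Based.ι Λ M → Λ)) ≃ₗ[Λ] (Based.κ Λ M → Λ) := Based.basis
  -- The matrix that defines the torsion of the `s`-basis `b` is not an identity: the stabilising
  -- copy of `Λ^ι` takes the place of the one inside the domain. It is the conjugate by `b ⊕ 1` of
  -- the swap of the two copies, hence has the torsion of a permutation.
  let sw : ((M × (Based.ι Λ M → Λ)) × (Based.ι Λ M → Λ)) ≃ₗ[Λ]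
      ((M × (Based.ι Λ M → Λ)) × (Based.ι Λ M → Λ)) :=
    shuffle (Based.ι Λ M → Λ) (Based.ι Λ M → Λ) (LinearEquiv.refl Λ M)
  have hsw : torsion sw = 0 := by
    have : sw = (LinearEquiv.prodAssoc Λ _ _ _).trans (((LinearEquiv.refl Λ M).prodCongr
      (LinearEquiv.prodComm Λ _ _)).trans (LinearEquiv.prodAssoc Λ _ _ _).symm) := rfl
    have h1 : torsion (LinearEquiv.prodComm Λ (Based.ι Λ M → Λ) (Based.ι Λ M → Λ)) = 0 := by
      refine torsion_of_compat _ (Equiv.sumComm _ _) (Equiv.sumComm _ _) fun m a => ?_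
      ext (k | k) <;> rfl
    rw [this, torsion_trans, torsion_trans, torsion_symm, torsion_prod, torsion_refl, h1]
    simp
  let bb := b.prodCongr (LinearEquiv.refl Λ (Based.ι Λ M → Λ))
  let f := bb.symm.trans (sw.trans bb)
  have hf : torsion f = 0 := by
    change torsion (bb.symm.trans (sw.trans bb)) = 0
    rw [torsion_trans, torsion_trans, torsion_symm, hsw]
    simp
  let s : (Based.κ Λ M ⊕ Based.ι Λ M) ⊕ Empty ≃
      (Based.κ Λ M ⊕ Based.ι Λ M) ⊕ (Empty ⊕ Empty) :=
    (Equiv.refl _).sumCongr (Equiv.equivOfIsEmpty _ _)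
  let t : (Based.κ Λ M ⊕ Based.ι Λ M) ⊕ (Empty ⊕ Empty) ≃
      Based.κ Λ M ⊕ (Based.ι Λ M ⊕ Empty) :=
    ((Equiv.refl _).sumCongr (Equiv.equivOfIsEmpty _ _)).trans (Equiv.sumAssoc _ _ Empty)
  have h : torsionIso b = (reindex s).trans ((torsionIso f).trans (reindex t)) := by
    refine LinearEquiv.ext fun x => funext fun k => ?_
    rcases k with k | (k | k)
    · rfl
    · rfl
    · exact k.elim
  change tau (torsionIso b) = 0
  rw [h, tau_trans, tau_trans, tau_reindex, tau_reindex, zero_add, add_zero]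
  exact hf

theorem IsSimple.basis :
    IsSimple Z (Based.basis : (M × (Based.ι Λ M → Λ)) ≃ₗ[Λ] (Based.κ Λ M → Λ)) := by
  rw [IsSimple, torsion_basis]; exact Z.zero_mem

/-- `Λ^k ⊕ Λ^m = Λ^n` for `k + m = n`. -/
theorem IsSimple.exists_free_sum {k m n : ℕ} (h : k + m = n) :
    ∃ e : ((Fin k → Λ) × (Fin m → Λ)) ≃ₗ[Λ] (Fin n → Λ), IsSimple Z e := by
  subst h
  refine ⟨(LinearEquiv.sumArrowLequivProdArrow _ _ Λ Λ).symm.trans (reindex finSumFinEquiv), ?_⟩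
  rw [IsSimple, torsion_trans, torsion_symm, torsion_sumArrow, torsion_reindex]
  simp

variable (M) in
/-- A based module becomes a standard free module after the addition of a free module. -/
theorem IsSimple.exists_stably_free (Z : AddSubgroup (ReducedK1 Λ)) :
    ∃ n₀ : ℕ, ∀ t n : ℕ, n₀ ≤ t → rank Λ M + t = n →
      ∃ e : (M × (Fin t → Λ)) ≃ₗ[Λ] (Fin n → Λ), IsSimple Z e := by
  -- The threshold leaves room for the summand `Λ^ι` on which the `s`-basis of `M` lives; what
  -- remains of `Λ^t` is added to both sides.
  refine ⟨Fintype.card (Based.ι Λ M), fun t n ht hn => ?_⟩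
  obtain ⟨r, rfl⟩ := Nat.exists_eq_add_of_le ht
  obtain ⟨e₁, h₁⟩ := IsSimple.exists_free_sum (Λ := Λ) (Z := Z)
    (rfl : Fintype.card (Based.ι Λ M) + r = _)
  obtain ⟨e₂, h₂⟩ := IsSimple.exists_free_sum (Λ := Λ) (Z := Z)
    (show Fintype.card (Based.κ Λ M) + r = n by unfold rank at hn; push_cast at hn; omega)
  have hr {κ : Type} [Fintype κ] [DecidableEq κ] : IsSimple Z
      (reindex (Fintype.equivFin κ) : (κ → Λ) ≃ₗ[Λ] _) := by
    rw [IsSimple, torsion_reindex]; exact Z.zero_mem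
  refine ⟨((LinearEquiv.refl Λ M).prodCongr e₁.symm).trans
    ((LinearEquiv.prodAssoc Λ M _ _).symm.trans
      (((((LinearEquiv.refl Λ M).prodCongr (reindex (Fintype.equivFin _)).symm).trans
        Based.basis).trans (reindex (Fintype.equivFin _))).prodCongr (.refl Λ _) |>.trans e₂)), ?_⟩
  exact (IsSimple.refl.prod h₁.symm).trans (IsSimple.prodAssoc.symm.trans
    (((((IsSimple.refl.prod hr.symm).trans .basis).trans hr).prod .refl).trans h₂))

end Torsion

/-! ### Torsion of dual isomorphisms. -/

section DualTorsion

variable {Λ : Type u} [Ring Λ] [StarRing Λ] [InvariantBasisNumber Λ]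
variable {M N : Type u} [AddCommGroup M] [Module Λ M] [AddCommGroup N] [Module Λ N]
  [Based Λ M] [Based Λ N]
variable {Z : AddSubgroup (ReducedK1 Λ)}

theorem ReducedK1.mk_one (n : ℕ) : ReducedK1.mk (1 : GLn Λ n) = 0 := by
  have := ReducedK1.mk_mul (1 : GLn Λ n) 1
  simpa using this

/-- The inverse conjugate transpose of a matrix with torsion in `Z` has torsion in `Z`. -/
theorem StarInvariant.tau_mem (hZ : StarInvariant Z) {ι κ : Type} [Fintype ι] [Fintype κ]
    {g g' : (ι → Λ) ≃ₗ[Λ] (κ → Λ)}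
    (h : ∀ x y, ∑ k, g x k * star (g' y k) = ∑ i, x i * star (y i)) (hg : tau g ∈ Z) :
    tau g' ∈ Z := by
  classical
  let s := Fintype.equivFin ι
  let t := (Fintype.equivFin κ).trans (finCongr (card_eq_of_linearEquiv Λ g).symm)
  rw [tau_eq _ s t] at hg ⊢
  unfold tauAux at hg ⊢
  set G : GLn Λ _ := (reindex s.symm).trans (g.trans (reindex t))
  set G' : GLn Λ _ := (reindex s.symm).trans (g'.trans (reindex t))
  have hGG (x y : Fin (Fintype.card ι) → Λ) :
      ∑ k, G x k * star (G' y k) = ∑ i, x i * star (y i) := by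
    have h1 := h (reindex s.symm x) (reindex s.symm y)
    refine (Equiv.sum_comp t _).symm.trans (Eq.trans ?_ (Equiv.sum_comp s _))
    simpa [G, G'] using h1
  -- The pairing identity says that `G'⁻¹` is the conjugate transpose of `G`, so `*`-invariance
  -- applies to it, and `G'` has the opposite class.
  have h2 := hZ _ G G'⁻¹ (fun i j => by
    have := hGG (Pi.single j 1) (G'⁻¹ (Pi.single i 1))
    rw [show G' (G'⁻¹ (Pi.single i 1)) = Pi.single i 1 from G'.apply_symm_apply _] at this
    have h3 := congrArg star this
    simpa [Pi.single_apply] using h3.symm) hg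
  have h4 := ReducedK1.mk_mul G' G'⁻¹
  rw [mul_inv_cancel, ReducedK1.mk_one] at h4
  rw [eq_neg_of_add_eq_zero_left h4.symm]
  exact Z.neg_mem h2

/-- The dual `s`-bases are characterised by the evaluation pairing, and `f` together with `dualEquiv
f` preserves it. Their matrices are therefore inverse conjugate transposes of each other. This is
how the `*`-invariance of `Z` enters the argument. -/
theorem IsSimple.dual (hZ : StarInvariant Z) {f : M ≃ₗ[Λ] N} (hf : IsSimple Z f) :
    IsSimple Z (dualEquiv f) := by
  refine StarInvariant.tau_mem hZ (ι := Based.κ Λ M ⊕ Based.ι Λ N)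
    (κ := Based.κ Λ N ⊕ Based.ι Λ M) (g := torsionIso f) (g' := torsionIso (M := Dual Λ M) (N := Dual Λ N) (dualEquiv f))
    (fun x y => ?_) hf
  set X := (Based.basis (Λ := Λ) (M := M)).symm fun i => x (.inl i) with hX
  set Y := (Based.basis (Λ := Λ) (M := Dual Λ M)).symm fun i => y (.inl i) with hY
  have hX' : Based.basis X = fun i => x (.inl i) := LinearEquiv.apply_symm_apply _ _
  have hY' : Based.basis (M := Dual Λ M) Y = fun i => y (.inl i) := LinearEquiv.apply_symm_apply _ _
  have h1 := Based.dual_basis (Λ := Λ) (M := M) Y X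
  have h2 := Based.dual_basis (Λ := Λ) (M := N) (dualEquiv f Y.1, fun i => y (.inr i))
    (f X.1, fun i => x (.inr i))
  rw [hX', hY'] at h1
  rw [Fintype.sum_sum_type, Fintype.sum_sum_type]
  refine (congrArg₂ (· + ·) h2 rfl).trans ?_
  refine Eq.trans ?_ (congrArg₂ (· + ·) h1 rfl).symm
  rw [dualEquiv_apply, LinearEquiv.symm_apply_apply]
  exact add_right_comm _ _ _

end DualTorsion

/-! ### Calculus in the groups `Q_ε`. -/

section QGroupLemmas

variable {Λ : Type u} [Ring Λ] [StarRing Λ] {ε : ℤˣ}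
variable {M N P : Type u} [AddCommGroup M] [Module Λ M] [AddCommGroup N] [Module Λ N]
  [AddCommGroup P] [Module Λ P]

theorem eps_smul_eps_smul {A : Type*} [AddCommGroup A] (ε : ℤˣ) (x : A) :
    (ε : ℤ) • (ε : ℤ) • x = x := by
  rcases Int.units_eq_one_or ε with rfl | rfl <;> simp

theorem QGroup.mk_eq_mk_of {A B : Sesq Λ M} (χ : Sesq Λ M)
    (h : ∀ x y, A x y - B x y = χ x y - (ε : ℤ) • star (χ y x)) :
    QGroup.mk ε A = QGroup.mk ε B := by
  refine (QuotientAddGroup.eq).2 ⟨-χ, ?_⟩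
  ext x y
  have := h x y
  simp only [AddMonoidHom.sub_apply, AddMonoidHom.id_apply, map_neg, LinearMap.sub_apply,
    LinearMap.neg_apply, LinearMap.add_apply, Dual.sub_apply, Dual.neg_apply, Dual.add_apply,
    Teps_apply]
  rw [← sub_eq_zero] at this ⊢
  rw [← this]
  abel_nf

theorem QGroup.mk_Teps (A : Sesq Λ M) : QGroup.mk ε (Teps ε A) = QGroup.mk ε A := by
  refine QGroup.mk_eq_mk_of (-A) fun x y => ?_
  simp
  abel

theorem QGroup.sym_comm (ψ : QGroup Λ ε M) (x y : M) :
    ψ.sym x y = (ε : ℤ) • star (ψ.sym y x) := by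
  obtain ⟨ψ, rfl⟩ := QGroup.mk_surjective ε ψ
  rcases Int.units_eq_one_or ε with rfl | rfl <;> simp [add_comm]

theorem QGroup.sym_pull_apply (f : M →ₗ[Λ] N) (ψ : QGroup Λ ε N) (x y : M) :
    (QGroup.pull f ψ).sym x y = ψ.sym (f x) (f y) := by
  rw [QGroup.sym_pull]; rfl

@[simp] theorem QGroup.pull_id (ψ : QGroup Λ ε M) : QGroup.pull LinearMap.id ψ = ψ := by
  obtain ⟨ψ, rfl⟩ := QGroup.mk_surjective ε ψ
  rfl

@[simp] theorem QGroup.pull_zero_map (ψ : QGroup Λ ε N) :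
    QGroup.pull (0 : M →ₗ[Λ] N) ψ = 0 := by
  obtain ⟨ψ, rfl⟩ := QGroup.mk_surjective ε ψ
  refine (QGroup.pull_mk _ _).trans ?_
  have : Sesq.pull (0 : M →ₗ[Λ] N) ψ = 0 := by ext x y; simp
  rw [this, map_zero]

@[simp] theorem QGroup.pull_neg_map (f : M →ₗ[Λ] N) (ψ : QGroup Λ ε N) :
    QGroup.pull (-f) ψ = QGroup.pull f ψ := by
  obtain ⟨ψ, rfl⟩ := QGroup.mk_surjective ε ψ
  refine (QGroup.pull_mk _ _).trans ?_
  have : Sesq.pull (-f) ψ = Sesq.pull f ψ := by ext x y; simp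
  rw [this]; rfl

/-- The form `(x, y) ↦ φ (X x) (Y y)`. -/
def Sesq.cross (X Y : M →ₗ[Λ] N) (φ : Sesq Λ N) : Sesq Λ M := (dualMap Y).comp (φ.comp X)

@[simp] theorem Sesq.cross_apply (X Y : M →ₗ[Λ] N) (φ : Sesq Λ N) (x y : M) :
    Sesq.cross X Y φ x y = φ (X x) (Y y) := rfl

/-- The symmetrisation is `ε`-symmetric, so `T_ε` exchanges the two arguments of the cross term, and
`T_ε` is the identity on `Q_ε`. -/
theorem QGroup.mk_cross_comm (X Y : M →ₗ[Λ] N) (ψ : QGroup Λ ε N) :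
    QGroup.mk ε (Sesq.cross X Y ψ.sym) = QGroup.mk ε (Sesq.cross Y X ψ.sym) := by
  rw [← QGroup.mk_Teps]
  congr 1
  ext x y
  rw [Teps_apply, Sesq.cross_apply, Sesq.cross_apply, ← QGroup.sym_comm]

/-- Polarisation: of the two mixed terms of a representative, one becomes the `T_ε`-image of the
other modulo `1 - T_ε`, and together they make one cross term of the symmetrisation. -/
theorem QGroup.pull_add_map (X Y : M →ₗ[Λ] N) (ψ : QGroup Λ ε N) :
    QGroup.pull (X + Y) ψ = QGroup.pull X ψ + QGroup.pull Y ψ +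
      QGroup.mk ε (Sesq.cross X Y ψ.sym) := by
  obtain ⟨ψ, rfl⟩ := QGroup.mk_surjective ε ψ
  simp only [QGroup.pull_mk, ← map_add, QGroup.sym_mk]
  refine QGroup.mk_eq_mk_of (Sesq.cross Y X ψ) fun x y => ?_
  simp
  abel

theorem QGroup.pull_sub_map (X Y : M →ₗ[Λ] N) (ψ : QGroup Λ ε N) :
    QGroup.pull (X - Y) ψ = QGroup.pull X ψ + QGroup.pull Y ψ -
      QGroup.mk ε (Sesq.cross X Y ψ.sym) := by
  rw [sub_eq_add_neg, QGroup.pull_add_map, QGroup.pull_neg_map, sub_eq_add_neg, ← map_neg]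
  congr 2
  ext x y
  simp

/-- The identity of `M ⊕ N` is the sum of the two projections onto the summands; polarisation leaves
the two restrictions and one cross term, which only sees the symmetrisation. -/
theorem QGroup.prod_eq_zero {E : QGroup Λ ε (M × N)} (h1 : E.pull (LinearMap.inl Λ M N) = 0)
    (h2 : E.pull (LinearMap.inr Λ M N) = 0) (h3 : ∀ x y, E.sym (x, 0) (0, y) = 0) : E = 0 := by
  have h : (LinearMap.id : M × N →ₗ[Λ] M × N) = (LinearMap.inl Λ M N).comp (LinearMap.fst Λ M N) +
      (LinearMap.inr Λ M N).comp (LinearMap.snd Λ M N) := by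
    refine LinearMap.ext fun x => ?_
    simp
  rw [← QGroup.pull_id E, h, QGroup.pull_add_map, ← QGroup.pull_pull, ← QGroup.pull_pull, h1, h2]
  have : Sesq.cross ((LinearMap.inl Λ M N).comp (LinearMap.fst Λ M N))
      ((LinearMap.inr Λ M N).comp (LinearMap.snd Λ M N)) E.sym = 0 := by
    refine LinearMap.ext fun x => Dual.ext fun y => ?_
    exact h3 _ _
  rw [this]
  simp

/-- An element of `Q_ε(M ⊕ N)` is determined by its restrictions and by its symmetrisation. -/
theorem QGroup.prod_ext {E E' : QGroup Λ ε (M × N)}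
    (h1 : E.pull (LinearMap.inl Λ M N) = E'.pull (LinearMap.inl Λ M N))
    (h2 : E.pull (LinearMap.inr Λ M N) = E'.pull (LinearMap.inr Λ M N))
    (h3 : ∀ x y, E.sym (x, 0) (0, y) = E'.sym (x, 0) (0, y)) : E = E' := by
  refine sub_eq_zero.1 (QGroup.prod_eq_zero ?_ ?_ fun x y => ?_)
  · rw [map_sub, h1, sub_self]
  · rw [map_sub, h2, sub_self]
  · rw [map_sub]
    simp [h3]

variable [InvariantBasisNumber Λ]

theorem eq_of_dual [Based Λ M] {x y : M} (h : ∀ f : Dual Λ M, f x = f y) : x = y := by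
  refine (ev_bijective (Λ := Λ) (M := M)).1 ?_
  ext f
  simp [h]

theorem evEquiv_symm_spec [Based Λ M] (Φ : Dual Λ (Dual Λ M)) (f : Dual Λ M) :
    f ((evEquiv Λ M).symm Φ) = star (Φ f) := by
  have := DFunLike.congr_fun ((evEquiv Λ M).apply_symm_apply Φ) f
  rw [evEquiv_apply, ev_apply] at this
  rw [← this, star_star]

theorem apply_codual [Based Λ M] (Δ : Dual Λ M →ₗ[Λ] N) (y : Dual Λ N) (f : Dual Λ M) :
    f (codual Δ y) = star (y (Δ f)) :=
  evEquiv_symm_spec _ _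

theorem codual_codual [Based Λ M] [Based Λ N] (Δ : Dual Λ M →ₗ[Λ] N) : codual (codual Δ) = Δ := by
  refine LinearMap.ext fun f => eq_of_dual (Λ := Λ) fun y => ?_
  rw [apply_codual, apply_codual, star_star]

end QGroupLemmas

/-! ### Isometries of forms. -/

section Forms

variable {Λ : Type u} [Ring Λ] [StarRing Λ] {ε : ℤˣ}

theorem QuadForm.sym_comm (v : QuadForm Λ ε) (x y : v.mod) :
    v.sym x y = (ε : ℤ) • star (v.sym y x) := QGroup.sym_comm _ _ _

theorem QuadForm.sum_sym (v w : QuadForm Λ ε) (x y : v.mod × w.mod) :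
    (v.sum w).sym x y = v.sym x.1 y.1 + w.sym x.2 y.2 := by
  rw [QuadForm.sum_sym_apply]; rfl

theorem QuadForm.hyp_sym (P : BasedModule Λ) (x y : P × Dual Λ P) :
    (QuadForm.hyp ε P).sym x y = x.2 y.1 + (ε : ℤ) • star (y.2 x.1) := by
  rw [QuadForm.hyp_sym_apply]; rfl

variable [InvariantBasisNumber Λ] {Z : AddSubgroup (ReducedK1 Λ)}

namespace Isometry

variable {u v w x : QuadForm Λ ε}

theorem sym_eq (e : Isometry Z v w) (x y : v.mod) :
    w.sym (e.toEquiv x) (e.toEquiv y) = v.sym x y := by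
  have := congrArg QGroup.sym e.pull_eq
  rw [QGroup.sym_pull] at this
  exact DFunLike.congr_fun (LinearMap.congr_fun this x) y

/-- The identity isometry. -/
def refl (Z : AddSubgroup (ReducedK1 Λ)) (v : QuadForm Λ ε) : Isometry Z v v :=
  ⟨LinearEquiv.refl Λ _, .refl, QGroup.pull_id _⟩

/-- The composition of isometries. -/
def trans (e : Isometry Z u v) (f : Isometry Z v w) : Isometry Z u w :=
  ⟨e.toEquiv.trans f.toEquiv, e.simple.trans f.simple, by
    rw [← e.pull_eq, ← f.pull_eq, QGroup.pull_pull]; rfl⟩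

/-- The inverse isometry. -/
def symm (e : Isometry Z u v) : Isometry Z v u :=
  ⟨e.toEquiv.symm, e.simple.symm, by
    rw [← e.pull_eq, QGroup.pull_pull, LinearEquiv.comp_coe, LinearEquiv.symm_trans_self]
    exact QGroup.pull_id _⟩

/-- The sum of isometries. -/
def sum (e : Isometry Z u v) (f : Isometry Z w x) : Isometry Z (u.sum w) (v.sum x) :=
  ⟨e.toEquiv.prodCongr f.toEquiv, e.simple.prod f.simple, by
    simp only [map_add, QGroup.pull_pull]
    rw [← e.pull_eq, ← f.pull_eq, QGroup.pull_pull, QGroup.pull_pull]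
    rfl⟩

@[simp] theorem trans_apply (e : Isometry Z u v) (f : Isometry Z v w) (x : u.mod) :
    (e.trans f).toEquiv x = f.toEquiv (e.toEquiv x) := rfl
@[simp] theorem symm_toEquiv (e : Isometry Z u v) : e.symm.toEquiv = e.toEquiv.symm := rfl

variable (u v w x)

/-- Associativity of the sum of forms. -/
def sumAssoc : Isometry Z ((u.sum v).sum w) (u.sum (v.sum w)) :=
  ⟨LinearEquiv.prodAssoc Λ _ _ _, .prodAssoc, by
    simp only [QuadForm.sum, map_add, QGroup.pull_pull, add_assoc]
    rfl⟩

/-- Commutativity of the sum of forms. -/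
def sumComm : Isometry Z (u.sum v) (v.sum u) :=
  ⟨LinearEquiv.prodComm Λ _ _, .prodComm, by
    simp only [QuadForm.sum, map_add, QGroup.pull_pull, add_comm]
    rfl⟩

/-- Interchange of summands. -/
def sumSumSumComm : Isometry Z ((u.sum v).sum (w.sum x)) ((u.sum w).sum (v.sum x)) :=
  ⟨LinearEquiv.prodProdProdComm Λ _ _ _ _, .prodProdProdComm, by
    simp only [QuadForm.sum, map_add, QGroup.pull_pull]
    rw [add_add_add_comm]
    rfl⟩

/-- Interchange of the last two summands. -/
def sumRightComm : Isometry Z ((u.sum v).sum w) ((u.sum w).sum v) :=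
  (sumAssoc u v w).trans (((refl Z u).sum (sumComm v w)).trans (sumAssoc u w v).symm)

end Isometry

/-- A simple isomorphism induces an isometry of zero forms. -/
def Isometry.zero {S T : BasedModule Λ} (e : S ≃ₗ[Λ] T) (he : IsSimple Z e) :
    Isometry Z (QuadForm.zero (ε := ε) S) (.zero T) := ⟨e, he, map_zero _⟩

/-- A simple isomorphism induces an isometry of hyperbolic forms. -/
def Isometry.hyp (hZ : StarInvariant Z) {S T : BasedModule Λ} (e : S ≃ₗ[Λ] T) (he : IsSimple Z e) :
    Isometry Z (QuadForm.hyp ε S) (.hyp ε T) :=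
  ⟨e.prodCongr (dualEquiv e), he.prod (he.dual hZ), by
    refine (QGroup.pull_mk _ _).trans (congrArg _ ?_)
    refine LinearMap.ext fun x => Dual.ext fun y => ?_
    exact congrArg x.2 (e.symm_apply_apply y.1)⟩

/-- `H_ε(S) ⊕ H_ε(T) = H_ε(S ⊕ T)`. -/
def Isometry.hypSum (Z : AddSubgroup (ReducedK1 Λ)) (ε : ℤˣ) (S T : BasedModule Λ) :
    Isometry Z ((QuadForm.hyp ε S).sum (.hyp ε T)) (.hyp ε (.of Λ (S × T))) :=
  ⟨(LinearEquiv.prodProdProdComm Λ S (Dual Λ S) T (Dual Λ T)).trans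
      ((LinearEquiv.refl Λ (S × T)).prodCongr (dualProd S T)),
    IsSimple.prodProdProdComm.trans (IsSimple.refl.prod .dualProd), by
    refine (QGroup.pull_mk _ _).trans ?_
    simp only [QuadForm.sum, QGroup.pull_mk, ← map_add]
    rfl⟩

theorem QuadForm.IsSimple.isometry (hZ : StarInvariant Z) {v w : QuadForm Λ ε}
    (hv : v.IsSimple Z) (e : Isometry Z v w) : w.IsSimple Z := by
  obtain ⟨φ, h, hs⟩ := hv
  refine ⟨e.toEquiv.symm.trans (φ.trans (dualEquiv e.toEquiv)), ?_,
    e.simple.symm.trans (hs.trans (e.simple.dual hZ))⟩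
  refine LinearMap.ext fun x => Dual.ext fun y => ?_
  have := e.sym_eq (e.toEquiv.symm x) (e.toEquiv.symm y)
  rw [e.toEquiv.apply_symm_apply, e.toEquiv.apply_symm_apply, ← h] at this
  exact this.symm

theorem QuadForm.IsSimple.sym_injective {v : QuadForm Λ ε} (hv : v.IsSimple Z) {x y : v.mod}
    (h : ∀ z, v.sym x z = v.sym y z) : x = y := by
  obtain ⟨φ, hφ, hs⟩ := hv
  refine φ.injective ?_
  ext z
  have := h z
  rw [← hφ] at this
  exact this

end Forms

/-! ### Based exact sequences and annihilators. -/

section BasedExact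

variable {Λ : Type u} [Ring Λ] [StarRing Λ] [InvariantBasisNumber Λ] {ε : ℤˣ}
  {Z : AddSubgroup (ReducedK1 Λ)}
variable {A M C A' M' C' : Type u} [AddCommGroup A] [Module Λ A] [AddCommGroup M] [Module Λ M]
    [AddCommGroup C] [Module Λ C] [AddCommGroup A'] [Module Λ A'] [AddCommGroup M'] [Module Λ M']
    [AddCommGroup C'] [Module Λ C'] [Based Λ A] [Based Λ M] [Based Λ C]
    [Based Λ A'] [Based Λ M'] [Based Λ C']

theorem IsBasedExact.comp_eq_zero {i : A →ₗ[Λ] M} {p : M →ₗ[Λ] C} (h : IsBasedExact Z i p) (a : A) :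
    p (i a) = 0 := by
  obtain ⟨e, he, h1, h2⟩ := h
  rw [← h1, h2]

theorem IsBasedExact.exists_of_eq_zero {i : A →ₗ[Λ] M} {p : M →ₗ[Λ] C} (h : IsBasedExact Z i p)
    {m : M} (hm : p m = 0) : ∃ a, i a = m := by
  obtain ⟨e, he, h1, h2⟩ := h
  obtain ⟨⟨a, c⟩, rfl⟩ := e.surjective m
  rw [h2] at hm
  subst hm
  exact ⟨a, (h1 a).symm⟩

theorem IsBasedExact.exists_retraction {i : A →ₗ[Λ] M} {p : M →ₗ[Λ] C} (h : IsBasedExact Z i p) :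
    ∃ r : M →ₗ[Λ] A, r.comp i = LinearMap.id := by
  obtain ⟨e, he, h1, h2⟩ := h
  refine ⟨(LinearMap.fst Λ A C).comp e.symm.toLinearMap, LinearMap.ext fun a => ?_⟩
  simp [← h1]

theorem IsBasedExact.exists_section {i : A →ₗ[Λ] M} {p : M →ₗ[Λ] C} (h : IsBasedExact Z i p) :
    ∃ s : C →ₗ[Λ] M, p.comp s = LinearMap.id := by
  obtain ⟨e, he, h1, h2⟩ := h
  exact ⟨e.toLinearMap.comp (LinearMap.inr Λ A C), LinearMap.ext fun c => h2 0 c⟩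

/-- Every section of a based exact sequence gives a simple isomorphism. -/
theorem IsBasedExact.exists_equiv {i : A →ₗ[Λ] M} {p : M →ₗ[Λ] C} (h : IsBasedExact Z i p)
    (s : C →ₗ[Λ] M) (hs : ∀ c, p (s c) = c) :
    ∃ e : (A × C) ≃ₗ[Λ] M, IsSimple Z e ∧ ∀ a c, e (a, c) = i a + s c := by
  obtain ⟨e, he, h1, h2⟩ := h
  -- Two sections differ by a map into `A`, hence the two splittings differ by a shear.
  let f : C →ₗ[Λ] A := (LinearMap.fst Λ A C).comp (e.symm.toLinearMap.comp s)
  refine ⟨(LinearEquiv.prodComm Λ A C).trans ((shear f).trans ((LinearEquiv.prodComm Λ C A).trans e)),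
    IsSimple.prodComm.trans ((IsSimple.shear f).trans (IsSimple.prodComm.trans he)), fun a c => ?_⟩
  have h3 : s c = e (f c, c) := by
    obtain ⟨⟨a', c'⟩, hx⟩ := e.surjective (s c)
    have h4 := hs c
    rw [← hx, h2] at h4
    subst h4
    have : f c' = a' := by simp [f, ← hx]
    rw [this, hx]
  rw [h3, ← h1, ← map_add]
  simp

theorem IsBasedExact.prod {i : A →ₗ[Λ] M} {p : M →ₗ[Λ] C} {i' : A' →ₗ[Λ] M'} {p' : M' →ₗ[Λ] C'}
    (h : IsBasedExact Z i p) (h' : IsBasedExact Z i' p') :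
    IsBasedExact Z (i.prodMap i') (p.prodMap p') := by
  obtain ⟨e, he, h1, h2⟩ := h
  obtain ⟨e', he', h1', h2'⟩ := h'
  refine ⟨(LinearEquiv.prodProdProdComm Λ A A' C C').trans (e.prodCongr e'),
    IsSimple.prodProdProdComm.trans (he.prod he'), fun a => ?_, fun a c => ?_⟩
  · simp [← h1, ← h1']
  · simp [h2, h2']

theorem IsBasedExact.congr {i : A →ₗ[Λ] M} {p : M →ₗ[Λ] C} {i' : A' →ₗ[Λ] M'} {p' : M' →ₗ[Λ] C'}
    (h : IsBasedExact Z i p) {a : A ≃ₗ[Λ] A'} {m : M ≃ₗ[Λ] M'} {c : C ≃ₗ[Λ] C'}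
    (ha : IsSimple Z a) (hm : IsSimple Z m) (hc : IsSimple Z c) (hi : ∀ x, m (i x) = i' (a x))
    (hp : ∀ x, c (p x) = p' (m x)) : IsBasedExact Z i' p' := by
  obtain ⟨e, he, h1, h2⟩ := h
  refine ⟨(a.symm.prodCongr c.symm).trans (e.trans m),
    (ha.symm.prod hc.symm).trans (he.trans hm), fun x => ?_, fun x y => ?_⟩
  · have := hi (a.symm x)
    rw [a.apply_symm_apply] at this
    simp [h1, this]
  · simp [← hp, h2]

/-- The kernel of a surjection of based modules, when it is a direct summand, can be based. -/
theorem exists_isBasedExact (Z : AddSubgroup (ReducedK1 Λ)) (p : M →ₗ[Λ] C) (s : C →ₗ[Λ] M)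
    (hs : p.comp s = LinearMap.id) :
    ∃ (U : BasedModule Λ) (k : U →ₗ[Λ] M), IsBasedExact Z k p := by
  let K := LinearMap.ker p
  have hps (c : C) : p (s c) = c := LinearMap.congr_fun hs c
  let e : (K × C) ≃ₗ[Λ] M := LinearEquiv.ofLinearMap
    (K.subtype.coprod s)
    (((LinearMap.id - s.comp p).codRestrict K (fun m => by
      simp [K, hps])).prod p)
    (by ext m; simp) (by ext x <;> simp [hps])
  have he (a : K) (c : C) : e (a, c) = a + s c := rfl
  let x₁ := (LinearEquiv.sumArrowLequivProdArrow (Based.κ Λ C) (Based.ι Λ M) Λ Λ).trans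
    ((Based.basis.symm.prodCongr (.refl Λ _)).trans (LinearEquiv.prodAssoc Λ C _ _))
  let x₂ := (LinearEquiv.prodAssoc Λ M (Based.ι Λ M → Λ) (Based.ι Λ C → Λ)).symm.trans
    ((Based.basis.prodCongr (.refl Λ _)).trans
      (LinearEquiv.sumArrowLequivProdArrow (Based.κ Λ M) (Based.ι Λ C) Λ Λ).symm)
  let c := LinearEquiv.prodComm Λ (Based.ι Λ C → Λ) (Based.ι Λ M → Λ)
  -- The kernel inherits its `s`-basis by adding `C` and replacing `K ⊕ C` by `M`. On one side
  -- `Λ^{κ_C}` stands for `C ⊕ Λ^{ι_C}`, on the other `M ⊕ Λ^{ι_M}` becomes `Λ^{κ_M}`.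
  let b : Based Λ K :=
    { ι := Based.κ Λ C ⊕ Based.ι Λ M
      κ := Based.κ Λ M ⊕ Based.ι Λ C
      basis := ((LinearEquiv.refl Λ K).prodCongr x₁).trans
        ((LinearEquiv.prodAssoc Λ K C _).symm.trans ((e.prodCongr c).trans x₂)) }
  refine ⟨⟨K⟩, K.subtype, e, ?_, fun a => by simp [he], fun a c => ?_⟩
  · have hs (κ κ' : Type) [Fintype κ] [DecidableEq κ] [Fintype κ'] [DecidableEq κ'] :
        IsSimple Z (LinearEquiv.sumArrowLequivProdArrow κ κ' Λ Λ) := by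
      rw [IsSimple, torsion_sumArrow]; exact Z.zero_mem
    have h₁ : IsSimple Z x₁ := (hs _ _).trans ((IsSimple.basis.symm.prod .refl).trans .prodAssoc)
    have h₂ : IsSimple Z x₂ := IsSimple.prodAssoc.symm.trans
      ((IsSimple.basis.prod .refl).trans (hs _ _).symm)
    have hb : IsSimple Z (((LinearEquiv.refl Λ K).prodCongr x₁).trans
        ((LinearEquiv.prodAssoc Λ K C _).symm.trans ((e.prodCongr c).trans x₂))) :=
      IsSimple.basis (M := K)
    refine IsSimple.of_prod_left (Z := Z) (g := c) ?_ .prodComm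
    -- Reading the definition of the `s`-basis backwards expresses the splitting, stabilised by the
    -- exchange `c`, through isomorphisms already known to be simple.
    have h₃ : e.prodCongr c = ((LinearEquiv.prodAssoc Λ K C _).trans
        ((LinearEquiv.refl Λ K).prodCongr x₁).symm).trans
        ((((LinearEquiv.refl Λ K).prodCongr x₁).trans
        ((LinearEquiv.prodAssoc Λ K C _).symm.trans ((e.prodCongr c).trans x₂))).trans x₂.symm) := by
      refine LinearEquiv.ext fun z => ?_
      simp only [LinearEquiv.trans_apply, LinearEquiv.symm_apply_apply]
      rw [LinearEquiv.apply_symm_apply, LinearEquiv.symm_apply_apply]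
    rw [h₃]
    exact (IsSimple.prodAssoc.trans (IsSimple.refl.prod h₁).symm).trans (hb.trans h₂.symm)
  · have : p a = 0 := a.2
    simp [he, this, hps]

/-- The dual of a based exact sequence. -/
theorem IsBasedExact.dual (hZ : StarInvariant Z) {i : A →ₗ[Λ] M} {p : M →ₗ[Λ] C}
    (h : IsBasedExact Z i p) : IsBasedExact Z (dualMap p) (dualMap i) := by
  obtain ⟨e, he, h1, h2⟩ := h
  refine ⟨(LinearEquiv.prodComm Λ _ _).trans ((dualProd A C).trans (dualEquiv e)),
    IsSimple.prodComm.trans (IsSimple.dualProd.trans (he.dual hZ)), fun f => ?_, fun f g => ?_⟩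
  · refine Dual.ext fun m => ?_
    obtain ⟨⟨a, c⟩, rfl⟩ := e.surjective m
    simp [h2]
  · refine Dual.ext fun m => ?_
    simp [← h1]

/-- The annihilator of the annihilator. -/
theorem IsBasedExact.annihilator (hZ : StarInvariant Z) {m : QuadForm Λ ε} (hm : m.IsSimple Z)
    {U V : BasedModule Λ} {j : V →ₗ[Λ] m.mod} {k : U →ₗ[Λ] m.mod}
    (h : IsBasedExact Z k ((dualMap j).comp m.sym)) :
    IsBasedExact Z j ((dualMap k).comp m.sym) := by
  obtain ⟨φ, hφ, hs⟩ := hm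
  have hφ' (x y : m.mod) : φ x y = m.sym x y := by rw [← hφ]; rfl
  obtain ⟨η, hη, hη'⟩ := IsSimple.units (Z := Z) V ε
  -- The dual sequence is `V^** → M^* → U^*`. The isomorphism `φ⁻¹` carries it back to `M`; the
  -- `ε`-symmetry of `φ` accounts for the factor `ε` in the identification of `V^**` with `V`.
  refine (h.dual hZ).congr (a := (η.trans (evEquiv Λ V)).symm) (m := φ.symm)
    (c := LinearEquiv.refl Λ _) (hη.trans .evEquiv).symm hs.symm .refl (fun x => ?_) (fun x => ?_)
  · obtain ⟨x, rfl⟩ := (η.trans (evEquiv Λ V)).surjective x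
    rw [LinearEquiv.symm_apply_apply, LinearEquiv.symm_apply_eq]
    refine Dual.ext fun y => ?_
    rw [hφ', m.sym_comm]
    simp [hη']
  · refine Dual.ext fun y => ?_
    have := hφ' (φ.symm x) (k y)
    rw [φ.apply_symm_apply] at this
    exact this

end BasedExact

/-! ### Simple split formations and composition of their isomorphisms. -/

section Split

variable {Λ : Type u} [Ring Λ] [StarRing Λ] {ε : ℤˣ} [InvariantBasisNumber Λ]
  {Z : AddSubgroup (ReducedK1 Λ)}

/-- A based exact sequence splits and is exact in the middle, so the conditions on the summand and
on the annihilator come for free. Only the vanishing in `Q_ε` is an extra condition. -/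
theorem QuadForm.IsSimpleLagrangian.of_based {v : QuadForm Λ ε} {L : BasedModule Λ}
    {i : L →ₗ[Λ] v.mod} (h : IsBasedExact Z i ((dualMap i).comp v.sym)) (h0 : v.ψ.pull i = 0) :
    v.IsSimpleLagrangian Z i := by
  refine ⟨⟨h.exists_retraction, ?_, h0⟩, h⟩
  ext x
  exact ⟨fun ⟨a, ha⟩ => ha ▸ h.comp_eq_zero a, fun hx => h.exists_of_eq_zero hx⟩

theorem QuadForm.IsSimpleLagrangian.isometry {v w : QuadForm Λ ε} {L : BasedModule Λ}
    {i : L →ₗ[Λ] v.mod} (h : v.IsSimpleLagrangian Z i) (e : Isometry Z v w) :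
    w.IsSimpleLagrangian Z (e.toEquiv.toLinearMap.comp i) := by
  refine .of_based (h.based.congr (a := .refl Λ L) (m := e.toEquiv) (c := .refl Λ _)
    .refl e.simple .refl (fun x => rfl) fun x => ?_) ?_
  · refine Dual.ext fun y => ?_
    exact (e.sym_eq x (i y)).symm
  · rw [← QGroup.pull_pull, e.pull_eq, h.isLagrangian.pull_eq_zero]

namespace SplitFormation

/-- The graph of an `ε`-symmetric map is a Lagrangian of the hyperbolic form of the opposite sign,
and the shear along this map is a simple splitting. The induced class in `Q_{-ε}` is that of `θ + ε
θ^*`, which is `(1 - T_{-ε}) θ` and so vanishes. -/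
theorem boundary_isFormation (v : QuadForm Λ ε) : (boundary v).IsFormation Z := by
  refine ⟨.of_based ⟨shear v.sym, .shear _, fun a => ?_, fun a c => ?_⟩ ?_, rfl⟩
  · simp
  · refine Dual.ext fun y => ?_
    change (QuadForm.hyp (-ε) v.mod).sym (a, c + v.sym a) (y, v.sym y) = c y
    rw [QuadForm.hyp_sym]
    change (c y + v.sym a y) + ((-ε : ℤˣ) : ℤ) • star (v.sym y a) = c y
    rw [v.sym_comm a y, Units.val_neg, neg_smul]
    abel
  · obtain ⟨θ, hθ⟩ := QGroup.mk_surjective ε v.ψ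
    refine (QGroup.pull_mk _ _).trans ((QGroup.mk_eq_mk_of (B := 0) θ fun x y => ?_).trans (map_zero _))
    change v.ψ.sym x y - 0 = _
    rw [← hθ, QGroup.sym_mk]
    simp

theorem triv_isFormation (P : BasedModule Λ) : (triv P : SplitFormation Λ ε).IsFormation Z := by
  obtain ⟨e, he, h⟩ := IsSimple.units (Z := Z) P (-ε)
  refine ⟨.of_based ⟨(LinearEquiv.prodComm Λ _ _).trans
    (((e.trans (evEquiv Λ P)).symm).prodCongr (.refl Λ _)),
    IsSimple.prodComm.trans ((he.trans .evEquiv).symm.prod .refl), fun a => ?_, fun a c => ?_⟩ ?_, ?_⟩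
  · simp
  · obtain ⟨c, rfl⟩ := (e.trans (evEquiv Λ P)).surjective c
    refine Dual.ext fun y => ?_
    change (QuadForm.hyp (-ε) P).sym _ (0, y) = _
    rw [QuadForm.hyp_sym]
    change a 0 + ((-ε : ℤˣ) : ℤ) • star (y ((e.trans (evEquiv Λ P)).symm
      (e.trans (evEquiv Λ P) c))) = star (y (e c))
    rw [LinearEquiv.symm_apply_apply, h, map_zero]
    rcases Int.units_eq_one_or ε with rfl | rfl <;> simp
  · refine (QGroup.pull_mk _ _).trans ((congrArg _ ?_).trans (map_zero _))
    refine LinearMap.ext fun x => Dual.ext fun y => ?_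
    exact map_zero x
  · refine LinearMap.ext fun x => Dual.ext fun y => ?_
    change x 0 = (QGroup.sym (0 : QGroup Λ ε (Dual Λ P))) x y
    rw [map_zero, map_zero]
    rfl

theorem IsFormation.sum {x y : SplitFormation Λ ε} (hx : x.IsFormation Z) (hy : y.IsFormation Z) :
    (x.sum y).IsFormation Z := by
  refine ⟨(hx.lagr.sum hy.lagr).isometry (Isometry.hypSum Z (-ε) x.F y.F), ?_⟩
  refine LinearMap.ext fun a => Dual.ext fun b => ?_
  have h1 : x.μ a.1 (x.γ b.1) = x.θ.sym a.1 b.1 :=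
    DFunLike.congr_fun (LinearMap.congr_fun hx.sym_eq a.1) b.1
  have h2 : y.μ a.2 (y.γ b.2) = y.θ.sym a.2 b.2 :=
    DFunLike.congr_fun (LinearMap.congr_fun hy.sym_eq a.2) b.2
  rw [map_add]
  change x.μ a.1 (x.γ b.1) + y.μ a.2 (y.γ b.2) = (QGroup.sym _) a b + (QGroup.sym _) a b
  rw [h1, h2, QGroup.sym_pull_apply, QGroup.sym_pull_apply]
  rfl

end SplitFormation

namespace SplitMap

variable {x y z x' y' : SplitFormation Λ ε}

theorem IsIso.μ_apply {f : SplitMap x y} (hf : f.IsIso Z) (g : x.G) (a : x.F) :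
    y.μ (f.β g) (f.α a) = x.μ g a := by
  have := DFunLike.congr_fun (LinearMap.congr_fun hf.eqμ g) (f.α a)
  refine this.symm.trans ?_
  exact congrArg (x.μ g) (f.α.symm_apply_apply a)

theorem IsIso.γ_apply {f : SplitMap x y} (hf : f.IsIso Z) (φ : Dual Λ y.F) (g : x.G) :
    f.ν.sym (dualMap f.α.toLinearMap φ) (x.μ g) = φ (y.γ (f.β g)) - φ (f.α (x.γ g)) := by
  have := congrArg φ (LinearMap.congr_fun hf.eqγ g)
  have h2 : φ (f.α (x.γ g + (evEquiv Λ x.F).symm (adj f.ν.sym (x.μ g)))) = φ (y.γ (f.β g)) := this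
  rw [← h2, map_add, map_add, add_sub_cancel_left]
  have h3 := evEquiv_symm_spec (adj f.ν.sym (x.μ g)) (dualMap f.α.toLinearMap φ)
  rw [adj_apply, star_star] at h3
  exact h3.symm

/-- Testing the equation for `γ` on functionals removes the double dual from it and leaves only
values of the symmetrisation of `ν`. The closure properties of isomorphisms below are verified in
this form. -/
theorem IsIso.of_apply {f : SplitMap x y} (hx : x.IsFormation Z) (hy : y.IsFormation Z)
    (hα : IsSimple Z f.α) (hβ : IsSimple Z f.β)
    (hγ : ∀ (φ : Dual Λ y.F) (g : x.G),
      f.ν.sym (dualMap f.α.toLinearMap φ) (x.μ g) = φ (y.γ (f.β g)) - φ (f.α (x.γ g)))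
    (hμ : ∀ g a, y.μ (f.β g) (f.α a) = x.μ g a)
    (hθ : x.θ + f.ν.pull x.μ = y.θ.pull f.β.toLinearMap) : f.IsIso Z := by
  refine ⟨hx, hy, hα, hβ, LinearMap.ext fun g => eq_of_dual (Λ := Λ) fun φ => ?_,
    LinearMap.ext fun g => Dual.ext fun a => ?_, hθ⟩
  · change φ (f.α (x.γ g + (evEquiv Λ x.F).symm (adj f.ν.sym (x.μ g)))) = φ (y.γ (f.β g))
    have h3 := evEquiv_symm_spec (adj f.ν.sym (x.μ g)) (dualMap f.α.toLinearMap φ)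
    rw [adj_apply, star_star, hγ] at h3
    have h4 : φ (f.α ((evEquiv Λ x.F).symm (adj f.ν.sym (x.μ g)))) = _ := h3
    rw [map_add, map_add, h4, add_sub_cancel]
  · have := hμ g (f.α.symm a)
    rw [f.α.apply_symm_apply] at this
    exact this.symm

theorem IsIso.of_zero {f : SplitMap x y} (hν : f.ν = 0) (hx : x.IsFormation Z) (hy : y.IsFormation Z)
    (hα : IsSimple Z f.α) (hβ : IsSimple Z f.β) (hγ : ∀ g, y.γ (f.β g) = f.α (x.γ g))
    (hμ : ∀ g a, y.μ (f.β g) (f.α a) = x.μ g a) (hθ : x.θ = y.θ.pull f.β.toLinearMap) :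
    f.IsIso Z := by
  refine .of_apply hx hy hα hβ (fun φ g => ?_) hμ ?_
  · rw [hν, map_zero, hγ, sub_self]; rfl
  · rw [hν, map_zero, add_zero, hθ]

theorem IsIso.id (hx : x.IsFormation Z) : (SplitMap.id x).IsIso Z :=
  .of_zero rfl hx hx .refl .refl (fun _ => rfl) (fun _ _ => rfl) (QGroup.pull_id _).symm

theorem IsIso.comp {f : SplitMap x y} {g : SplitMap y z} (hg : g.IsIso Z) (hf : f.IsIso Z) :
    (g.comp f).IsIso Z := by
  have hμ (c : x.G) : dualMap f.α.symm.toLinearMap (x.μ c) = y.μ (f.β c) := by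
    refine Dual.ext fun a => ?_
    have := hf.μ_apply c (f.α.symm a)
    rw [f.α.apply_symm_apply] at this
    exact this.symm
  refine .of_apply hf.source hg.target (hf.simple_α.trans hg.simple_α)
    (hf.simple_β.trans hg.simple_β) (fun φ c => ?_) (fun c a => ?_) ?_
  · change (f.ν + g.ν.pull (dualMap f.α.symm.toLinearMap)).sym
      (dualMap f.α.toLinearMap (dualMap g.α.toLinearMap φ)) (x.μ c) = _
    have h1 := hf.γ_apply (dualMap g.α.toLinearMap φ) c
    have h2 := hg.γ_apply φ (f.β c)
    have h3 : dualMap f.α.symm.toLinearMap (dualMap f.α.toLinearMap (dualMap g.α.toLinearMap φ)) =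
        dualMap g.α.toLinearMap φ := Dual.ext fun a => by simp
    rw [map_add, LinearMap.add_apply, Dual.add_apply, h1, QGroup.sym_pull_apply, hμ, h3, h2]
    change φ (g.α (y.γ (f.β c))) - φ (g.α (f.α (x.γ c))) + (φ (z.γ (g.β (f.β c))) -
      φ (g.α (y.γ (f.β c)))) = φ (z.γ (g.β (f.β c))) - φ (g.α (f.α (x.γ c)))
    abel
  · exact (hg.μ_apply _ _).trans (hf.μ_apply _ _)
  · change x.θ + (f.ν + g.ν.pull (dualMap f.α.symm.toLinearMap)).pull x.μ =
      z.θ.pull (g.β.toLinearMap.comp f.β.toLinearMap)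
    have h1 : (dualMap f.α.symm.toLinearMap).comp x.μ = y.μ.comp f.β.toLinearMap :=
      LinearMap.ext hμ
    rw [map_add, ← add_assoc, hf.eqθ, QGroup.pull_pull, h1, ← QGroup.pull_pull, ← map_add, hg.eqθ,
      QGroup.pull_pull]

theorem IsIso.symm {f : SplitMap x y} (hf : f.IsIso Z) : f.symm.IsIso Z := by
  have hμ (c : y.G) : dualMap f.α.toLinearMap (y.μ c) = x.μ (f.β.symm c) := by
    refine Dual.ext fun a => ?_
    have := hf.μ_apply (f.β.symm c) a
    rw [f.β.apply_symm_apply] at this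
    exact this
  refine .of_apply hf.target hf.source hf.simple_α.symm hf.simple_β.symm (fun φ c => ?_)
    (fun c a => ?_) ?_
  · change (-f.ν.pull (dualMap f.α.toLinearMap)).sym (dualMap f.α.symm.toLinearMap φ) (y.μ c) =
      φ (x.γ (f.β.symm c)) - φ (f.α.symm (y.γ c))
    have h1 := hf.γ_apply (dualMap f.α.symm.toLinearMap φ) (f.β.symm c)
    rw [map_neg, LinearMap.neg_apply, Dual.neg_apply, QGroup.sym_pull_apply, hμ, h1]
    simp
  · have := hf.μ_apply (f.β.symm c) (f.α.symm a)
    rw [f.β.apply_symm_apply, f.α.apply_symm_apply] at this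
    exact this.symm
  · change y.θ + (-f.ν.pull (dualMap f.α.toLinearMap)).pull y.μ = x.θ.pull f.β.symm.toLinearMap
    have h1 : (dualMap f.α.toLinearMap).comp y.μ = x.μ.comp f.β.symm.toLinearMap :=
      LinearMap.ext hμ
    have h2 := congrArg (QGroup.pull f.β.symm.toLinearMap) hf.eqθ
    rw [map_add, QGroup.pull_pull, QGroup.pull_pull, ← h1, LinearEquiv.comp_coe,
      LinearEquiv.symm_trans_self] at h2
    have h3 : y.θ.pull (LinearEquiv.refl Λ y.G).toLinearMap = y.θ := QGroup.pull_id _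
    rw [map_neg, QGroup.pull_pull, ← h3, ← h2]
    abel

theorem IsIso.sum {f : SplitMap x y} {g : SplitMap x' y'} (hf : f.IsIso Z) (hg : g.IsIso Z) :
    (f.sum g).IsIso Z := by
  refine .of_apply (hf.source.sum hg.source) (hf.target.sum hg.target)
    (hf.simple_α.prod hg.simple_α) (hf.simple_β.prod hg.simple_β) (fun φ c => ?_) (fun c a => ?_) ?_
  · obtain ⟨⟨φ, φ'⟩, rfl⟩ := (dualProd y.F y'.F).surjective φ
    have h1 := hf.γ_apply φ c.1
    have h2 := hg.γ_apply φ' c.2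
    change (f.ν.pull (dualMap (LinearMap.inl Λ x.F x'.F)) +
      g.ν.pull (dualMap (LinearMap.inr Λ x.F x'.F))).sym _ (dualProd x.F x'.F (x.μ c.1, x'.μ c.2)) =
      (φ (y.γ (f.β c.1)) + φ' (y'.γ (g.β c.2))) - (φ (f.α (x.γ c.1)) + φ' (g.α (x'.γ c.2)))
    have e1 : dualMap (LinearMap.inl Λ x.F x'.F) (dualMap (f.sum g).α.toLinearMap
        (dualProd y.F y'.F (φ, φ'))) = dualMap f.α.toLinearMap φ := by
      refine Dual.ext fun a => ?_
      change φ (f.α a) + φ' (g.α 0) = φ (f.α a)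
      simp
    have e2 : dualMap (LinearMap.inr Λ x.F x'.F) (dualMap (f.sum g).α.toLinearMap
        (dualProd y.F y'.F (φ, φ'))) = dualMap g.α.toLinearMap φ' := by
      refine Dual.ext fun a => ?_
      change φ (f.α 0) + φ' (g.α a) = φ' (g.α a)
      simp
    have e3 : dualMap (LinearMap.inl Λ x.F x'.F) (dualProd x.F x'.F (x.μ c.1, x'.μ c.2)) = x.μ c.1 :=
      Dual.ext fun a => by simp
    have e4 : dualMap (LinearMap.inr Λ x.F x'.F) (dualProd x.F x'.F (x.μ c.1, x'.μ c.2)) = x'.μ c.2 :=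
      Dual.ext fun a => by simp
    rw [map_add, LinearMap.add_apply, Dual.add_apply, QGroup.sym_pull_apply, QGroup.sym_pull_apply,
      e1, e2, e3, e4, h1, h2]
    abel
  · exact congrArg₂ (· + ·) (hf.μ_apply c.1 a.1) (hg.μ_apply c.2 a.2)
  · have h1 := congrArg (QGroup.pull (LinearMap.fst Λ x.G x'.G)) hf.eqθ
    have h2 := congrArg (QGroup.pull (LinearMap.snd Λ x.G x'.G)) hg.eqθ
    simp only [map_add, QGroup.pull_pull] at h1 h2
    change x.θ.pull _ + x'.θ.pull _ + (f.ν.pull (dualMap (LinearMap.inl Λ x.F x'.F)) +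
      g.ν.pull (dualMap (LinearMap.inr Λ x.F x'.F))).pull _ =
      (y.θ.pull (LinearMap.fst Λ y.G y'.G) + y'.θ.pull (LinearMap.snd Λ y.G y'.G)).pull _
    simp only [map_add, QGroup.pull_pull]
    refine Eq.trans ?_ (congrArg₂ (· + ·) h1 h2)
    have e3 : (dualMap (LinearMap.inl Λ x.F x'.F)).comp (x.sum x').μ =
        x.μ.comp (LinearMap.fst Λ x.G x'.G) :=
      LinearMap.ext fun c => Dual.ext fun a => by simp
    have e4 : (dualMap (LinearMap.inr Λ x.F x'.F)).comp (x.sum x').μ =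
        x'.μ.comp (LinearMap.snd Λ x.G x'.G) :=
      LinearMap.ext fun c => Dual.ext fun a => by simp
    rw [e3, e4]
    abel

theorem IsIso.assoc (hx : x.IsFormation Z) (hy : y.IsFormation Z) (hz : z.IsFormation Z) :
    (SplitMap.assoc x y z).IsIso Z := by
  refine .of_zero rfl ((hx.sum hy).sum hz) (hx.sum (hy.sum hz)) .prodAssoc .prodAssoc
    (fun _ => rfl) (fun c a => ?_) ?_
  · change x.μ c.1.1 a.1.1 + (y.μ c.1.2 a.1.2 + z.μ c.2 a.2) =
      x.μ c.1.1 a.1.1 + y.μ c.1.2 a.1.2 + z.μ c.2 a.2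
    rw [add_assoc]
  · simp only [map_add, QGroup.pull_pull, add_assoc]
    rfl

theorem IsIso.boundary {v w : QuadForm Λ ε} (h : Isometry Z v w) :
    (SplitMap.boundary h.toEquiv).IsIso Z :=
  .of_zero rfl (SplitFormation.boundary_isFormation v) (SplitFormation.boundary_isFormation w)
    h.simple h.simple (fun _ => rfl) h.sym_eq h.pull_eq.symm

theorem isSimple_rightComm (A B C : BasedModule Λ) : IsSimple Z (rightComm (Λ := Λ) A B C) :=
  IsSimple.prodAssoc.trans ((IsSimple.refl.prod IsSimple.prodComm).trans IsSimple.prodAssoc.symm)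

theorem IsIso.reorder (w r : QuadForm Λ ε) {t : SplitFormation Λ ε} (ht : t.IsFormation Z) :
    (SplitMap.reorder w r t).IsIso Z := by
  refine .of_zero rfl ((SplitFormation.boundary_isFormation _).sum ht)
    (((SplitFormation.boundary_isFormation w).sum ht).sum (SplitFormation.boundary_isFormation r))
    (isSimple_rightComm _ _ _) (isSimple_rightComm _ _ _)
    (fun _ => rfl) (fun c a => ?_) ?_
  · change w.sym c.1.1 a.1.1 + t.μ c.2 a.2 + r.sym c.1.2 a.1.2 =
      (w.sum r).sym c.1 a.1 + t.μ c.2 a.2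
    rw [QuadForm.sum_sym, add_right_comm]
  · simp only [map_add, QGroup.pull_pull]
    rw [add_right_comm]
    rfl

/-- The target has `θ = 0`, so the equation for `θ` asks that `ψ + φ^* ν φ = 0`; since `φ` is
invertible, this forces the `ν` in the definition. -/
theorem IsIso.ofSimple {m : QuadForm Λ ε} {φ : m.mod ≃ₗ[Λ] Dual Λ m.mod}
    (hφ : φ.toLinearMap = m.sym) (hs : IsSimple Z φ) : (SplitMap.ofSimple m φ).IsIso Z := by
  have h1 : φ.symm.toLinearMap.comp m.sym = LinearMap.id := by
    rw [← hφ]; exact LinearMap.ext fun a => φ.symm_apply_apply a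
  refine .of_apply (SplitFormation.boundary_isFormation m) (SplitFormation.triv_isFormation _)
    .refl hs (fun χ c => ?_) (fun c a => ?_) ?_
  · obtain ⟨χ, rfl⟩ := φ.surjective χ
    change (-m.ψ.pull φ.symm.toLinearMap).sym (φ χ) (m.sym c) = φ χ 0 - φ χ c
    have h2 : φ.symm (m.sym c) = c := LinearMap.congr_fun h1 c
    rw [map_neg, LinearMap.neg_apply, Dual.neg_apply, QGroup.sym_pull_apply, map_zero, zero_sub,
      LinearEquiv.coe_coe, h2, φ.symm_apply_apply]
    have h3 : φ χ = m.sym χ := LinearMap.congr_fun hφ χ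
    rw [h3]; rfl
  · exact DFunLike.congr_fun (LinearMap.congr_fun hφ c) a
  · change m.ψ + (-m.ψ.pull φ.symm.toLinearMap).pull m.sym = (0 : QGroup Λ ε _).pull _
    rw [map_neg, QGroup.pull_pull, h1, QGroup.pull_id, map_zero, add_neg_cancel]

/-- The element `α ν α^*` of `Q_ε(F'^*)`. -/
def conu (f : SplitMap x y) : QGroup Λ ε (Dual Λ y.F) := f.ν.pull (dualMap f.α.toLinearMap)

theorem conu_id : (SplitMap.id x).conu = 0 := map_zero _

/-- Transporting `ν` to the target turns the twisted composition law into a sum. This is why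
homotopies and unions are expressed through `α ν α^*`. -/
theorem conu_comp (g : SplitMap y z) (f : SplitMap x y) :
    (g.comp f).conu = f.conu.pull (dualMap g.α.toLinearMap) + g.conu := by
  unfold conu
  change (f.ν + g.ν.pull (dualMap f.α.symm.toLinearMap)).pull _ = _
  have e : (dualMap f.α.symm.toLinearMap).comp (dualMap (g.comp f).α.toLinearMap) =
      dualMap g.α.toLinearMap :=
    LinearMap.ext fun χ => Dual.ext fun a =>
      congrArg (fun b => χ (g.α b)) (f.α.apply_symm_apply a)
  rw [map_add, QGroup.pull_pull, QGroup.pull_pull, e]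
  rfl

theorem conu_symm (f : SplitMap x y) : f.symm.conu = -f.ν := by
  unfold conu
  change (-f.ν.pull (dualMap f.α.toLinearMap)).pull (dualMap f.α.symm.toLinearMap) = _
  rw [map_neg, QGroup.pull_pull]
  have : (dualMap f.α.toLinearMap).comp (dualMap f.α.symm.toLinearMap) = LinearMap.id :=
    LinearMap.ext fun χ => Dual.ext fun a => congrArg χ (f.α.symm_apply_apply a)
  rw [this, QGroup.pull_id]

theorem conu_sum (f : SplitMap x y) (g : SplitMap x' y') :
    (f.sum g).conu = f.conu.pull (dualMap (LinearMap.inl Λ y.F y'.F)) +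
      g.conu.pull (dualMap (LinearMap.inr Λ y.F y'.F)) := by
  unfold conu
  change (f.ν.pull (dualMap (LinearMap.inl Λ x.F x'.F)) +
      g.ν.pull (dualMap (LinearMap.inr Λ x.F x'.F))).pull _ = _
  simp only [map_add, QGroup.pull_pull]
  congr 2
  · congr 1
    refine LinearMap.ext fun χ => Dual.ext fun a => congrArg χ ?_
    exact Prod.ext rfl (map_zero g.α)
  · congr 1
    refine LinearMap.ext fun χ => Dual.ext fun a => congrArg χ ?_
    exact Prod.ext (map_zero f.α) rfl

theorem conu_of_ν_eq_zero {f : SplitMap x y} (h : f.ν = 0) : f.conu = 0 := by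
  rw [conu, h, map_zero]

theorem IsIso.push {w w' u u' : QuadForm Λ ε} {t t' : SplitFormation Λ ε}
    {f : SplitMap ((SplitFormation.boundary w).sum t) ((SplitFormation.boundary w').sum t')}
    (hf : f.IsIso Z) (ht : t.IsFormation Z) (ht' : t'.IsFormation Z)
    (R : BasedModule Λ) (k : Isometry Z (w.sum (.zero R)) u) (l : Isometry Z (w'.sum (.zero R)) u') :
    (f.push R k l).IsIso Z :=
  ((IsIso.boundary l).sum (.id ht')).comp ((IsIso.reorder _ _ ht').symm.comp
    ((hf.sum (.id (SplitFormation.boundary_isFormation _))).comp ((IsIso.reorder _ _ ht).comp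
      ((IsIso.boundary k).symm.sum (.id ht)))))

theorem IsIso.stabilise {y z u w t t' : SplitFormation Λ ε} {f : SplitMap (y.sum u) (z.sum w)}
    (hf : f.IsIso Z) (hy : y.IsFormation Z) (hz : z.IsFormation Z) (hu : u.IsFormation Z)
    (hw : w.IsFormation Z)
    {R : BasedModule Λ} {g : SplitMap t (u.sum (.triv R))} {h : SplitMap (w.sum (.triv R)) t'}
    (hg : g.IsIso Z) (hh : h.IsIso Z) : (f.stabilise R g h).IsIso Z := by
  have hR := SplitFormation.triv_isFormation (ε := ε) (Z := Z) R
  exact ((IsIso.id hz).sum hh).comp ((IsIso.assoc hz hw hR).comp ((hf.sum (.id hR)).comp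
    ((IsIso.assoc hy hu hR).symm.comp ((IsIso.id hy).sum hg))))

end SplitMap

end Split

/-! ### The union of two forms along a boundary isomorphism, and homotopies as shears. -/

section Union

variable {Λ : Type u} [Ring Λ] [StarRing Λ] {ε : ℤˣ}

/-- The form on `V ⊕ V'^*` with matrix `(θ, 0; ε a, -s)`. -/
abbrev unionOf (v v' : QuadForm Λ ε) (a : v.mod →ₗ[Λ] v'.mod) (s : QGroup Λ ε (Dual Λ v'.mod)) :
    QuadForm Λ ε where
  mod := .of Λ (v.mod × Dual Λ v'.mod)
  ψ := v.ψ.pull (LinearMap.fst Λ v.mod (Dual Λ v'.mod)) +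
    (ε : ℤ) • QGroup.mk ε ((dualMap (LinearMap.snd Λ v.mod (Dual Λ v'.mod))).comp
      (ev.comp (a.comp (LinearMap.fst Λ v.mod (Dual Λ v'.mod))))) -
    s.pull (LinearMap.snd Λ v.mod (Dual Λ v'.mod))

section

variable {v v' : QuadForm Λ ε} {a : v.mod →ₗ[Λ] v'.mod} {s : QGroup Λ ε (Dual Λ v'.mod)}

theorem unionOf_pull {N : Type u} [AddCommGroup N] [Module Λ N]
    (f : N →ₗ[Λ] v.mod) (g : N →ₗ[Λ] Dual Λ v'.mod) :
    (unionOf v v' a s).ψ.pull (f.prod g) = v.ψ.pull f +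
      (ε : ℤ) • QGroup.mk ε ((dualMap g).comp (ev.comp (a.comp f))) - s.pull g := by
  change (v.ψ.pull _ + (ε : ℤ) • QGroup.mk ε _ - s.pull _).pull (f.prod g) = _
  rw [map_sub, map_add, map_zsmul, QGroup.pull_pull, QGroup.pull_pull, LinearMap.fst_prod,
    LinearMap.snd_prod]
  rfl

theorem unionOf_pull_inl :
    (unionOf v v' a s).ψ.pull (LinearMap.inl Λ v.mod (Dual Λ v'.mod)) = v.ψ := by
  have := unionOf_pull (v := v) (v' := v') (a := a) (s := s) LinearMap.id 0
  refine this.trans ?_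
  have h : (dualMap (0 : v.mod →ₗ[Λ] Dual Λ v'.mod)).comp (ev.comp (a.comp LinearMap.id)) = 0 := by
    ext x y
    simp
  rw [h]
  simp

theorem unionOf_pull_inr :
    (unionOf v v' a s).ψ.pull (LinearMap.inr Λ v.mod (Dual Λ v'.mod)) = -s := by
  have := unionOf_pull (v := v) (v' := v') (a := a) (s := s) 0 LinearMap.id
  refine this.trans ?_
  have h : (dualMap LinearMap.id).comp (ev.comp (a.comp (0 : Dual Λ v'.mod →ₗ[Λ] v.mod))) = 0 := by
    ext x y
    simp
  rw [h]
  simp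

theorem unionOf_sym (p q : v.mod × Dual Λ v'.mod) :
    (unionOf v v' a s).sym p q = v.sym p.1 q.1 + (ε : ℤ) • star (q.2 (a p.1)) + p.2 (a q.1) -
      s.sym p.2 q.2 := by
  change QGroup.sym (v.ψ.pull _ + (ε : ℤ) • QGroup.mk ε _ - s.pull _) p q = _
  rw [map_sub, map_add, map_zsmul]
  simp only [LinearMap.sub_apply, LinearMap.add_apply, Dual.sub_apply, Dual.add_apply,
    LinearMap.smul_apply, Dual.zsmul_apply, QGroup.sym_pull_apply, QGroup.sym_mk, Teps_apply,
    smul_add, eps_smul_eps_smul]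
  rw [← add_assoc]
  change _ + (ε : ℤ) • star (q.2 (a p.1)) + star (star (p.2 (a q.1))) - _ = _
  rw [star_star]
  rfl

variable (v v') in
/-- The automorphism `(x, y) ↦ (x + δ y, y)` of `V ⊕ V'^*`. -/
def unionShear (δ : Dual Λ v'.mod →ₗ[Λ] v.mod) :
    (v.mod × Dual Λ v'.mod) ≃ₗ[Λ] (v.mod × Dual Λ v'.mod) :=
  (LinearEquiv.prodComm Λ _ _).trans ((shear δ).trans (LinearEquiv.prodComm Λ _ _))

@[simp] theorem unionShear_apply (δ : Dual Λ v'.mod →ₗ[Λ] v.mod) (p : v.mod × Dual Λ v'.mod) :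
    unionShear v v' δ p = (p.1 + δ p.2, p.2) := rfl

variable {a' : v.mod →ₗ[Λ] v'.mod} {s' : QGroup Λ ε (Dual Λ v'.mod)}

/-- A form on `V ⊕ V'^*` is tested on the two summands and on the mixed part of its symmetrisation.
The shear fixes `V`, so nothing happens there; the mixed part compares `a` with `a'`, and the
summand `V'^*` compares `s` with `s'`. These are the conditions of a homotopy as seen on `V` and
`V'^*`. -/
theorem unionShear_pull_iff (δ : Dual Λ v'.mod →ₗ[Λ] v.mod) :
    (unionOf v v' a' s').ψ.pull (unionShear v v' δ).toLinearMap = (unionOf v v' a s).ψ ↔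
      (∀ x (y : Dual Λ v'.mod), v.sym (δ y) x = y (a x) - y (a' x)) ∧
      s' - s = v.ψ.pull δ + (ε : ℤ) • QGroup.mk ε (ev.comp (a'.comp δ)) := by
  have hl : (unionShear v v' δ).toLinearMap.comp (LinearMap.inl Λ v.mod (Dual Λ v'.mod)) =
      LinearMap.inl Λ v.mod (Dual Λ v'.mod) :=
    LinearMap.ext fun x => Prod.ext (by simp) rfl
  have hr : (unionShear v v' δ).toLinearMap.comp (LinearMap.inr Λ v.mod (Dual Λ v'.mod)) =
      δ.prod LinearMap.id :=
    LinearMap.ext fun x => Prod.ext (by simp) rfl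
  have hS : s' - s = v.ψ.pull δ + (ε : ℤ) • QGroup.mk ε (ev.comp (a'.comp δ)) ↔
      ((unionOf v v' a' s').ψ.pull (unionShear v v' δ).toLinearMap).pull
        (LinearMap.inr Λ v.mod (Dual Λ v'.mod)) =
      (unionOf v v' a s).ψ.pull (LinearMap.inr Λ v.mod (Dual Λ v'.mod)) := by
    rw [QGroup.pull_pull, hr, unionOf_pull, unionOf_pull_inr, QGroup.pull_id]
    change _ ↔ v.ψ.pull δ + (ε : ℤ) • QGroup.mk ε (ev.comp (a'.comp δ)) - s' = -s
    constructor
    · intro h; rw [← h]; abel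
    · intro h; rw [← sub_eq_zero] at h ⊢; rw [← neg_eq_zero, ← h]; abel
  have hA (x : v.mod) (y : Dual Λ v'.mod) : v.sym (δ y) x = y (a x) - y (a' x) ↔
      ((unionOf v v' a' s').ψ.pull (unionShear v v' δ).toLinearMap).sym (x, 0) (0, y) =
      (unionOf v v' a s).ψ.sym (x, 0) (0, y) := by
    rw [QGroup.sym_pull_apply]
    change _ ↔ (unionOf v v' a' s').sym (unionShear v v' δ (x, 0)) (unionShear v v' δ (0, y)) =
      (unionOf v v' a s).sym (x, 0) (0, y)
    rw [unionOf_sym, unionOf_sym, v.sym_comm]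
    simp only [unionShear_apply, map_zero, add_zero, zero_add,
      Dual.zero_apply, sub_zero]
    constructor
    · intro h
      have h' := congrArg (fun z => (ε : ℤ) • star z) h
      simp only [star_smul, star_star, eps_smul_eps_smul, star_trivial, star_sub, smul_sub] at h'
      rw [h']
      abel
    · intro h
      have h' := congrArg (fun z => (ε : ℤ) • star z) h
      simp only [star_smul, star_star, star_add, smul_add, eps_smul_eps_smul, star_trivial] at h'
      rw [← h']
      abel
  rw [hS]
  constructor
  · intro h
    exact ⟨fun x y => (hA x y).2 (by rw [h]), by rw [h]⟩
  · rintro ⟨h1, h2⟩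
    refine QGroup.prod_ext ?_ h2 fun x y => (hA x y).1 (h1 x y)
    rw [QGroup.pull_pull, hl]
    exact unionOf_pull_inl.trans unionOf_pull_inl.symm

end

variable [InvariantBasisNumber Λ] {Z : AddSubgroup (ReducedK1 Λ)}

namespace SplitMap

section General

variable {x y : SplitFormation Λ ε} {f f' : SplitMap x y}

theorem IsIso.dualMap_μ (hf : f.IsIso Z) (g : y.G) :
    dualMap f.α.toLinearMap (y.μ g) = x.μ (f.β.symm g) := by
  refine Dual.ext fun a => ?_
  have := hf.μ_apply (f.β.symm g) a
  rw [f.β.apply_symm_apply] at this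
  exact this

theorem IsIso.conu_sym (hf : f.IsIso Z) (φ : Dual Λ y.F) (g : y.G) :
    f.conu.sym φ (y.μ g) = φ (y.γ g) - φ (f.α (x.γ (f.β.symm g))) := by
  have := hf.γ_apply φ (f.β.symm g)
  rw [f.β.apply_symm_apply] at this
  rw [← this, conu, QGroup.sym_pull_apply, hf.dualMap_μ]

theorem IsIso.conu_pull_μ (hf : f.IsIso Z) :
    f.conu.pull y.μ = y.θ - x.θ.pull f.β.symm.toLinearMap := by
  have h1 : (dualMap f.α.toLinearMap).comp y.μ = x.μ.comp f.β.symm.toLinearMap :=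
    LinearMap.ext hf.dualMap_μ
  have h2 := congrArg (QGroup.pull f.β.symm.toLinearMap) hf.eqθ
  rw [map_add, QGroup.pull_pull, QGroup.pull_pull, ← h1, LinearEquiv.comp_coe,
    LinearEquiv.symm_trans_self] at h2
  have h3 : y.θ.pull (LinearEquiv.refl Λ y.G).toLinearMap = y.θ := QGroup.pull_id _
  rw [conu, QGroup.pull_pull, ← h3, ← h2]
  abel

theorem IsIso.source_sym (hf : f.IsIso Z) (g g' : x.G) : x.μ g (x.γ g') = x.θ.sym g g' :=
  DFunLike.congr_fun (LinearMap.congr_fun hf.source.sym_eq g) g'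

/-- A homotopy in terms of the dual `D` of `Δ`. -/
theorem homotopic_iff : f.Homotopic f' ↔ ∃ D : Dual Λ y.F →ₗ[Λ] x.G,
    (∀ g, D (y.μ g) = f'.β.symm g - f.β.symm g) ∧
    (∀ φ a, x.μ (D φ) a = φ (f'.α a) - φ (f.α a)) ∧
    f'.conu - f.conu = -((ε : ℤ) • QGroup.mk ε (ev.comp (f'.α.toLinearMap.comp (x.γ.comp D)))) +
      x.θ.pull D := by
  constructor
  · rintro ⟨Δ, h1, h2, h3⟩
    refine ⟨codual Δ, fun g => eq_of_dual (Λ := Λ) fun χ => ?_, fun φ a => ?_, h3⟩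
    · have := DFunLike.congr_fun (LinearMap.congr_fun h1 χ) g
      rw [apply_codual, map_sub]
      exact this.symm
    · have h4 := congrArg φ (LinearMap.congr_fun h2 a)
      have h5 := apply_codual Δ φ (adj x.μ a)
      rw [adj_apply] at h5
      rw [← map_sub]
      refine (star_injective h5).trans ?_
      exact h4.symm
  · rintro ⟨D, h1, h2, h3⟩
    refine ⟨codual D, LinearMap.ext fun χ => Dual.ext fun g => ?_,
      LinearMap.ext fun a => eq_of_dual (Λ := Λ) fun φ => ?_, ?_⟩
    · have := congrArg χ (h1 g)
      rw [map_sub] at this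
      refine this.symm.trans ?_
      change χ (D (y.μ g)) = star (y.μ g (codual D χ))
      rw [apply_codual, star_star]
    · change φ (f'.α a - f.α a) = φ (codual D (adj x.μ a))
      rw [apply_codual, adj_apply, star_star, h2, map_sub]
    · rw [codual_codual]
      exact h3

/-- The obstruction to a homotopy. -/
def homotopyDefect (f f' : SplitMap x y) (D : Dual Λ y.F →ₗ[Λ] x.G) : QGroup Λ ε (Dual Λ y.F) :=
  f'.conu - f.conu + (ε : ℤ) • QGroup.mk ε (ev.comp (f'.α.toLinearMap.comp (x.γ.comp D))) -
    x.θ.pull D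

/-- The two linear conditions of a homotopy nearly imply the quadratic one: the equations satisfied
by `f` and `f'` make the defect orthogonal to the image of `μ'`. On a trivial summand `μ'` is the
identity, so only the part of the defect on `V'^*` remains to be controlled. -/
theorem IsIso.homotopyDefect_sym (hf : f.IsIso Z) (hf' : f'.IsIso Z) {D : Dual Λ y.F →ₗ[Λ] x.G}
    (h1 : ∀ g, D (y.μ g) = f'.β.symm g - f.β.symm g)
    (h2 : ∀ φ a, x.μ (D φ) a = φ (f'.α a) - φ (f.α a)) (φ : Dual Λ y.F) (g : y.G) :
    (homotopyDefect f f' D).sym φ (y.μ g) = 0 := by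
  have e1 : (ev (f'.α (x.γ (D φ)))) (y.μ g) = (ε : ℤ) • x.θ.sym (D φ) (f'.β.symm g) := by
    have : y.μ g (f'.α (x.γ (D φ))) = x.μ (f'.β.symm g) (x.γ (D φ)) :=
      DFunLike.congr_fun (hf'.dualMap_μ g) _
    rw [ev_apply, this, hf.source_sym, QGroup.sym_comm, star_smul, star_star, star_trivial]
  have e2 : (ev (f'.α (x.γ (D (y.μ g))))) φ = star (φ (f'.α (x.γ (D (y.μ g))))) := rfl
  have e3 : x.θ.sym (D φ) (D (y.μ g)) = φ (f'.α (x.γ (D (y.μ g)))) - φ (f.α (x.γ (D (y.μ g)))) := by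
    rw [← hf.source_sym, h2]
  have e4 : x.θ.sym (D φ) (f'.β.symm g) =
      φ (f'.α (x.γ (f'.β.symm g))) - φ (f.α (x.γ (f'.β.symm g))) := by
    rw [← hf.source_sym, h2]
  unfold homotopyDefect
  rw [map_sub, map_add, map_sub, map_zsmul]
  simp only [LinearMap.sub_apply, LinearMap.add_apply, Dual.sub_apply, Dual.add_apply,
    LinearMap.smul_apply, Dual.zsmul_apply, QGroup.sym_pull_apply, QGroup.sym_mk, Teps_apply,
    hf.conu_sym, hf'.conu_sym, LinearMap.comp_apply, LinearEquiv.coe_coe, e1, e2, e3, star_star,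
    smul_add, eps_smul_eps_smul, e4]
  rw [h1]
  simp only [map_sub]
  abel

/-- Along `μ'` the map `D` is `β'⁻¹ - β⁻¹`, and the pullbacks of `α ν α^*` are differences of values
of `θ`. Polarising `θ` at this difference makes all terms cancel; the quadratic class, and not only
its symmetrisation, vanishes. -/
theorem IsIso.homotopyDefect_pull (hf : f.IsIso Z) (hf' : f'.IsIso Z) {D : Dual Λ y.F →ₗ[Λ] x.G}
    (h1 : ∀ g, D (y.μ g) = f'.β.symm g - f.β.symm g) :
    (homotopyDefect f f' D).pull y.μ = 0 := by
  have hD : D.comp y.μ = f'.β.symm.toLinearMap - f.β.symm.toLinearMap := LinearMap.ext h1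
  have e0 : (ε : ℤ) • Sesq.pull y.μ (ev.comp (f'.α.toLinearMap.comp (x.γ.comp D))) =
      Sesq.cross f'.β.symm.toLinearMap f'.β.symm.toLinearMap x.θ.sym -
        Sesq.cross f.β.symm.toLinearMap f'.β.symm.toLinearMap x.θ.sym := by
    refine LinearMap.ext fun g => Dual.ext fun g' => ?_
    have : y.μ g' (f'.α (x.γ (D (y.μ g)))) = x.μ (f'.β.symm g') (x.γ (D (y.μ g))) :=
      DFunLike.congr_fun (hf'.dualMap_μ g') _
    change (ε : ℤ) • star (y.μ g' (f'.α (x.γ (D (y.μ g))))) =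
      x.θ.sym (f'.β.symm g) (f'.β.symm g') - x.θ.sym (f.β.symm g) (f'.β.symm g')
    rw [this, hf.source_sym, ← QGroup.sym_comm, h1, map_sub]
    rfl
  have e1 (X : y.G →ₗ[Λ] x.G) : QGroup.mk ε (Sesq.cross X X x.θ.sym) = x.θ.pull X + x.θ.pull X := by
    have := QGroup.pull_sub_map X X x.θ
    rw [sub_self, QGroup.pull_zero_map] at this
    exact (sub_eq_zero.1 this.symm).symm
  unfold homotopyDefect
  rw [map_sub, map_add, map_sub, map_zsmul, hf.conu_pull_μ, hf'.conu_pull_μ, QGroup.pull_pull, hD,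
    QGroup.pull_sub_map, QGroup.pull_mk, ← map_zsmul, e0, map_sub, e1,
    QGroup.mk_cross_comm f.β.symm.toLinearMap]
  abel

end General

variable {v v' : QuadForm Λ ε} {P P' : BasedModule Λ}

/-- The component `V → V'` of `α`. -/
def corner (f : SplitMap ((SplitFormation.boundary v).sum (.triv P))
    ((SplitFormation.boundary v').sum (.triv P'))) : v.mod →ₗ[Λ] v'.mod :=
  (LinearMap.fst Λ v'.mod P').comp (f.α.toLinearMap.comp (LinearMap.inl Λ v.mod P))

/-- The component in `Q_ε(V'^*)` of `α ν α^*`. -/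
def cornerQ (f : SplitMap ((SplitFormation.boundary v).sum (.triv P))
    ((SplitFormation.boundary v').sum (.triv P'))) : QGroup Λ ε (Dual Λ v'.mod) :=
  f.conu.pull (dualMap (LinearMap.fst Λ v'.mod P'))

/-- The component `V' → V` of `β⁻¹`. -/
def cornerInv (f : SplitMap ((SplitFormation.boundary v).sum (.triv P))
    ((SplitFormation.boundary v').sum (.triv P'))) : v'.mod →ₗ[Λ] v.mod :=
  (LinearMap.fst Λ v.mod (Dual Λ P)).comp
    (f.β.symm.toLinearMap.comp (LinearMap.inl Λ v'.mod (Dual Λ P')))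

variable {f f' : SplitMap ((SplitFormation.boundary v).sum (.triv P))
    ((SplitFormation.boundary v').sum (.triv P'))}

theorem union_eq (f : SplitMap ((SplitFormation.boundary v).sum (.triv P))
    ((SplitFormation.boundary v').sum (.triv P'))) :
    union f = unionOf v v' f.corner f.cornerQ := by
  unfold union unionOf cornerQ conu
  rw [QGroup.pull_pull (dualMap (LinearMap.fst Λ v'.mod P'))]
  rfl

theorem triv_target_μ (t : v'.mod) : ((SplitFormation.boundary v').sum (.triv P')).μ (t, 0) =
    dualMap (LinearMap.fst Λ v'.mod P') (v'.sym t) := by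
  refine Dual.ext fun a => ?_
  change v'.sym t a.1 + 0 = v'.sym t a.1
  rw [add_zero]

/-- The equation for `μ` makes the corner of `β⁻¹` adjoint to the corner of `α`; the trivial summand
contributes an evaluation at `0`. -/
theorem IsIso.cornerInv_sym (hf : f.IsIso Z) (t : v'.mod) (x : v.mod) :
    v.sym (f.cornerInv t) x = v'.sym t (f.corner x) := by
  have h1 := DFunLike.congr_fun (hf.dualMap_μ (t, 0)) (x, 0)
  rw [triv_target_μ] at h1
  have h2 : v'.sym t (f.corner x) = v.sym (f.cornerInv t) x + (f.β.symm (t, 0)).2 0 := h1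
  rw [h2, map_zero, add_zero]

/-- The form `s` measures how far the two corners are from being inverse to each other. -/
theorem IsIso.cornerQ_sym (hf : f.IsIso Z) (y : Dual Λ v'.mod) (t : v'.mod) :
    f.cornerQ.sym y (v'.sym t) = y t - y (f.corner (f.cornerInv t)) := by
  have h1 := hf.conu_sym (dualMap (LinearMap.fst Λ v'.mod P') y) (t, 0)
  rw [triv_target_μ] at h1
  rw [cornerQ, QGroup.sym_pull_apply]
  exact h1

theorem IsIso.cornerQ_pull (hf : f.IsIso Z) :
    f.cornerQ.pull v'.sym = v'.ψ - v.ψ.pull f.cornerInv := by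
  have h1 := congrArg (QGroup.pull (LinearMap.inl Λ v'.mod (Dual Λ P'))) hf.conu_pull_μ
  have h2 : ((SplitFormation.boundary v').sum (.triv P')).μ.comp
      (LinearMap.inl Λ v'.mod (Dual Λ P')) =
      (dualMap (LinearMap.fst Λ v'.mod P')).comp v'.sym := LinearMap.ext triv_target_μ
  rw [QGroup.pull_pull, h2, ← QGroup.pull_pull] at h1
  refine h1.trans ?_
  simp only [map_sub, map_zero, add_zero, QGroup.pull_pull]
  congr 1
  exact QGroup.pull_id _

/-- The inclusion `V' → V ⊕ V'^*` of the annihilator of `V` in the union. -/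
def unionPerp (f : SplitMap ((SplitFormation.boundary v).sum (.triv P))
    ((SplitFormation.boundary v').sum (.triv P'))) : v'.mod →ₗ[Λ] v.mod × Dual Λ v'.mod :=
  f.cornerInv.prod (-v'.sym)

/-- All terms with `a` cancel by adjointness of the corners, and those with `s` by
`IsIso.cornerQ_sym`. What survives is evaluation on the second coordinate, so `V'` annihilates `V`
and pairs with `V'^*` in the standard way up to `ε`. -/
theorem IsIso.unionPerp_sym (hf : f.IsIso Z) (t : v'.mod) (p : v.mod × Dual Λ v'.mod) :
    (unionOf v v' f.corner f.cornerQ).sym (f.unionPerp t) p = (ε : ℤ) • star (p.2 t) := by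
  rw [unionOf_sym]
  change v.sym (f.cornerInv t) p.1 + (ε : ℤ) • star (p.2 (f.corner (f.cornerInv t))) +
    -(v'.sym t (f.corner p.1)) - f.cornerQ.sym (-v'.sym t) p.2 = _
  rw [hf.cornerInv_sym, QGroup.sym_comm, map_neg, hf.cornerQ_sym]
  simp only [star_neg, star_sub, smul_neg, smul_sub]
  abel

theorem IsIso.unionPerp_pull (hf : f.IsIso Z) :
    (unionOf v v' f.corner f.cornerQ).ψ.pull f.unionPerp = -v'.ψ := by
  have e0 : (ε : ℤ) • (dualMap (-v'.sym)).comp (ev.comp (f.corner.comp f.cornerInv)) =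
      -Sesq.cross f.cornerInv f.cornerInv v.ψ.sym := by
    refine LinearMap.ext fun t => Dual.ext fun t' => ?_
    change (ε : ℤ) • star (-(v'.sym t' (f.corner (f.cornerInv t)))) =
      -(v.sym (f.cornerInv t) (f.cornerInv t'))
    rw [← hf.cornerInv_sym, v.sym_comm (f.cornerInv t)]
    simp
  have e1 : QGroup.mk ε (Sesq.cross f.cornerInv f.cornerInv v.ψ.sym) =
      v.ψ.pull f.cornerInv + v.ψ.pull f.cornerInv := by
    have := QGroup.pull_sub_map f.cornerInv f.cornerInv v.ψ
    rw [sub_self, QGroup.pull_zero_map] at this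
    exact (sub_eq_zero.1 this.symm).symm
  refine (unionOf_pull _ _).trans ?_
  rw [← map_zsmul, e0, map_neg, e1, QGroup.pull_neg_map, hf.cornerQ_pull]
  abel

/-- `V'` is the annihilator of `V` in the union. -/
theorem IsIso.unionPerp_based (hZ : StarInvariant Z) (hf : f.IsIso Z) :
    IsBasedExact Z f.unionPerp ((dualMap (LinearMap.inl Λ v.mod (Dual Λ v'.mod))).comp
      (unionOf v v' f.corner f.cornerQ).sym) := by
  let FV := BasedModule.of Λ (v.mod × P)
  let dP := dualProd (Λ := Λ) v.mod P
  let dP' := dualProd (Λ := Λ) v'.mod P'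
  let μ' : (v'.mod × Dual Λ P') →ₗ[Λ] Dual Λ v'.mod × Dual Λ P' :=
    v'.sym.prodMap LinearMap.id
  -- In formulas `T((t, q), ξ) = (β⁻¹(t, q), α^{-*} ξ - μ'(t, q))`. It contains the wanted splitting
  -- `V' ⊕ V^* ≅ V ⊕ V'^*`, enlarged by the duals of the trivial summands, which are now cancelled
  -- one after the other.
  let T : ((v'.mod × Dual Λ P') × (Dual Λ v.mod × Dual Λ P)) ≃ₗ[Λ]
      ((v.mod × Dual Λ P) × (Dual Λ v'.mod × Dual Λ P')) :=
    ((LinearEquiv.refl Λ _).prodCongr (dP.trans ((dualEquiv f.α).trans dP'.symm))).trans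
      ((shear (-μ')).trans (f.β.symm.prodCongr (.refl Λ _)))
  have hT : IsSimple Z T := (IsSimple.refl.prod (IsSimple.dualProd.trans
    ((hf.simple_α.dual hZ).trans IsSimple.dualProd.symm))).trans
      ((IsSimple.shear _).trans (hf.simple_β.symm.prod .refl))
  let b : P →ₗ[Λ] v'.mod := (LinearMap.fst Λ v'.mod P').comp
    (f.α.toLinearMap.comp (LinearMap.inr Λ v.mod P))
  let E : ((v'.mod × (Dual Λ v.mod × Dual Λ P)) × Dual Λ P') ≃ₗ[Λ]
      (((v.mod × Dual Λ P) × Dual Λ v'.mod) × Dual Λ P') :=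
    (rightComm (Λ := Λ) v'.mod (Dual Λ v.mod × Dual Λ P) (Dual Λ P')).trans
      (T.trans (LinearEquiv.prodAssoc Λ _ _ _).symm)
  have hE : IsSimple Z E :=
    (isSimple_rightComm v'.mod (.of Λ (Dual Λ v.mod × Dual Λ P)) (.of Λ (Dual Λ P'))).trans
      (hT.trans IsSimple.prodAssoc.symm)
  -- On `P'^*` the last coordinate of `E` is `-1`, because `μ'` is the identity there; this cancels
  -- `P'^*` by setting `q` equal to the `P'^*`-component of `α^{-*} ξ`.
  obtain ⟨B, hB, hB'⟩ := hE.exists_schur (d := LinearEquiv.neg Λ) IsSimple.neg (fun q => by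
    change (dP'.symm (dualEquiv f.α (dP (0, 0)))).2 + -q = -q
    rw [Prod.mk_zero_zero, map_zero, map_zero, map_zero]
    simp)
  let X (ξ : Dual Λ v.mod × Dual Λ P) : Dual Λ v'.mod × Dual Λ P' :=
    dP'.symm (dualEquiv f.α (dP ξ))
  have hX (ξ : Dual Λ v.mod × Dual Λ P) (z : v.mod × P) :
      (X ξ).1 (f.α z).1 + (X ξ).2 (f.α z).2 = ξ.1 z.1 + ξ.2 z.2 := by
    have h1 : dP' (X ξ) = dualEquiv f.α (dP ξ) := dP'.apply_symm_apply _
    have h2 := DFunLike.congr_fun h1 (f.α z)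
    refine h2.trans ?_
    exact congrArg (dP ξ) (f.α.symm_apply_apply z)
  have hBX (t : v'.mod) (ξ : Dual Λ v.mod × Dual Λ P) :
      B (t, ξ) = (f.β.symm (t, (X ξ).2), (X ξ).1 - v'.sym t) := by
    have h1 := hB' (t, ξ)
    have h2 : (E ((t, ξ), 0)).2 = (X ξ).2 := add_eq_left.2 neg_zero
    rw [h2] at h1
    have h3 := congrArg Prod.fst h1
    refine h3.symm.trans ?_
    change (f.β.symm (t, -(LinearEquiv.neg Λ).symm (X ξ).2), (X ξ).1 + -v'.sym t) = _
    rw [sub_eq_add_neg]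
    congr 4
    exact neg_neg _
  have hμ (t : v'.mod) (q : Dual Λ P') (z : v.mod × P) :
      v.sym (f.β.symm (t, q)).1 z.1 + (f.β.symm (t, q)).2 z.2 =
        v'.sym t (f.α z).1 + q (f.α z).2 :=
    (DFunLike.congr_fun (hf.dualMap_μ (t, q)) z).symm
  -- The shear by `b^*` makes the `P^*`-coordinate of the result equal to the `P^*`-coordinate of
  -- `ξ`, so the triangular criterion applies and cancels `P^*` as well.
  let E₂ : ((v'.mod × Dual Λ v.mod) × Dual Λ P) ≃ₗ[Λ] ((v.mod × Dual Λ v'.mod) × Dual Λ P) :=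
    (LinearEquiv.prodAssoc Λ _ _ _).trans (B.trans
      ((rightComm (Λ := Λ) v.mod (Dual Λ P) (Dual Λ v'.mod)).trans
        (shear ((dualMap b).comp (LinearMap.snd Λ v.mod (Dual Λ v'.mod))))))
  have hE₂ : IsSimple Z E₂ := IsSimple.prodAssoc.trans (hB.trans
    ((isSimple_rightComm v.mod (.of Λ (Dual Λ P)) (.of Λ (Dual Λ v'.mod))).trans (.shear _)))
  have hE₂' (t : v'.mod) (ξ : Dual Λ v.mod × Dual Λ P) : E₂ ((t, ξ.1), ξ.2) =
      (((f.β.symm (t, (X ξ).2)).1, (X ξ).1 - v'.sym t),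
        (f.β.symm (t, (X ξ).2)).2 + dualMap b ((X ξ).1 - v'.sym t)) := by
    change shear _ (rightComm (Λ := Λ) _ _ _ (B (t, ξ))) = _
    rw [hBX]
    rfl
  obtain ⟨C, hC, hC'⟩ := hE₂.exists_of_triangular (d := .refl Λ _) .refl (fun m ξ₂ => by
    obtain ⟨t, ξ₁⟩ := m
    rw [hE₂' t (ξ₁, ξ₂)]
    refine Dual.ext fun r => ?_
    have h1 := hμ t (X (ξ₁, ξ₂)).2 (0, r)
    have h2 := hX (ξ₁, ξ₂) (0, r)
    rw [map_zero, zero_add] at h1 h2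
    change (f.β.symm (t, (X (ξ₁, ξ₂)).2)).2 r + ((X (ξ₁, ξ₂)).1 (b r) - v'.sym t (b r)) = ξ₂ r
    rw [h1, ← h2]
    change v'.sym t (b r) + _ + ((X (ξ₁, ξ₂)).1 (b r) - v'.sym t (b r)) =
      (X (ξ₁, ξ₂)).1 (b r) + _
    abel)
  have hCX (t : v'.mod) (ξ : Dual Λ v.mod) :
      C (t, ξ) = ((f.β.symm (t, (X (ξ, 0)).2)).1, (X (ξ, 0)).1 - v'.sym t) := by
    have h1 := hC' (t, ξ)
    rw [hE₂' t (ξ, 0)] at h1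
    exact (congrArg Prod.fst h1).symm
  refine ⟨C, hC, fun t => ?_, fun t ξ => Dual.ext fun x => ?_⟩
  · rw [hCX]
    have : X (0, 0) = 0 := by
      change dP'.symm (dualEquiv f.α (dP (0, 0))) = 0
      rw [Prod.mk_zero_zero, map_zero, map_zero, map_zero]
    rw [this]
    change _ = (f.cornerInv t, -v'.sym t)
    rw [Prod.fst_zero, zero_sub]
    rfl
  · rw [hCX]
    change (unionOf v v' f.corner f.cornerQ).sym _ (x, 0) = ξ x
    rw [unionOf_sym]
    have h1 := hμ t (X (ξ, 0)).2 (x, 0)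
    have h2 := hX (ξ, 0) (x, 0)
    rw [map_zero, add_zero] at h1 h2
    simp only [Dual.zero_apply, star_zero, smul_zero, add_zero, map_zero, sub_zero]
    rw [h1, ← h2]
    change v'.sym t (f.corner x) + _ + ((X (ξ, 0)).1 (f.corner x) - v'.sym t (f.corner x)) =
      (X (ξ, 0)).1 (f.corner x) + _
    abel

/-- In the splitting of the union by the annihilator `V'` and by `V^*`, the adjoint of the form
becomes triangular with diagonal blocks the identity of `V^*` and `ε` times `V' ≅ V'^**`, both
simple. -/
theorem IsIso.unionOf_isSimple (hZ : StarInvariant Z) (hf : f.IsIso Z) :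
    (unionOf v v' f.corner f.cornerQ).IsSimple Z := by
  obtain ⟨e, he, h1, h2⟩ := hf.unionPerp_based hZ
  obtain ⟨η, hη, hη'⟩ := IsSimple.units (Z := Z) v'.mod ε
  let w := unionOf v v' f.corner f.cornerQ
  let τ : Dual Λ v.mod →ₗ[Λ] Dual Λ (Dual Λ v'.mod) :=
    (dualMap (LinearMap.inr Λ v.mod (Dual Λ v'.mod))).comp
      (w.sym.comp (e.toLinearMap.comp (LinearMap.inr Λ v'.mod (Dual Λ v.mod))))
  let R := (LinearEquiv.prodComm Λ v'.mod (Dual Λ v.mod)).trans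
    (((LinearEquiv.refl Λ _).prodCongr (η.trans (evEquiv Λ v'.mod))).trans
      ((shear τ).trans (dualProd v.mod (Dual Λ v'.mod))))
  have hR : IsSimple Z R := IsSimple.prodComm.trans
    ((IsSimple.refl.prod (hη.trans .evEquiv)).trans ((IsSimple.shear _).trans .dualProd))
  refine ⟨e.symm.trans R, ?_, he.symm.trans hR⟩
  have key (z : v'.mod × Dual Λ v.mod) : R z = w.sym (e z) := by
    refine Dual.ext fun p => ?_
    obtain ⟨t, ξ⟩ := z
    obtain ⟨x, y⟩ := p
    have e1 : w.sym (e (t, ξ)) (x, 0) = ξ x := DFunLike.congr_fun (h2 t ξ) x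
    have e2 : w.sym (e (t, 0)) (0, y) = (ε : ℤ) • star (y t) := by
      rw [h1]
      exact hf.unionPerp_sym t (0, y)
    have e3 : w.sym (e (t, ξ)) (x, y) = w.sym (e (t, ξ)) (x, 0) + (w.sym (e (t, 0)) (0, y) +
        w.sym (e (0, ξ)) (0, y)) := by
      rw [← Dual.add_apply, ← map_add, ← map_add, Prod.mk_add_mk, add_zero, zero_add,
        ← map_add (w.sym (e (t, ξ)))]
      congr 1
      exact Prod.ext (add_zero x).symm (zero_add y).symm
    rw [e3, e1, e2]
    change ξ x + (star (y (η t)) + w.sym (e (0, ξ)) (0, y)) = _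
    rw [hη', map_zsmul, star_smul, star_trivial]
  refine LinearMap.ext fun p => ?_
  have := key (e.symm p)
  rw [e.apply_symm_apply] at this
  exact this

/-- Homotopic isomorphisms have isometric unions. -/
theorem Homotopic.exists_unionShear (h : f.Homotopic f') : ∃ δ,
    (unionOf v v' f'.corner f'.cornerQ).ψ.pull (unionShear v v' δ).toLinearMap =
      (unionOf v v' f.corner f.cornerQ).ψ := by
  obtain ⟨D, h1, h2, h3⟩ := homotopic_iff.1 h
  let i := LinearMap.fst Λ v'.mod P'
  -- The shear only needs the block `V'^* → V` of the dual of `Δ`. The homotopy conditions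
  -- restricted to `V` and `V'^*` are the two conditions of `unionShear_pull_iff`, with the sign
  -- absorbed in `δ`.
  let δ : Dual Λ v'.mod →ₗ[Λ] v.mod := -(LinearMap.fst Λ v.mod (Dual Λ P)).comp (D.comp (dualMap i))
  refine ⟨δ, (unionShear_pull_iff δ).2 ⟨fun x y => ?_, ?_⟩⟩
  · have h4 := h2 (dualMap i y) (x, 0)
    have h5 : v.sym (D (dualMap i y)).1 x + (D (dualMap i y)).2 0 =
      y (f'.corner x) - y (f.corner x) := h4
    rw [map_zero, add_zero] at h5
    change v.sym (-(D (dualMap i y)).1) x = _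
    rw [map_neg, Dual.neg_apply, h5, neg_sub]
  · have h4 := congrArg (QGroup.pull (dualMap i)) h3
    rw [map_sub, map_add, map_neg, map_zsmul, QGroup.pull_pull] at h4
    refine h4.trans ?_
    have e1 : (ε : ℤ) • QGroup.mk ε (ev.comp (f'.corner.comp δ)) =
        -((ε : ℤ) • QGroup.pull (dualMap i) (QGroup.mk ε (ev.comp (f'.α.toLinearMap.comp
          (((SplitFormation.boundary v).sum (.triv P)).γ.comp D))))) := by
      rw [QGroup.pull_mk, ← smul_neg, ← map_neg]
      congr 2
      refine LinearMap.ext fun y => Dual.ext fun y' => ?_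
      change star (y' (f'.corner (-(D (dualMap i y)).1))) =
        -star (y' (f'.α ((D (dualMap i y)).1, 0)).1)
      rw [map_neg, map_neg, star_neg]
      rfl
    have e2 : v.ψ.pull δ = ((v.ψ.pull (LinearMap.fst Λ v.mod (Dual Λ P)) +
        (0 : QGroup Λ ε (Dual Λ P)).pull (LinearMap.snd Λ v.mod (Dual Λ P))).pull
          (D.comp (dualMap i))) := by
      rw [map_zero, add_zero, QGroup.pull_neg_map, QGroup.pull_pull]
    rw [e1, e2, add_comm]

/-- Isomorphisms with isometric unions are homotopic. -/
theorem IsIso.homotopic_of_unionShear (hZ : StarInvariant Z) (hf : f.IsIso Z) (hf' : f'.IsIso Z)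
    {δ : Dual Λ v'.mod →ₗ[Λ] v.mod}
    (h : (unionOf v v' f'.corner f'.cornerQ).ψ.pull (unionShear v v' δ).toLinearMap =
      (unionOf v v' f.corner f.cornerQ).ψ) : f.Homotopic f' := by
  obtain ⟨hA, hS⟩ := (unionShear_pull_iff δ).1 h
  -- The shear is an isometry and does not change the coordinate in `V'^*`, which determines the
  -- pairing with the annihilator. Nondegeneracy then forces it to carry one copy of `V'` to the
  -- other, pointwise.
  have hc (t : v'.mod) : f'.cornerInv t = f.cornerInv t - δ (v'.sym t) := by
    have h1 : f'.unionPerp t = unionShear v v' δ (f.unionPerp t) := by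
      refine (hf'.unionOf_isSimple hZ).sym_injective fun p => ?_
      obtain ⟨p, rfl⟩ := (unionShear v v' δ).surjective p
      rw [hf'.unionPerp_sym]
      have h2 := congrArg (fun q => QGroup.sym q (f.unionPerp t) p) h
      simp only [QGroup.sym_pull_apply] at h2
      refine Eq.trans ?_ h2.symm
      exact (hf.unionPerp_sym t p).symm
    have h3 := congrArg Prod.fst h1
    refine h3.trans ?_
    change f.cornerInv t + δ (-v'.sym t) = _
    rw [map_neg, sub_eq_add_neg]
  -- The remaining blocks of `D` are forced. On `P'^*` the map `μ'` is the identity, so the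
  -- `V`-component must be that of `β'⁻¹ - β⁻¹`; the `P^*`-component is read off from `α' - α` on
  -- `P`.
  let D₁ : Dual Λ (v'.mod × P') →ₗ[Λ] v.mod :=
    -(δ.comp (dualMap (LinearMap.inl Λ v'.mod P'))) +
      (LinearMap.fst Λ v.mod (Dual Λ P)).comp
        ((f'.β.symm.toLinearMap - f.β.symm.toLinearMap).comp
          ((LinearMap.inr Λ v'.mod (Dual Λ P')).comp (dualMap (LinearMap.inr Λ v'.mod P'))))
  let D₂ : Dual Λ (v'.mod × P') →ₗ[Λ] Dual Λ P :=
    dualMap ((f'.α.toLinearMap - f.α.toLinearMap).comp (LinearMap.inr Λ v.mod P))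
  let D : Dual Λ (v'.mod × P') →ₗ[Λ] v.mod × Dual Λ P := D₁.prod D₂
  let dP' := dualProd (Λ := Λ) v'.mod P'
  have hD₁ (y : Dual Λ v'.mod) (q : Dual Λ P') :
      D₁ (dP' (y, q)) = -δ y + ((f'.β.symm (0, q)).1 - (f.β.symm (0, q)).1) := by
    have e1 : dualMap (LinearMap.inl Λ v'.mod P') (dP' (y, q)) = y := Dual.ext fun x => by
      change y x + q 0 = y x
      rw [map_zero, add_zero]
    have e2 : dualMap (LinearMap.inr Λ v'.mod P') (dP' (y, q)) = q := Dual.ext fun x => by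
      change y 0 + q x = q x
      rw [map_zero, zero_add]
    change -δ (dualMap (LinearMap.inl Λ v'.mod P') (dP' (y, q))) +
      ((f'.β.symm (0, dualMap (LinearMap.inr Λ v'.mod P') (dP' (y, q)))) -
        (f.β.symm (0, dualMap (LinearMap.inr Λ v'.mod P') (dP' (y, q))))).1 = _
    rw [e1, e2]
    rfl
  have hμ (g : SplitMap ((SplitFormation.boundary v).sum (.triv P))
      ((SplitFormation.boundary v').sum (.triv P'))) (hg : g.IsIso Z)
      (c : v'.mod × Dual Λ P') (z : v.mod × P) :
      v.sym (g.β.symm c).1 z.1 + (g.β.symm c).2 z.2 =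
        v'.sym c.1 (g.α z).1 + c.2 (g.α z).2 :=
    (DFunLike.congr_fun (hg.dualMap_μ c) z).symm
  have h1 (g : ((SplitFormation.boundary v').sum (.triv P') : SplitFormation Λ ε).G) :
      D (((SplitFormation.boundary v').sum (.triv P')).μ g) = f'.β.symm g - f.β.symm g := by
    obtain ⟨t, q⟩ := g
    refine Prod.ext ?_ (Dual.ext fun r => ?_)
    · have e1 : ((t, q) : v'.mod × Dual Λ P') = (t, 0) + (0, q) := by simp
      have e2 : (f'.β.symm (t, q)).1 = f'.cornerInv t + (f'.β.symm (0, q)).1 := by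
        rw [e1, map_add]; rfl
      have e3 : (f.β.symm (t, q)).1 = f.cornerInv t + (f.β.symm (0, q)).1 := by
        rw [e1, map_add]; rfl
      refine (hD₁ (v'.sym t) q).trans ?_
      change _ = (f'.β.symm (t, q)).1 - (f.β.symm (t, q)).1
      rw [e2, e3, hc]
      abel
    · have e1 := hμ f hf (t, q) (0, r)
      have e2 := hμ f' hf' (t, q) (0, r)
      rw [map_zero, zero_add] at e1 e2
      change (dP' (v'.sym t, q)) (f'.α (0, r) - f.α (0, r)) =
        (f'.β.symm (t, q)).2 r - (f.β.symm (t, q)).2 r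
      rw [e1, e2, map_sub]
      rfl
  have h2 (φ : Dual Λ (v'.mod × P')) (z : v.mod × P) :
      ((SplitFormation.boundary v).sum (.triv P)).μ (D φ) z = φ (f'.α z) - φ (f.α z) := by
    obtain ⟨⟨y, q⟩, rfl⟩ := dP'.surjective φ
    change v.sym (D₁ (dP' (y, q))) z.1 + (dP' (y, q)) (f'.α (0, z.2) - f.α (0, z.2)) = _
    have e1 : z = (z.1, 0) + (0, z.2) := by simp
    have e2 := hμ f hf (0, q) (z.1, 0)
    have e3 := hμ f' hf' (0, q) (z.1, 0)
    rw [map_zero, map_zero, add_zero, Dual.zero_apply, zero_add] at e2 e3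
    have e4 (g : SplitMap ((SplitFormation.boundary v).sum (.triv P))
      ((SplitFormation.boundary v').sum (.triv P'))) :
      dP' (y, q) (g.α (z.1, 0)) = y (g.corner z.1) + q (g.α (z.1, 0)).2 := rfl
    conv_rhs => rw [e1, map_add, map_add, map_add, map_add]
    rw [hD₁, map_add, map_neg, map_sub, Dual.add_apply, Dual.neg_apply, Dual.sub_apply, hA, e2, e3,
      map_sub, e4, e4]
    abel
  refine homotopic_iff.2 ⟨D, h1, h2, ?_⟩
  -- Only the restriction to `V'^*` uses the isometry. The restriction to `P'^*` and the mixed part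
  -- lie in the image of `μ'`, where the defect vanishes automatically.
  have hE : homotopyDefect f f' D = 0 := by
    have hp := hf.homotopyDefect_pull hf' h1
    have hs := hf.homotopyDefect_sym hf' h1 h2
    have hμq (q : Dual Λ P') : ((SplitFormation.boundary v').sum (.triv P')).μ (0, q) =
        dP' (0, q) := by
      change dP' (v'.sym 0, q) = dP' (0, q)
      rw [map_zero]
    have h0 : (homotopyDefect f f' D).pull dP'.toLinearMap = 0 := by
      refine QGroup.prod_eq_zero ?_ ?_ fun y q => ?_
      · rw [QGroup.pull_pull]
        have e0 : dP'.toLinearMap.comp (LinearMap.inl Λ (Dual Λ v'.mod) (Dual Λ P')) =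
            dualMap (LinearMap.fst Λ v'.mod P') := by
          refine LinearMap.ext fun y => Dual.ext fun z => ?_
          exact add_zero _
        have hDδ : (LinearMap.fst Λ v.mod (Dual Λ P)).comp
            (D.comp (dualMap (LinearMap.fst Λ v'.mod P'))) = -δ := by
          refine LinearMap.ext fun y => ?_
          have := hD₁ y 0
          have e5 : dualMap (LinearMap.fst Λ v'.mod P') y = dP' (y, 0) :=
            (LinearMap.congr_fun e0 y).symm
          change D₁ (dualMap (LinearMap.fst Λ v'.mod P') y) = -δ y
          rw [e5, this, Prod.mk_zero_zero, map_zero, map_zero]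
          simp
        rw [e0]
        unfold homotopyDefect
        rw [map_sub, map_add, map_sub, map_zsmul]
        change f'.cornerQ - f.cornerQ + _ - _ = 0
        rw [hS, QGroup.pull_pull]
        have e1 : (ε : ℤ) • QGroup.pull (dualMap (LinearMap.fst Λ v'.mod P')) (QGroup.mk ε
            (ev.comp (f'.α.toLinearMap.comp
              (((SplitFormation.boundary v).sum (.triv P)).γ.comp D)))) =
            -((ε : ℤ) • QGroup.mk ε (ev.comp (f'.corner.comp δ))) := by
          rw [QGroup.pull_mk, ← smul_neg, ← map_neg]
          congr 2
          refine LinearMap.ext fun y => Dual.ext fun y' => ?_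
          have e6 : (D (dualMap (LinearMap.fst Λ v'.mod P') y)).1 = -δ y :=
            LinearMap.congr_fun hDδ y
          change star (y' (f'.corner (D (dualMap (LinearMap.fst Λ v'.mod P') y)).1)) =
            -star (y' (f'.corner (δ y)))
          rw [e6, map_neg, map_neg, star_neg]
        have e2 : v.ψ.pull δ = ((v.ψ.pull (LinearMap.fst Λ v.mod (Dual Λ P)) +
            (0 : QGroup Λ ε (Dual Λ P)).pull (LinearMap.snd Λ v.mod (Dual Λ P))).pull
              (D.comp (dualMap (LinearMap.fst Λ v'.mod P')))) := by
          rw [map_zero, add_zero, QGroup.pull_pull, hDδ, QGroup.pull_neg_map]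
        rw [e1, e2]
        abel
      · have e0 : dP'.toLinearMap.comp (LinearMap.inr Λ (Dual Λ v'.mod) (Dual Λ P')) =
            ((SplitFormation.boundary v').sum (.triv P')).μ.comp
              (LinearMap.inr Λ v'.mod (Dual Λ P')) :=
          LinearMap.ext fun q => (hμq q).symm
        rw [QGroup.pull_pull, e0, ← QGroup.pull_pull, hp, map_zero]
      · rw [QGroup.sym_pull_apply]
        have := hs (dP' (y, 0)) (0, q)
        rw [hμq] at this
        exact this
    have h3 := congrArg (QGroup.pull dP'.symm.toLinearMap) h0
    rw [QGroup.pull_pull, map_zero] at h3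
    have h4 : dP'.toLinearMap.comp dP'.symm.toLinearMap = LinearMap.id :=
      LinearMap.ext fun z => dP'.apply_symm_apply z
    rw [h4, QGroup.pull_id] at h3
    exact h3
  unfold homotopyDefect at hE
  rw [← sub_eq_zero, ← hE]
  abel

end SplitMap

end Union

/-! ### Stabilisation by trivial formations. -/

section StableHomotopy

variable {Λ : Type u} [Ring Λ] [StarRing Λ] {ε : ℤˣ} [InvariantBasisNumber Λ]
  {Z : AddSubgroup (ReducedK1 Λ)}
variable {v v' : QuadForm Λ ε} {P P' R T T' : BasedModule Λ}

namespace SplitMap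

/-- On trivial formations `θ = 0` and `μ` is the identity on the source, so the equation for `θ`
says precisely that `ν` vanishes. -/
theorem IsIso.conu_eq_zero {g : SplitMap (.triv T) ((SplitFormation.triv P).sum (.triv R))}
    (hg : g.IsIso (ε := ε) Z) : g.conu = 0 := by
  refine conu_of_ν_eq_zero ?_
  have h := hg.eqθ
  have h1 : (0 : QGroup Λ ε (Dual Λ T)) + g.ν.pull LinearMap.id =
    ((0 : QGroup Λ ε _).pull (LinearMap.fst Λ (Dual Λ P) (Dual Λ R)) +
      (0 : QGroup Λ ε _).pull (LinearMap.snd Λ (Dual Λ P) (Dual Λ R))).pull g.β.toLinearMap := h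
  rw [zero_add, QGroup.pull_id] at h1
  rw [h1]
  simp

theorem IsIso.conu_eq_zero' {h : SplitMap ((SplitFormation.triv P').sum (.triv R)) (.triv T')}
    (hh : h.IsIso (ε := ε) Z) : h.conu = 0 := by
  have h1 := hh.symm.conu_eq_zero
  rw [conu_symm, neg_eq_zero] at h1
  exact conu_of_ν_eq_zero h1

variable {f : SplitMap ((SplitFormation.boundary v).sum (.triv P))
    ((SplitFormation.boundary v').sum (.triv P'))}
  {g : SplitMap (.triv T) ((SplitFormation.triv P).sum (.triv R))}
  {h : SplitMap ((SplitFormation.triv P').sum (.triv R)) (.triv T')}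

theorem corner_stabilise : (f.stabilise R g h).corner = f.corner := by
  refine LinearMap.ext fun x => ?_
  change (f.α (x, (g.α 0).1)).1 = (f.α (x, 0)).1
  rw [map_zero]
  rfl

/-- Re-identifying trivial summands contributes no `ν` and does not touch the block on `V'^*`. With
`corner_stabilise` this makes the union literally unchanged by stabilisation. -/
theorem cornerQ_stabilise (hg : g.IsIso Z) (hh : h.IsIso Z) :
    (f.stabilise R g h).cornerQ = f.cornerQ := by
  have e1 : (f.stabilise R g h).conu = ((f.conu.pull (dualMap (LinearMap.inl Λ (v'.mod × P') R))).pull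
      (dualMap (LinearEquiv.prodAssoc Λ v'.mod P' R).toLinearMap)).pull
        (dualMap ((SplitMap.id (.boundary v')).sum h).α.toLinearMap) := by
    have h1 : ((SplitMap.id (.boundary v')).sum h).conu = 0 := by
      rw [conu_sum, conu_id, hh.conu_eq_zero', map_zero, map_zero, add_zero]
    have h2 (x y z : SplitFormation Λ ε) : (SplitMap.assoc x y z).conu = 0 := conu_of_ν_eq_zero rfl
    have h3 : ((SplitMap.assoc (.boundary v) (.triv P) (.triv R)).symm.comp
        ((SplitMap.id (.boundary v)).sum g)).conu = 0 := by
      rw [conu_comp, conu_symm, conu_sum, conu_id, hg.conu_eq_zero, map_zero, map_zero, add_zero,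
        map_zero, zero_add]
      exact neg_zero
    unfold stabilise
    rw [conu_comp, conu_comp, conu_comp, h1, h2, h3, conu_sum, conu_id]
    simp only [map_zero, add_zero, zero_add]
    rfl
  unfold cornerQ
  rw [e1]
  simp only [QGroup.pull_pull]
  rfl

/-- A decomposition `T ≅ P ⊕ R` as an isomorphism of trivial formations. -/
def splitTriv (e : T ≃ₗ[Λ] P × R) :
    SplitMap (SplitFormation.triv (ε := ε) T) ((SplitFormation.triv P).sum (.triv R)) where
  α := e
  β := (dualEquiv e).trans (dualProd (Λ := Λ) P R).symm
  ν := 0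

theorem IsIso.splitTriv (hZ : StarInvariant Z) {e : T ≃ₗ[Λ] P × R} (he : IsSimple Z e) :
    (splitTriv (ε := ε) e).IsIso Z := by
  refine .of_zero rfl (SplitFormation.triv_isFormation T)
    ((SplitFormation.triv_isFormation P).sum (SplitFormation.triv_isFormation R))
    he ((he.dual hZ).trans IsSimple.dualProd.symm) (fun g => (map_zero e).symm) (fun g a => ?_) ?_
  · have h1 : dualProd (Λ := Λ) P R ((dualProd (Λ := Λ) P R).symm (dualEquiv e g)) = dualEquiv e g :=
      LinearEquiv.apply_symm_apply _ _
    have h2 := DFunLike.congr_fun h1 (e a)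
    refine h2.trans ?_
    exact congrArg g (e.symm_apply_apply a)
  · simp

end SplitMap

/-- The trivial summands of two stable isomorphisms become isomorphic after stabilisation. -/
theorem exists_common_stabilisation (Z : AddSubgroup (ReducedK1 Λ)) (P P' Q Q' : BasedModule Λ)
    (h : rank Λ P - rank Λ P' = rank Λ Q - rank Λ Q') :
    ∃ a b m n : ℕ, (∃ e : (P × (Fin a → Λ)) ≃ₗ[Λ] (Fin m → Λ), IsSimple Z e) ∧
      (∃ e : (Q × (Fin b → Λ)) ≃ₗ[Λ] (Fin m → Λ), IsSimple Z e) ∧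
      (∃ e : (P' × (Fin a → Λ)) ≃ₗ[Λ] (Fin n → Λ), IsSimple Z e) ∧
      ∃ e : (Q' × (Fin b → Λ)) ≃ₗ[Λ] (Fin n → Λ), IsSimple Z e := by
  obtain ⟨n₁, h₁⟩ := IsSimple.exists_stably_free P Z
  obtain ⟨n₂, h₂⟩ := IsSimple.exists_stably_free Q Z
  obtain ⟨n₃, h₃⟩ := IsSimple.exists_stably_free P' Z
  obtain ⟨n₄, h₄⟩ := IsSimple.exists_stably_free Q' Z
  -- The number `K` exceeds every threshold and every rank in absolute value. Adding `K - rank P` to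
  -- `P` and `K - rank Q` to `Q` gives rank `K` for both, and the hypothesis on differences makes
  -- the enlarged `P'` and `Q'` agree in rank.
  let K := n₁ + n₂ + n₃ + n₄ + (rank Λ P).natAbs + (rank Λ Q).natAbs + (rank Λ P').natAbs +
    (rank Λ Q').natAbs
  refine ⟨(K - rank Λ P).toNat, (K - rank Λ Q).toNat, K, (K + rank Λ P' - rank Λ P).toNat,
    h₁ _ _ ?_ ?_, h₂ _ _ ?_ ?_, h₃ _ _ ?_ ?_, h₄ _ _ ?_ ?_⟩ <;> omega

theorem SplitMap.IsIso.rank_eq {f : SplitMap ((SplitFormation.boundary v).sum (.triv P))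
    ((SplitFormation.boundary v').sum (.triv P'))} :
    v.rank + EpsQuad.rank Λ P = v'.rank + EpsQuad.rank Λ P' := by
  have h := rank_eq_of_equiv (M := v.mod × P) (N := v'.mod × P') f.α
  rw [rank_prod, rank_prod] at h
  exact h

/-- Stable isomorphisms with isometric unions are stably homotopic. -/
theorem StableIso.stablyHomotopic_of_unionShear (hZ : StarInvariant Z)
    {f f' : StableIso Z (.boundary v) (.boundary v')} {δ : Dual Λ v'.mod →ₗ[Λ] v.mod}
    (h : (unionOf v v' f'.map.corner f'.map.cornerQ).ψ.pull (unionShear v v' δ).toLinearMap =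
      (unionOf v v' f.map.corner f.map.cornerQ).ψ) : f.StablyHomotopic f' := by
  -- Both differences of ranks of trivial summands equal `rank v' - rank v`, so the source and
  -- target can be made equal simultaneously.
  have hr := SplitMap.IsIso.rank_eq (f := f.map)
  have hr' := SplitMap.IsIso.rank_eq (f := f'.map)
  obtain ⟨a, b, m, n, ⟨e₁, h₁⟩, ⟨e₂, h₂⟩, ⟨e₃, h₃⟩, ⟨e₄, h₄⟩⟩ :=
    exists_common_stabilisation Z f.P f.P' f'.P f'.P' (by linarith)
  have k₁ := SplitMap.IsIso.splitTriv (P := f.P) (R := freeMod Λ a) (T := freeMod Λ m)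
    (ε := ε) hZ h₁.symm
  have k₂ := SplitMap.IsIso.splitTriv (P := f'.P) (R := freeMod Λ b) (T := freeMod Λ m)
    (ε := ε) hZ h₂.symm
  have k₃ := (SplitMap.IsIso.splitTriv (P := f.P') (R := freeMod Λ a) (T := freeMod Λ n)
    (ε := ε) hZ h₃.symm).symm
  have k₄ := (SplitMap.IsIso.splitTriv (P := f'.P') (R := freeMod Λ b) (T := freeMod Λ n)
    (ε := ε) hZ h₄.symm).symm
  refine ⟨freeMod Λ m, freeMod Λ n, freeMod Λ a, freeMod Λ b, _, _, _, _, k₁, k₂, k₃, k₄, ?_⟩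
  have hb := SplitFormation.boundary_isFormation (Z := Z) v
  have hb' := SplitFormation.boundary_isFormation (Z := Z) v'
  refine SplitMap.IsIso.homotopic_of_unionShear hZ
    (f.isIso.stabilise hb hb' (SplitFormation.triv_isFormation _)
      (SplitFormation.triv_isFormation _) k₁ k₃)
    (f'.isIso.stabilise hb hb' (SplitFormation.triv_isFormation _)
      (SplitFormation.triv_isFormation _) k₂ k₄) (δ := δ) ?_
  rw [SplitMap.corner_stabilise, SplitMap.corner_stabilise, SplitMap.cornerQ_stabilise k₁ k₃,
    SplitMap.cornerQ_stabilise k₂ k₄]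
  exact h

/-- Stably homotopic stable isomorphisms have isometric unions. -/
theorem StableIso.StablyHomotopic.exists_unionShear
    {f f' : StableIso Z (.boundary v) (.boundary v')} (h : f.StablyHomotopic f') : ∃ δ,
    (unionOf v v' f'.map.corner f'.map.cornerQ).ψ.pull (unionShear v v' δ).toLinearMap =
      (unionOf v v' f.map.corner f.map.cornerQ).ψ := by
  obtain ⟨P, Q, R, R', g, g', k, k', hg, hg', hk, hk', h⟩ := h
  obtain ⟨δ, hδ⟩ := h.exists_unionShear
  refine ⟨δ, ?_⟩
  rw [SplitMap.corner_stabilise, SplitMap.corner_stabilise, SplitMap.cornerQ_stabilise hg hk,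
    SplitMap.cornerQ_stabilise hg' hk'] at hδ
  exact hδ

theorem isSimple_unionShear (δ : Dual Λ v'.mod →ₗ[Λ] v.mod) : IsSimple Z (unionShear v v' δ) :=
  IsSimple.prodComm.trans ((IsSimple.shear δ).trans .prodComm)

end StableHomotopy

/-! ### Recognising a form with two submodules as a union. -/

section Presentation

variable {Λ : Type u} [Ring Λ] [StarRing Λ] {ε : ℤˣ} [InvariantBasisNumber Λ]
  {Z : AddSubgroup (ReducedK1 Λ)}
variable {w w' u u' m m' : QuadForm Λ ε}

/-- The form `m`, with the submodule `j : W → m` and its annihilator `k : W' → m`, is isometric to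
the union determined by `a` and `s`. -/
def Presents (Z : AddSubgroup (ReducedK1 Λ)) (w w' : QuadForm Λ ε) (a : w.mod →ₗ[Λ] w'.mod)
    (s : QGroup Λ ε (Dual Λ w'.mod)) (m : QuadForm Λ ε) (j : w.mod →ₗ[Λ] m.mod)
    (k : w'.mod →ₗ[Λ] m.mod) : Prop :=
  ∃ e : Isometry Z (unionOf w w' a s) m, (∀ x, e.toEquiv (x, 0) = j x) ∧
    ∀ t p, m.sym (k t) (e.toEquiv p) = (ε : ℤ) • star (p.2 t)

theorem SplitMap.IsIso.presents {P P' : BasedModule Λ}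
    {f : SplitMap ((SplitFormation.boundary w).sum (.triv P))
    ((SplitFormation.boundary w').sum (.triv P'))} (hf : f.IsIso Z) :
    Presents Z w w' f.corner f.cornerQ (unionOf w w' f.corner f.cornerQ)
      (LinearMap.inl Λ w.mod (Dual Λ w'.mod)) f.unionPerp :=
  ⟨.refl Z _, fun _ => rfl, hf.unionPerp_sym⟩

variable {a : w.mod →ₗ[Λ] w'.mod} {s : QGroup Λ ε (Dual Λ w'.mod)} {j : w.mod →ₗ[Λ] m.mod}
    {k : w'.mod →ₗ[Λ] m.mod}

theorem Presents.isometry (h : Presents Z w w' a s m j k) (G : Isometry Z m m') :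
    Presents Z w w' a s m' (G.toEquiv.toLinearMap.comp j) (G.toEquiv.toLinearMap.comp k) := by
  obtain ⟨e, h1, h2⟩ := h
  exact ⟨e.trans G, fun x => congrArg G.toEquiv (h1 x), fun t p =>
    (G.sym_eq (k t) (e.toEquiv p)).trans (h2 t p)⟩

theorem Presents.pull_left (h : Presents Z w w' a s m j k) : m.ψ.pull j = w.ψ := by
  obtain ⟨e, h1, h2⟩ := h
  have h3 : j = e.toEquiv.toLinearMap.comp (LinearMap.inl Λ w.mod (Dual Λ w'.mod)) :=
    LinearMap.ext fun x => (h1 x).symm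
  rw [h3, ← QGroup.pull_pull, e.pull_eq]
  exact unionOf_pull_inl

/-- The pairings prescribed for `k` are those of the standard annihilator of the union, and the form
is nondegenerate. So `k` is the image of that annihilator and inherits its properties. -/
theorem Presents.perp {P P' : BasedModule Λ} (hZ : StarInvariant Z)
    {f : SplitMap ((SplitFormation.boundary w).sum (.triv P))
    ((SplitFormation.boundary w').sum (.triv P'))} (hf : f.IsIso Z)
    (h : Presents Z w w' f.corner f.cornerQ m j k) : m.IsSimple Z ∧ m.ψ.pull k = -w'.ψ ∧
      IsBasedExact Z k ((dualMap j).comp m.sym) := by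
  obtain ⟨e, h1, h2⟩ := h
  have hm := (hf.unionOf_isSimple hZ).isometry hZ e
  have hk (t : w'.mod) : e.toEquiv (f.unionPerp t) = k t := hm.sym_injective fun z => by
    obtain ⟨z, rfl⟩ := e.toEquiv.surjective z
    rw [e.sym_eq, hf.unionPerp_sym, h2]
  have hk' : k = e.toEquiv.toLinearMap.comp f.unionPerp := LinearMap.ext fun t => (hk t).symm
  refine ⟨hm, ?_, ?_⟩
  · rw [hk', ← QGroup.pull_pull, e.pull_eq, hf.unionPerp_pull]
  · refine (hf.unionPerp_based hZ).congr (a := .refl Λ _) (m := e.toEquiv) (c := .refl Λ _)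
      .refl e.simple .refl hk fun p => Dual.ext fun x => ?_
    have := e.sym_eq p (x, 0)
    rw [h1] at this
    exact this.symm

/-- A presentation determines the stable homotopy class. -/
theorem Presents.stablyHomotopic (hZ : StarInvariant Z)
    {f f' : StableIso Z (.boundary w) (.boundary w')}
    (h : Presents Z w w' f.map.corner f.map.cornerQ m j k)
    (h' : Presents Z w w' f'.map.corner f'.map.cornerQ m j k) : f.StablyHomotopic f' := by
  obtain ⟨e, h1, h2⟩ := h
  obtain ⟨e', h1', h2'⟩ := h'
  -- The comparison isometry fixes `V` because both presentations restrict to `j`, and fixes the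
  -- coordinate in `V'^*` because both have the same pairings with `k`. Such a map is a shear.
  let g := e.trans e'.symm
  have hg (p : w.mod × Dual Λ w'.mod) : e'.toEquiv (g.toEquiv p) = e.toEquiv p :=
    e'.toEquiv.apply_symm_apply _
  have hg1 (x : w.mod) : g.toEquiv (x, 0) = (x, 0) := by
    refine e'.toEquiv.injective ?_
    rw [hg, h1, h1']
  have hg2 (p : w.mod × Dual Λ w'.mod) : (g.toEquiv p).2 = p.2 := Dual.ext fun t => by
    have h3 := h2' t (g.toEquiv p)
    rw [hg, h2] at h3
    have h4 := congrArg (fun z => star ((ε : ℤ) • z)) h3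
    simp only [eps_smul_eps_smul, star_star] at h4
    exact h4.symm
  let δ : Dual Λ w'.mod →ₗ[Λ] w.mod := (LinearMap.fst Λ w.mod (Dual Λ w'.mod)).comp
    (g.toEquiv.toLinearMap.comp (LinearMap.inr Λ w.mod (Dual Λ w'.mod)))
  have hgδ : g.toEquiv.toLinearMap = (unionShear w w' δ).toLinearMap := by
    refine LinearMap.ext fun p => ?_
    have e1 : p = (p.1, 0) + (0, p.2) := Prod.ext (add_zero p.1).symm (zero_add p.2).symm
    refine Prod.ext ?_ (hg2 p)
    change (g.toEquiv p).1 = p.1 + (g.toEquiv (0, p.2)).1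
    conv_lhs => rw [e1, map_add, hg1]
    rfl
  refine StableIso.stablyHomotopic_of_unionShear hZ (δ := δ) ?_
  rw [← hgδ]
  exact g.pull_eq

/-- Transport of a union along isometries of the two forms. -/
def unionCongr (hZ : StarInvariant Z) (a : w.mod →ₗ[Λ] w'.mod) (s : QGroup Λ ε (Dual Λ w'.mod))
    (K : Isometry Z w u) (L : Isometry Z w' u') :
    Isometry Z (unionOf w w' a s) (unionOf u u'
      (L.toEquiv.toLinearMap.comp (a.comp K.toEquiv.symm.toLinearMap))
      (s.pull (dualMap L.toEquiv.toLinearMap))) where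
  toEquiv := K.toEquiv.prodCongr (dualEquiv L.toEquiv)
  simple := K.simple.prod (L.simple.dual hZ)
  pull_eq := by
    refine (unionOf_pull (K.toEquiv.toLinearMap.comp (LinearMap.fst Λ w.mod (Dual Λ w'.mod)))
      ((dualEquiv L.toEquiv).toLinearMap.comp (LinearMap.snd Λ w.mod (Dual Λ w'.mod)))).trans ?_
    rw [← QGroup.pull_pull, K.pull_eq, QGroup.pull_pull]
    congr 1
    · congr 3
      refine LinearMap.ext fun p => Dual.ext fun q => ?_
      change star (q.2 (L.toEquiv.symm (L.toEquiv (a (K.toEquiv.symm (K.toEquiv p.1)))))) =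
        star (q.2 (a p.1))
      rw [LinearEquiv.symm_apply_apply, LinearEquiv.symm_apply_apply]
    · congr 1
      congr 1
      refine LinearMap.ext fun p => Dual.ext fun q => ?_
      exact congrArg p.2 (L.toEquiv.symm_apply_apply q)

theorem Presents.congr (hZ : StarInvariant Z) (h : Presents Z w w' a s m j k) (K : Isometry Z w u)
    (L : Isometry Z w' u') : Presents Z u u'
      (L.toEquiv.toLinearMap.comp (a.comp K.toEquiv.symm.toLinearMap))
      (s.pull (dualMap L.toEquiv.toLinearMap)) m (j.comp K.toEquiv.symm.toLinearMap)
      (k.comp L.toEquiv.symm.toLinearMap) := by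
  obtain ⟨e, h1, h2⟩ := h
  refine ⟨(unionCongr hZ a s K L).symm.trans e, fun x => ?_, fun t p => ?_⟩
  · refine Eq.trans ?_ (h1 (K.toEquiv.symm x))
    refine congrArg e.toEquiv (Prod.ext rfl ?_)
    exact map_zero (dualEquiv L.toEquiv).symm
  · obtain ⟨p, rfl⟩ := (unionCongr hZ a s K L).toEquiv.surjective p
    rw [Isometry.trans_apply, Isometry.symm_toEquiv, LinearEquiv.symm_apply_apply]
    exact h2 _ p

/-- The union after the addition of `∂id` of a zero form. -/
def unionStab (a : w.mod →ₗ[Λ] w'.mod) (s : QGroup Λ ε (Dual Λ w'.mod)) (R : BasedModule Λ) :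
    Isometry Z (unionOf (w.sum (.zero R)) (w'.sum (.zero R)) (a.prodMap LinearMap.id)
      (s.pull (dualMap (LinearMap.inl Λ w'.mod R)))) ((unionOf w w' a s).sum (.hyp ε R)) where
  toEquiv := ((LinearEquiv.refl Λ (w.mod × R)).prodCongr (dualProd (Λ := Λ) w'.mod R).symm).trans
    (LinearEquiv.prodProdProdComm Λ w.mod R (Dual Λ w'.mod) (Dual Λ R))
  simple := (IsSimple.refl.prod IsSimple.dualProd.symm).trans .prodProdProdComm
  pull_eq := by
    let W := (w.mod × R) × Dual Λ (w'.mod × R)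
    let π₁ : W →ₗ[Λ] w.mod := (LinearMap.fst Λ w.mod R).comp (LinearMap.fst Λ _ _)
    let π₂ : W →ₗ[Λ] Dual Λ w'.mod := (dualMap (LinearMap.inl Λ w'.mod R)).comp (LinearMap.snd Λ _ _)
    let π₃ : W →ₗ[Λ] R × Dual Λ R := ((LinearMap.snd Λ w.mod R).comp (LinearMap.fst Λ _ _)).prod
      ((dualMap (LinearMap.inr Λ w'.mod R)).comp (LinearMap.snd Λ _ _))
    refine (map_add (QGroup.pull _) _ _).trans ?_
    rw [QGroup.pull_pull, QGroup.pull_pull]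
    refine (congrArg₂ (· + ·) (unionOf_pull π₁ π₂)
      (QGroup.mk_Teps (Sesq.pull π₃ (QuadForm.hypSesq R))).symm).trans ?_
    change _ = ((w.ψ.pull _ + (0 : QGroup Λ ε R).pull _).pull _ + (ε : ℤ) • QGroup.mk ε _ -
      (s.pull _).pull _)
    -- The identity block of `R` in the new corner contributes the `T_ε`-image of the hyperbolic
    -- form, which represents the same class in `Q_ε`.
    have e1 : Teps ε (Sesq.pull π₃ (QuadForm.hypSesq R)) + (ε : ℤ) •
        (dualMap π₂).comp (ev.comp (a.comp π₁)) = (ε : ℤ) •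
        (dualMap (LinearMap.snd Λ (w.mod × R) (Dual Λ (w'.mod × R)))).comp
        (ev.comp ((a.prodMap LinearMap.id).comp (LinearMap.fst Λ _ _))) := by
      refine LinearMap.ext fun p => Dual.ext fun q => ?_
      change (ε : ℤ) • star (q.2 (0, p.1.2)) + (ε : ℤ) • star (q.2 (a p.1.1, 0)) =
        (ε : ℤ) • star (q.2 (a p.1.1, p.1.2))
      rw [← smul_add, ← star_add, ← map_add, Prod.mk_add_mk, zero_add, add_zero]
    have e2 := congrArg (QGroup.mk ε) e1
    rw [map_add, map_zsmul, map_zsmul] at e2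
    rw [← e2, map_zero, add_zero, QGroup.pull_pull, QGroup.pull_pull]
    change w.ψ.pull π₁ + _ - s.pull π₂ + _ = w.ψ.pull π₁ + _ - s.pull π₂
    abel

theorem Presents.stab (h : Presents Z w w' a s m j k) (R : BasedModule Λ) :
    Presents Z (w.sum (.zero R)) (w'.sum (.zero R)) (a.prodMap LinearMap.id)
      (s.pull (dualMap (LinearMap.inl Λ w'.mod R))) (m.sum (.hyp ε R))
      (j.prodMap (LinearMap.inl Λ R (Dual Λ R))) (k.prodMap (LinearMap.inl Λ R (Dual Λ R))) := by
  obtain ⟨e, h1, h2⟩ := h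
  refine ⟨(unionStab a s R).trans (e.sum (.refl Z _)), fun x => ?_, fun t p => ?_⟩
  · refine Prod.ext (h1 x.1) rfl
  · rw [QuadForm.sum_sym]
    have e1 := h2 t.1 (p.1.1, dualMap (LinearMap.inl Λ w'.mod R) p.2)
    have e2 := QuadForm.hyp_sym (ε := ε) R (t.2, 0) (p.1.2, dualMap (LinearMap.inr Λ w'.mod R) p.2)
    refine (congrArg₂ (· + ·) e1 e2).trans ?_
    change (ε : ℤ) • star (p.2 (t.1, 0)) + (0 + (ε : ℤ) • star (p.2 (0, t.2))) =
      (ε : ℤ) • star (p.2 t)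
    rw [zero_add, ← smul_add, ← star_add, ← map_add, Prod.mk_add_mk, zero_add, add_zero]

namespace SplitMap

variable {P P' : BasedModule Λ} {f : SplitMap ((SplitFormation.boundary w).sum (.triv P))
    ((SplitFormation.boundary w').sum (.triv P'))}

theorem corner_congr (K : Isometry Z w u) (L : Isometry Z w' u') :
    (((SplitMap.boundary L.toEquiv).sum (SplitMap.id (.triv P'))).comp
      (f.comp ((SplitMap.boundary K.toEquiv).symm.sum (SplitMap.id (.triv P))))).corner =
    L.toEquiv.toLinearMap.comp (f.corner.comp K.toEquiv.symm.toLinearMap) := rfl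

theorem cornerQ_congr (K : Isometry Z w u) (L : Isometry Z w' u') :
    (((SplitMap.boundary L.toEquiv).sum (SplitMap.id (.triv P'))).comp
      (f.comp ((SplitMap.boundary K.toEquiv).symm.sum (SplitMap.id (.triv P))))).cornerQ =
    f.cornerQ.pull (dualMap L.toEquiv.toLinearMap) := by
  have h1 : ((SplitMap.boundary L.toEquiv).sum (SplitMap.id (.triv P'))).conu = 0 := by
    rw [conu_sum, conu_id, conu_of_ν_eq_zero (f := SplitMap.boundary L.toEquiv) rfl, map_zero,
      map_zero, add_zero]
  have h2 : ((SplitMap.boundary K.toEquiv).symm.sum (SplitMap.id (.triv P))).conu = 0 := by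
    have hν : (SplitMap.boundary K.toEquiv).symm.conu = 0 := by
      rw [conu_symm]
      exact neg_zero
    rw [conu_sum, conu_id, hν, map_zero, map_zero, add_zero]
  unfold cornerQ
  rw [conu_comp, conu_comp, h1, h2, map_zero, zero_add, add_zero, QGroup.pull_pull,
    QGroup.pull_pull]
  rfl

theorem corner_push (R : BasedModule Λ) (K : Isometry Z (w.sum (.zero R)) u)
    (L : Isometry Z (w'.sum (.zero R)) u') : (f.push R K L).corner =
      L.toEquiv.toLinearMap.comp ((f.corner.prodMap LinearMap.id).comp
        K.toEquiv.symm.toLinearMap) := rfl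

theorem cornerQ_push (R : BasedModule Λ) (K : Isometry Z (w.sum (.zero R)) u)
    (L : Isometry Z (w'.sum (.zero R)) u') : (f.push R K L).cornerQ =
      (f.cornerQ.pull (dualMap (LinearMap.inl Λ w'.mod R))).pull
        (dualMap L.toEquiv.toLinearMap) := by
  have h1 : ((SplitMap.boundary L.toEquiv).sum (SplitMap.id (.triv P'))).conu = 0 := by
    rw [conu_sum, conu_id, conu_of_ν_eq_zero (f := SplitMap.boundary L.toEquiv) rfl, map_zero,
      map_zero, add_zero]
  have h2 : ((SplitMap.boundary K.toEquiv).symm.sum (SplitMap.id (.triv P))).conu = 0 := by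
    have hν : (SplitMap.boundary K.toEquiv).symm.conu = 0 := by
      rw [conu_symm]
      exact neg_zero
    rw [conu_sum, conu_id, hν, map_zero, map_zero, add_zero]
  have h3 : (SplitMap.reorder w' (.zero R) (.triv P')).symm.conu = 0 := by
    rw [conu_symm]
    exact neg_zero
  have h4 : (SplitMap.reorder w (.zero R) (.triv P)).conu = 0 := conu_of_ν_eq_zero rfl
  unfold cornerQ push
  rw [conu_comp, conu_comp, conu_comp, conu_comp, h1, h2, h3, h4, conu_sum, conu_id]
  simp only [map_zero, zero_add, add_zero, QGroup.pull_pull]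
  rfl

end SplitMap

end Presentation

/-! ### Lagrangians and hyperbolic forms. -/

section Lagrangian

variable {Λ : Type u} [Ring Λ] [StarRing Λ] {ε : ℤˣ} [InvariantBasisNumber Λ]
  {Z : AddSubgroup (ReducedK1 Λ)}

theorem QuadForm.IsSimpleLagrangian.sym_eq_zero {m : QuadForm Λ ε} {L : BasedModule Λ}
    {i : L →ₗ[Λ] m.mod} (h : m.IsSimpleLagrangian Z i) (a b : L) : m.sym (i a) (i b) = 0 := by
  have := QGroup.sym_pull_apply i m.ψ a b
  rw [h.isLagrangian.pull_eq_zero, map_zero] at this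
  exact this.symm

/-- A simple Lagrangian has a complementary Lagrangian. -/
theorem QuadForm.IsSimpleLagrangian.exists_complement {m : QuadForm Λ ε} {L : BasedModule Λ}
    {i : L →ₗ[Λ] m.mod} (h : m.IsSimpleLagrangian Z i) :
    ∃ s : Dual Λ L →ₗ[Λ] m.mod, (∀ y a, m.sym (s y) (i a) = y a) ∧ m.ψ.pull s = 0 := by
  obtain ⟨s, hs⟩ := h.based.exists_section
  have hs (y : Dual Λ L) (a : L) : m.sym (s y) (i a) = y a :=
    DFunLike.congr_fun (LinearMap.congr_fun hs y) a
  obtain ⟨ρ, hρ⟩ := QGroup.mk_surjective ε m.ψ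
  -- The section is corrected by an element of `L`. Since `L` carries the zero form, the correction
  -- changes the quadratic form only by a cross term, and `τ` is chosen so that this term is the
  -- negative of a representative.
  obtain ⟨τ, hτ⟩ : ∃ τ : Dual Λ L →ₗ[Λ] L, ∀ y y' : Dual Λ L,
      y' (τ y) = -((ε : ℤ) • star (ρ (s y) (s y'))) := by
    refine ⟨-((ε : ℤ) • (evEquiv Λ L).symm.toLinearMap.comp (Sesq.pull s ρ)), fun y y' => ?_⟩
    change y' (-((ε : ℤ) • (evEquiv Λ L).symm (Sesq.pull s ρ y))) = _
    rw [map_neg, map_zsmul, evEquiv_symm_spec]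
    rfl
  refine ⟨i.comp τ + s, fun y a => ?_, ?_⟩
  · change m.sym (i (τ y) + s y) (i a) = y a
    rw [map_add, Dual.add_apply, h.sym_eq_zero, zero_add, hs]
  · have e1 : Sesq.cross (i.comp τ) s m.ψ.sym = -Sesq.pull s ρ := by
      refine LinearMap.ext fun y => Dual.ext fun y' => ?_
      change m.sym (i (τ y)) (s y') = -ρ (s y) (s y')
      rw [m.sym_comm, hs, hτ]
      simp only [star_neg, star_smul, star_star, star_trivial, smul_neg, eps_smul_eps_smul]
    rw [QGroup.pull_add_map, ← QGroup.pull_pull, h.isLagrangian.pull_eq_zero, e1, ← hρ,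
      QGroup.pull_mk, map_neg]
    simp

/-- A simple Lagrangian extends to an isometry with a hyperbolic form. -/
theorem QuadForm.IsSimpleLagrangian.exists_isometry {m : QuadForm Λ ε} {L : BasedModule Λ}
    {i : L →ₗ[Λ] m.mod} (h : m.IsSimpleLagrangian Z i) :
    ∃ e : Isometry Z (QuadForm.hyp ε L) m, ∀ x, e.toEquiv (x, 0) = i x := by
  obtain ⟨s, hs, hs0⟩ := h.exists_complement
  obtain ⟨f, hfs, hf⟩ := h.based.exists_equiv s fun c => Dual.ext fun a => hs c a
  have hfl (a : L) : f (a, 0) = i a := by rw [hf, map_zero, add_zero]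
  have hfr (y : Dual Λ L) : f (0, y) = s y := by rw [hf, map_zero, zero_add]
  refine ⟨⟨f, hfs, ?_⟩, hfl⟩
  refine QGroup.prod_ext ?_ ?_ fun a y => ?_
  · rw [QGroup.pull_pull, show f.toLinearMap.comp (LinearMap.inl Λ L (Dual Λ L)) = i from
      LinearMap.ext hfl, h.isLagrangian.pull_eq_zero]
    exact (QuasiFormation.hyp_isSimpleLagrangian (Z := Z) L).isLagrangian.pull_eq_zero.symm
  · have e2 : Sesq.pull (LinearMap.inr Λ L (Dual Λ L)) (QuadForm.hypSesq L) = 0 :=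
      LinearMap.ext fun y => Dual.ext fun y' => map_zero y
    rw [QGroup.pull_pull, show f.toLinearMap.comp (LinearMap.inr Λ L (Dual Λ L)) = s from
      LinearMap.ext hfr, hs0, QGroup.pull_mk, e2, map_zero]
  · rw [QGroup.sym_pull_apply]
    refine (congrArg₂ (fun x y => m.sym x y) (hfl a) (hfr y)).trans ?_
    refine Eq.trans ?_ (QuadForm.hyp_sym (ε := ε) L (a, 0) (0, y)).symm
    refine (m.sym_comm (i a) (s y)).trans ?_
    rw [hs]
    exact (zero_add _).symm

theorem QuadForm.IsSimpleLagrangian.two_mul_rank {m : QuadForm Λ ε} {L : BasedModule Λ}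
    {i : L →ₗ[Λ] m.mod} (h : m.IsSimpleLagrangian Z i) : 2 * EpsQuad.rank Λ L = m.rank := by
  obtain ⟨e, -⟩ := h.based
  have := rank_eq_of_equiv (Λ := Λ) e
  rw [rank_prod, rank_dual] at this
  exact (two_mul _).trans this

/-- `P^*` is a simple Lagrangian of `H_ε(P)`. -/
theorem hyp_isSimpleLagrangian_inr (P : BasedModule Λ) :
    (QuadForm.hyp ε P).IsSimpleLagrangian Z (L := .of Λ (Dual Λ P))
      (LinearMap.inr Λ P (Dual Λ P)) := by
  obtain ⟨e, he, h⟩ := IsSimple.units (Z := Z) P ε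
  refine .of_based ⟨(LinearEquiv.prodComm Λ _ _).trans
    (((e.trans (evEquiv Λ P)).symm).prodCongr (.refl Λ _)),
    IsSimple.prodComm.trans ((he.trans .evEquiv).symm.prod .refl), fun a => ?_, fun a c => ?_⟩ ?_
  · simp
  · obtain ⟨c, rfl⟩ := (e.trans (evEquiv Λ P)).surjective c
    refine Dual.ext fun y => ?_
    change (QuadForm.hyp ε P).sym _ (0, y) = _
    rw [QuadForm.hyp_sym]
    change a 0 + (ε : ℤ) • star (y ((e.trans (evEquiv Λ P)).symm
      (e.trans (evEquiv Λ P) c))) = star (y (e c))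
    rw [LinearEquiv.symm_apply_apply, h, map_zero, zero_add, map_zsmul]
    rcases Int.units_eq_one_or ε with rfl | rfl <;> simp
  · refine (QGroup.pull_mk _ _).trans ?_
    have : Sesq.pull (LinearMap.inr Λ P (Dual Λ P)) (QuadForm.hypSesq P) = 0 :=
      LinearMap.ext fun y => Dual.ext fun y' => map_zero y
    rw [this, map_zero]

end Lagrangian

/-! ### Inclusions into forms and their stable isomorphism. -/

section Inclusions

variable {Λ : Type u} [Ring Λ] [StarRing Λ] {ε : ℤˣ}

variable (Λ ε) in
/-- A form with a based submodule, or more generally a map of based modules `j : V → M` into the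
underlying module of a form. -/
structure Inclusion where
  form : QuadForm Λ ε
  V : BasedModule Λ
  j : V →ₗ[Λ] form.mod

namespace Inclusion

/-- The sum of two inclusions. -/
abbrev sum (x y : Inclusion Λ ε) : Inclusion Λ ε :=
  ⟨x.form.sum y.form, .of Λ (x.V × y.V), x.j.prodMap y.j⟩

variable (ε) in
/-- The inclusion of `S` in `H_ε(S)`. -/
abbrev hyp (S : BasedModule Λ) : Inclusion Λ ε := ⟨.hyp ε S, S, LinearMap.inl Λ S (Dual Λ S)⟩

variable [InvariantBasisNumber Λ] {Z : AddSubgroup (ReducedK1 Λ)}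

/-- Isomorphisms of inclusions. -/
structure Iso (Z : AddSubgroup (ReducedK1 Λ)) (x y : Inclusion Λ ε) where
  isom : Isometry Z x.form y.form
  equiv : x.V ≃ₗ[Λ] y.V
  simple : IsSimple Z equiv
  comm : ∀ a, isom.toEquiv (x.j a) = y.j (equiv a)

variable {x y z x' y' : Inclusion Λ ε}

namespace Iso

/-- The identity. -/
def refl (Z : AddSubgroup (ReducedK1 Λ)) (x : Inclusion Λ ε) : Iso Z x x :=
  ⟨.refl Z _, .refl Λ _, .refl, fun _ => rfl⟩

/-- The inverse. -/
def symm (f : Iso Z x y) : Iso Z y x :=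
  ⟨f.isom.symm, f.equiv.symm, f.simple.symm, fun a => by
    rw [Isometry.symm_toEquiv, LinearEquiv.symm_apply_eq, f.comm, LinearEquiv.apply_symm_apply]⟩

/-- The composition. -/
def trans (f : Iso Z x y) (g : Iso Z y z) : Iso Z x z :=
  ⟨f.isom.trans g.isom, f.equiv.trans g.equiv, f.simple.trans g.simple, fun a =>
    (congrArg g.isom.toEquiv (f.comm a)).trans (g.comm _)⟩

/-- The sum. -/
def sum (f : Iso Z x y) (g : Iso Z x' y') : Iso Z (x.sum x') (y.sum y') :=
  ⟨f.isom.sum g.isom, f.equiv.prodCongr g.equiv, f.simple.prod g.simple, fun a =>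
    Prod.ext (f.comm a.1) (g.comm a.2)⟩

variable (Z x y z x' y')

/-- Associativity. -/
def assoc : Iso Z ((x.sum y).sum z) (x.sum (y.sum z)) :=
  ⟨.sumAssoc _ _ _, LinearEquiv.prodAssoc Λ _ _ _, .prodAssoc, fun _ => rfl⟩

/-- Commutativity. -/
def comm' : Iso Z (x.sum y) (y.sum x) :=
  ⟨.sumComm _ _, LinearEquiv.prodComm Λ _ _, .prodComm, fun _ => rfl⟩

/-- Interchange of summands. -/
def interchange : Iso Z ((x.sum y).sum (x'.sum y')) ((x.sum x').sum (y.sum y')) :=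
  ⟨.sumSumSumComm _ _ _ _, LinearEquiv.prodProdProdComm Λ _ _ _ _, .prodProdProdComm, fun _ => rfl⟩

/-- `S ⊕ T` in `H_ε(S) ⊕ H_ε(T)`. -/
def hypSum (ε : ℤˣ) (S T : BasedModule Λ) :
    Iso Z ((Inclusion.hyp ε S).sum (.hyp ε T)) (.hyp ε (.of Λ (S × T))) :=
  ⟨.hypSum Z ε S T, .refl Λ _, .refl, fun _ => Prod.ext rfl (map_zero (dualProd (Λ := Λ) S T))⟩

variable {Z}

/-- Functoriality of the inclusion of `S` in `H_ε(S)`. -/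
def hyp (hZ : StarInvariant Z) (ε : ℤˣ) {S T : BasedModule Λ} (e : S ≃ₗ[Λ] T) (he : IsSimple Z e) :
    Iso Z (Inclusion.hyp ε S) (.hyp ε T) :=
  ⟨.hyp hZ e he, e, he, fun _ => Prod.ext rfl (map_zero (dualEquiv e))⟩

/-- The identification `(x ⊕ H(S)) ⊕ H(T) = x ⊕ H(S ⊕ T)`. -/
def stabStab (Z : AddSubgroup (ReducedK1 Λ)) (x : Inclusion Λ ε) (S T : BasedModule Λ) :
    Iso Z ((x.sum (.hyp ε S)).sum (.hyp ε T)) (x.sum (.hyp ε (.of Λ (S × T)))) :=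
  (assoc Z _ _ _).trans ((refl Z x).sum (hypSum Z ε S T))

/-- The identification `(x ⊕ y) ⊕ z = (x ⊕ z) ⊕ y`. -/
def rightComm (Z : AddSubgroup (ReducedK1 Λ)) (x y z : Inclusion Λ ε) :
    Iso Z ((x.sum y).sum z) ((x.sum z).sum y) :=
  (assoc Z x y z).trans (((refl Z x).sum (comm' Z y z)).trans (assoc Z x z y).symm)

end Iso

/-- Two inclusions are stably isomorphic if they become isomorphic after the addition of inclusions
of Lagrangians in hyperbolic forms. -/
def StabIso (Z : AddSubgroup (ReducedK1 Λ)) (x y : Inclusion Λ ε) : Prop :=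
  ∃ S T : BasedModule Λ, Nonempty (Iso Z (x.sum (.hyp ε S)) (y.sum (.hyp ε T)))

theorem StabIso.of_iso (f : Iso Z x y) : StabIso Z x y :=
  ⟨freeMod Λ 0, freeMod Λ 0, ⟨f.sum (.refl Z _)⟩⟩

theorem StabIso.refl (x : Inclusion Λ ε) : StabIso Z x x := .of_iso (.refl Z x)

theorem StabIso.symm (h : StabIso Z x y) : StabIso Z y x := by
  obtain ⟨S, T, ⟨f⟩⟩ := h
  exact ⟨T, S, ⟨f.symm⟩⟩

theorem StabIso.trans (h : StabIso Z x y) (h' : StabIso Z y z) : StabIso Z x z := by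
  obtain ⟨S, T, ⟨f⟩⟩ := h
  obtain ⟨S', T', ⟨g⟩⟩ := h'
  exact ⟨_, _, ⟨(Iso.stabStab Z x S S').symm.trans ((f.sum (.refl Z _)).trans
    ((Iso.rightComm Z _ _ _).trans ((g.sum (.refl Z _)).trans (Iso.stabStab Z z T' T))))⟩⟩

theorem StabIso.sum (h : StabIso Z x y) (h' : StabIso Z x' y') :
    StabIso Z (x.sum x') (y.sum y') := by
  obtain ⟨S, T, ⟨f⟩⟩ := h
  obtain ⟨S', T', ⟨g⟩⟩ := h'
  exact ⟨_, _, ⟨((Iso.refl Z _).sum (Iso.hypSum Z ε S S').symm).trans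
    ((Iso.interchange Z _ _ _ _).trans ((f.sum g).trans ((Iso.interchange Z _ _ _ _).trans
      ((Iso.refl Z _).sum (Iso.hypSum Z ε T T')))))⟩⟩

theorem stabIso_sum_hyp (x : Inclusion Λ ε) (S : BasedModule Λ) :
    StabIso Z (x.sum (.hyp ε S)) x :=
  ⟨freeMod Λ 0, _, ⟨Iso.stabStab Z x S _⟩⟩

/-- A simple Lagrangian is isomorphic to the standard Lagrangian of a hyperbolic form. -/
theorem nonempty_iso_hyp {m : QuadForm Λ ε} {L : BasedModule Λ} {i : L →ₗ[Λ] m.mod}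
    (h : m.IsSimpleLagrangian Z i) : Nonempty (Iso Z ⟨m, L, i⟩ (.hyp ε L)) := by
  obtain ⟨e, he⟩ := h.exists_isometry
  exact ⟨Iso.symm ⟨e, .refl Λ _, .refl, he⟩⟩

/-- Every simple Lagrangian is standard, so it is one of the summands that stabilisation ignores.
This makes the choice of a Lagrangian invisible to the invariant. -/
theorem stabIso_sum_lagrangian (x : Inclusion Λ ε) {m : QuadForm Λ ε} {L : BasedModule Λ}
    {i : L →ₗ[Λ] m.mod} (h : m.IsSimpleLagrangian Z i) : StabIso Z (x.sum ⟨m, L, i⟩) x := by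
  obtain ⟨f⟩ := nonempty_iso_hyp h
  exact (StabIso.of_iso ((Iso.refl Z x).sum f)).trans (stabIso_sum_hyp x L)

/-- A based inclusion of the annihilator of an inclusion. -/
def IsAnnihilator (Z : AddSubgroup (ReducedK1 Λ)) (x : Inclusion Λ ε) {U : BasedModule Λ}
    (k : U →ₗ[Λ] x.form.mod) : Prop :=
  IsBasedExact Z k ((dualMap x.j).comp x.form.sym)

theorem IsAnnihilator.sum {U U' : BasedModule Λ} {k : U →ₗ[Λ] x.form.mod}
    {k' : U' →ₗ[Λ] y.form.mod} (h : x.IsAnnihilator Z k) (h' : y.IsAnnihilator Z k') :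
    (x.sum y).IsAnnihilator Z (U := .of Λ (U × U')) (k.prodMap k') := by
  refine (IsBasedExact.prod h h').congr (a := .refl Λ _) (m := .refl Λ _)
    (c := dualProd (Λ := Λ) x.V y.V) .refl .refl .dualProd (fun _ => rfl) fun a => ?_
  refine Dual.ext fun b => ?_
  exact (QuadForm.sum_sym x.form y.form a (x.j b.1, y.j b.2)).symm

theorem isAnnihilator_hyp (S : BasedModule Λ) : (Inclusion.hyp ε S).IsAnnihilator Z (U := S)
    (LinearMap.inl Λ S (Dual Λ S)) :=
  (QuasiFormation.hyp_isSimpleLagrangian S).based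

/-- Isomorphisms of inclusions carry annihilators to annihilators. -/
theorem IsAnnihilator.exists_iso (hZ : StarInvariant Z) {U U' : BasedModule Λ}
    {k : U →ₗ[Λ] x.form.mod} {k' : U' →ₗ[Λ] y.form.mod} (h : x.IsAnnihilator Z k)
    (h' : y.IsAnnihilator Z k') (f : Iso Z x y) :
    ∃ g : Iso Z ⟨x.form, U, k⟩ ⟨y.form, U', k'⟩, g.isom = f.isom := by
  obtain ⟨e, he, h1, h2⟩ := h
  obtain ⟨e', he', h1', h2'⟩ := h'
  -- In the splittings of the two forms by annihilator and dual, the isometry preserves annihilators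
  -- and acts on the quotient `V^*` by the dual of the isomorphism of sources. One diagonal block
  -- being simple, so is the other.
  obtain ⟨B, hB, hB'⟩ := IsSimple.exists_of_triangular
    (he.trans (f.isom.simple.trans he'.symm)) (f.simple.dual hZ) (fun t c => by
      refine Eq.trans (h2' (e'.symm (f.isom.toEquiv (e (t, c)))).1 _).symm ?_
      change (dualMap y.j).comp y.form.sym (e' (e'.symm (f.isom.toEquiv (e (t, c))))) = _
      rw [e'.apply_symm_apply]
      refine Dual.ext fun a => ?_
      obtain ⟨a, rfl⟩ := f.equiv.surjective a
      have h3 := f.isom.sym_eq (e (t, c)) (x.j a)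
      rw [f.comm] at h3
      refine h3.trans ((DFunLike.congr_fun (h2 t c) a).trans ?_)
      exact (congrArg c (f.equiv.symm_apply_apply a)).symm)
  refine ⟨⟨f.isom, B, hB, fun t => ?_⟩, rfl⟩
  have h4 : e'.symm (f.isom.toEquiv (e (t, 0))) = (B t, 0) := hB' t
  rw [LinearEquiv.symm_apply_eq, h1, h1'] at h4
  exact h4

/-- The form induced on the source of an inclusion. -/
abbrev induced (x : Inclusion Λ ε) : QuadForm Λ ε := ⟨x.V, x.form.ψ.pull x.j⟩

theorem sum_hyp_pull (m : QuadForm Λ ε) {V : BasedModule Λ} (j : V →ₗ[Λ] m.mod) (S : BasedModule Λ) :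
    (m.sum (.hyp ε S)).ψ.pull (j.prodMap (LinearMap.inl Λ S (Dual Λ S))) =
      (m.ψ.pull j).pull (LinearMap.fst Λ V S) := by
  -- Only the vanishing of the form on `S` is used, in which torsion plays no role; `⊤` serves as an
  -- arbitrary subgroup.
  have h := (QuasiFormation.hyp_isSimpleLagrangian (ε := ε) (Z := ⊤) S).isLagrangian.pull_eq_zero
  refine (map_add (QGroup.pull _) _ _).trans ?_
  have e2 : (QuadForm.hyp ε S).ψ.pull ((LinearMap.inl Λ S (Dual Λ S)).comp (LinearMap.snd Λ V S)) =
      0 := by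
    rw [← QGroup.pull_pull]
    exact (congrArg _ h).trans (map_zero _)
  have e3 : (m.ψ.pull (LinearMap.fst Λ m.mod (S × Dual Λ S))).pull
      (j.prodMap (LinearMap.inl Λ S (Dual Λ S))) = (m.ψ.pull j).pull (LinearMap.fst Λ V S) := by
    rw [QGroup.pull_pull, QGroup.pull_pull]
    rfl
  exact (congrArg₂ (· + ·) e3 e2).trans (add_zero _)

/-- The form induced on the source of an inclusion, with the opposite sign. -/
abbrev coinduced (x : Inclusion Λ ε) : QuadForm Λ ε := ⟨x.V, -x.form.ψ.pull x.j⟩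

theorem Iso.pull_eq (f : Iso Z x y) :
    (y.form.ψ.pull y.j).pull f.equiv.toLinearMap = x.form.ψ.pull x.j := by
  rw [QGroup.pull_pull, ← f.isom.pull_eq, QGroup.pull_pull]
  exact congrArg (fun g => QGroup.pull g y.form.ψ) (LinearMap.ext fun a => (f.comm a).symm)

/-- The isometry of induced forms. -/
def Iso.induced (f : Iso Z x y) : Isometry Z x.induced y.induced :=
  ⟨f.equiv, f.simple, f.pull_eq⟩

/-- The isometry of induced forms with the opposite sign. -/
def Iso.coinduced (f : Iso Z x y) : Isometry Z x.coinduced y.coinduced :=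
  ⟨f.equiv, f.simple, (map_neg (QGroup.pull _) _).trans (congrArg Neg.neg f.pull_eq)⟩

/-- Stabilisation adds a zero form to the induced form. -/
def inducedStab (Z : AddSubgroup (ReducedK1 Λ)) (x : Inclusion Λ ε) (S : BasedModule Λ) :
    Isometry Z (x.sum (.hyp ε S)).induced (x.induced.sum (.zero S)) :=
  ⟨.refl Λ _, .refl, (QGroup.pull_id _).trans (by
    refine Eq.trans ?_ (sum_hyp_pull x.form x.j S).symm
    exact (congrArg₂ (· + ·) rfl (map_zero _)).trans (add_zero _))⟩

/-- Stabilisation adds a zero form to the induced form with the opposite sign. -/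
def coinducedStab (Z : AddSubgroup (ReducedK1 Λ)) (x : Inclusion Λ ε) (S : BasedModule Λ) :
    Isometry Z (x.sum (.hyp ε S)).coinduced (x.coinduced.sum (.zero S)) :=
  ⟨.refl Λ _, .refl, (QGroup.pull_id _).trans (by
    refine Eq.trans ?_ (congrArg Neg.neg (sum_hyp_pull x.form x.j S).symm)
    exact (congrArg₂ (· + ·) (map_neg _ _) (map_zero _)).trans (add_zero _))⟩

end Inclusion

end Inclusions

/-! ### Stable classes of forms as stable isometry. -/

section ZeroStab

variable {Λ : Type u} [Ring Λ] [StarRing Λ] {ε : ℤˣ} [InvariantBasisNumber Λ]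
  {Z : AddSubgroup (ReducedK1 Λ)}

/-- `(P, 0) ⊕ (Q, 0) = (P ⊕ Q, 0)`. -/
def Isometry.zeroSum (Z : AddSubgroup (ReducedK1 Λ)) (ε : ℤˣ) (P Q : BasedModule Λ) :
    Isometry Z ((QuadForm.zero (ε := ε) P).sum (.zero Q)) (.zero (.of Λ (P × Q))) :=
  ⟨.refl Λ _, .refl, by simp only [map_zero, QuadForm.sum, QuadForm.zero, add_zero]⟩

/-- `(v ⊕ (P, 0)) ⊕ (Q, 0) = v ⊕ (P ⊕ Q, 0)`. -/
def Isometry.sumZeroSum (Z : AddSubgroup (ReducedK1 Λ)) (v : QuadForm Λ ε) (P Q : BasedModule Λ) :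
    Isometry Z ((v.sum (.zero P)).sum (.zero Q)) (v.sum (.zero (.of Λ (P × Q)))) :=
  (Isometry.sumAssoc v (.zero P) (.zero Q)).trans ((Isometry.refl Z v).sum (Isometry.zeroSum Z ε P Q))

/-- The generating relation is already an equivalence: two stable isometries compose after each is
enlarged by the zero form needed for the other. -/
theorem ZeroStab.mk_eq_mk_iff {v w : QuadForm Λ ε} : ZeroStab.mk Z v = ZeroStab.mk Z w ↔
    ∃ P Q : BasedModule Λ, Nonempty (Isometry Z (v.sum (.zero P)) (w.sum (.zero Q))) := by
  refine ⟨fun h => ?_, fun h => Quot.sound h⟩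
  have key (a b : QuadForm Λ ε) (h : Relation.EqvGen (fun v w => ∃ P Q : BasedModule Λ,
      Nonempty (Isometry Z (v.sum (.zero P)) (w.sum (.zero Q)))) a b) : ∃ P Q : BasedModule Λ,
      Nonempty (Isometry Z (a.sum (.zero P)) (b.sum (.zero Q))) := by
    induction h with
    | rel _ _ h => exact h
    | refl v => exact ⟨freeMod Λ 0, freeMod Λ 0, ⟨.refl Z _⟩⟩
    | symm _ _ _ ih =>
      obtain ⟨P, Q, ⟨e⟩⟩ := ih
      exact ⟨Q, P, ⟨e.symm⟩⟩
    | trans u v w _ _ ih ih' =>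
      obtain ⟨P, Q, ⟨e⟩⟩ := ih
      obtain ⟨P', Q', ⟨e'⟩⟩ := ih'
      exact ⟨_, _, ⟨(Isometry.sumZeroSum Z u P P').symm.trans ((e.sum (.refl Z _)).trans
        ((Isometry.sumRightComm _ _ _).trans ((e'.sum (.refl Z _)).trans
          (Isometry.sumZeroSum Z w Q' Q))))⟩⟩
  exact key _ _ (Quot.eqvGen_exact h)

/-- `(v ⊕ H(P)) ⊕ H(Q) = v ⊕ H(P ⊕ Q)`. -/
def Isometry.sumHypSum (Z : AddSubgroup (ReducedK1 Λ)) (v : QuadForm Λ ε) (P Q : BasedModule Λ) :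
    Isometry Z ((v.sum (.hyp ε P)).sum (.hyp ε Q)) (v.sum (.hyp ε (.of Λ (P × Q)))) :=
  (Isometry.sumAssoc v (.hyp ε P) (.hyp ε Q)).trans
    ((Isometry.refl Z v).sum (Isometry.hypSum Z ε P Q))

/-- As for `ZeroStab.mk_eq_mk_iff`, with hyperbolic forms in place of zero forms. -/
theorem LEven.mk_eq_mk_iff {v w : QuadForm Λ ε} {hv : v.IsSimple Z} {hw : w.IsSimple Z} :
    LEven.mk v hv = LEven.mk w hw ↔
    ∃ P Q : BasedModule Λ, Nonempty (Isometry Z (v.sum (.hyp ε P)) (w.sum (.hyp ε Q))) := by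
  refine ⟨fun h => ?_, fun h => Quot.sound h⟩
  have key (a b : {v : QuadForm Λ ε // v.IsSimple Z}) (h : Relation.EqvGen (fun v w =>
      ∃ P Q : BasedModule Λ, Nonempty (Isometry Z (v.1.sum (.hyp ε P)) (w.1.sum (.hyp ε Q)))) a b) :
      ∃ P Q : BasedModule Λ, Nonempty (Isometry Z (a.1.sum (.hyp ε P)) (b.1.sum (.hyp ε Q))) := by
    induction h with
    | rel _ _ h => exact h
    | refl v => exact ⟨freeMod Λ 0, freeMod Λ 0, ⟨.refl Z _⟩⟩
    | symm _ _ _ ih =>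
      obtain ⟨P, Q, ⟨e⟩⟩ := ih
      exact ⟨Q, P, ⟨e.symm⟩⟩
    | trans u v w _ _ ih ih' =>
      obtain ⟨P, Q, ⟨e⟩⟩ := ih
      obtain ⟨P', Q', ⟨e'⟩⟩ := ih'
      exact ⟨_, _, ⟨(Isometry.sumHypSum Z u.1 P P').symm.trans ((e.sum (.refl Z _)).trans
        ((Isometry.sumRightComm _ _ _).trans ((e'.sum (.refl Z _)).trans
          (Isometry.sumHypSum Z w.1 Q' Q))))⟩⟩
  exact key _ _ (Quot.eqvGen_exact h)

/-- Stably isomorphic inclusions induce stably isometric forms. -/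
theorem Inclusion.StabIso.zeroStab_eq {x y : Inclusion Λ ε} (h : StabIso Z x y) :
    ZeroStab.mk Z x.induced = ZeroStab.mk Z y.induced := by
  obtain ⟨S, T, ⟨f⟩⟩ := h
  exact ZeroStab.mk_eq_mk_iff.2 ⟨S, T, ⟨(inducedStab Z x S).symm.trans (f.induced.trans
    (inducedStab Z y T))⟩⟩

/-- Stably isomorphic inclusions have stably isometric annihilators. -/
theorem Inclusion.StabIso.zeroStab_annihilator_eq (hZ : StarInvariant Z) {x y : Inclusion Λ ε}
    {U U' : BasedModule Λ} {k : U →ₗ[Λ] x.form.mod} {k' : U' →ₗ[Λ] y.form.mod}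
    (hk : x.IsAnnihilator Z k) (hk' : y.IsAnnihilator Z k') (h : StabIso Z x y) :
    ZeroStab.mk Z (Inclusion.mk x.form U k).coinduced =
      ZeroStab.mk Z (Inclusion.mk y.form U' k').coinduced := by
  obtain ⟨S, T, ⟨f⟩⟩ := h
  obtain ⟨g, -⟩ := (hk.sum (isAnnihilator_hyp S)).exists_iso hZ (hk'.sum (isAnnihilator_hyp T)) f
  exact ZeroStab.mk_eq_mk_iff.2 ⟨S, T, ⟨(coinducedStab Z ⟨x.form, U, k⟩ S).symm.trans
    (g.coinduced.trans (coinducedStab Z ⟨y.form, U', k'⟩ T))⟩⟩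

end ZeroStab

/-! ### The monoid of quasi-formations modulo simple formations. -/

section LMonoid

variable {Λ : Type u} [Ring Λ] [StarRing Λ] {ε : ℤˣ} [InvariantBasisNumber Λ]
  {Z : AddSubgroup (ReducedK1 Λ)}

namespace QuasiFormation

/-- The inclusion `V → M` of a quasi-formation `(M, ψ; L, V)`. -/
abbrev incl (x : QuasiFormation Z ε) : Inclusion Λ ε := ⟨x.form, x.V, x.j⟩

/-- The quasi-formation `(M, ψ; L, V)` with given inclusion `V → M`. -/
abbrev ofLagrangian (y : QuasiFormation Z ε) {L : BasedModule Λ} {i : L →ₗ[Λ] y.form.mod}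
    (h : y.form.IsSimpleLagrangian Z i) : QuasiFormation Z ε :=
  ⟨y.form, y.simple, L, i, h, y.V, y.j, y.split, y.half⟩

/-- The simple formation `(M, ψ; K, L)` of two simple Lagrangians. -/
abbrev ofLagrangians {v : QuadForm Λ ε} (hv : v.IsSimple Z) {K L : BasedModule Λ}
    {k : K →ₗ[Λ] v.mod} {i : L →ₗ[Λ] v.mod} (hk : v.IsSimpleLagrangian Z k)
    (hi : v.IsSimpleLagrangian Z i) : QuasiFormation Z ε :=
  ⟨v, hv, K, k, hk, L, i, hi.isLagrangian.split, hi.two_mul_rank⟩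

/-- Each generator alters `V ⊂ M` only by a Lagrangian in a simple form: a trivial formation
contributes `P^* ⊂ H_ε(P)`, and the relation `(K, L) + (L, V) ∼ (K, V)` drops `L ⊂ M`. -/
theorem Rel.stabIso {x y : QuasiFormation Z ε} (h : Rel x y) :
    Inclusion.StabIso Z x.incl y.incl := by
  induction h with
  | iso h =>
    obtain ⟨f, g, h, -, hs, -, hh⟩ := h
    exact .of_iso ⟨f, h, hs, hh⟩
  | stab x P => exact Inclusion.stabIso_sum_lagrangian x.incl (hyp_isSimpleLagrangian_inr P)
  | shift v hv k hk i hi j hj hL hV =>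
    exact (Inclusion.StabIso.of_iso (.comm' Z _ _)).trans
      (Inclusion.stabIso_sum_lagrangian ⟨v, _, j⟩ hi)
  | sum _ _ h h' => exact h.sum h'
  | refl x => exact .refl _
  | symm _ h => exact h.symm
  | trans _ _ h h' => exact h.trans h'

end QuasiFormation

open QuasiFormation

theorem LMonoid.mk_eq_mk_iff {x y : QuasiFormation Z ε} : LMonoid.mk x = LMonoid.mk y ↔ Rel x y :=
  Quotient.eq (r := lSetoid Z ε)

theorem LMonoid.ind {p : LMonoid Z ε → Prop} (h : ∀ x, p (LMonoid.mk x)) (ξ : LMonoid Z ε) : p ξ :=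
  Quotient.ind (s := lSetoid Z ε) h ξ

theorem LMonoid.mk_triv (P : BasedModule Λ) : LMonoid.mk (triv P : QuasiFormation Z ε) = 0 := by
  have h : LMonoid.mk ((triv (freeMod Λ 0) : QuasiFormation Z ε).sum (triv P)) =
    LMonoid.mk (triv (freeMod Λ 0)) := LMonoid.mk_eq_mk_iff.2 (.stab _ P)
  rw [← LMonoid.mk_add_mk] at h
  exact (zero_add _).symm.trans h

theorem LMonoid.mk_add_ofLagrangian (y : QuasiFormation Z ε) {K L : BasedModule Λ}
    {k : K →ₗ[Λ] y.form.mod} {i : L →ₗ[Λ] y.form.mod}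
    (hk : y.form.IsSimpleLagrangian Z k) (hi : y.form.IsSimpleLagrangian Z i) :
    LMonoid.mk (ofLagrangians y.simple hk hi) + LMonoid.mk (y.ofLagrangian hi) =
      LMonoid.mk (y.ofLagrangian hk) :=
  LMonoid.mk_eq_mk_iff.2 (.shift y.form y.simple k hk i hi y.j y.split hi.two_mul_rank y.half)

/-- Write `1` for `P` and `2` for `P^*`. Cancellation is not available in the monoid, but `[1,2] =
0` holds by definition. Then `[1,2] + [2,2] = [1,2]` gives `[2,2] = 0`, next `[2,1] + [1,2] = [2,2]`
gives `[2,1] = 0`, and `[1,2] + [2,1] = [1,1]` gives `[1,1] = 0`. -/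
theorem LMonoid.mk_self_hyp (P : BasedModule Λ) :
    LMonoid.mk (ofLagrangians (Z := Z) (QuadForm.hyp_isSimple (ε := ε) P)
      (hyp_isSimpleLagrangian P) (hyp_isSimpleLagrangian P)) = 0 ∧
    LMonoid.mk (ofLagrangians (Z := Z) (QuadForm.hyp_isSimple (ε := ε) P)
      (hyp_isSimpleLagrangian_inr P) (hyp_isSimpleLagrangian P)) = 0 := by
  have hv := QuadForm.hyp_isSimple (Z := Z) (ε := ε) P
  have h1 := hyp_isSimpleLagrangian (Z := Z) (ε := ε) P
  have h2 := hyp_isSimpleLagrangian_inr (Z := Z) (ε := ε) P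
  have e0 : LMonoid.mk (ofLagrangians hv h1 h2) = 0 := LMonoid.mk_triv P
  have e1 := LMonoid.mk_add_ofLagrangian (ofLagrangians hv h1 h2) h1 h2
  have e2 := LMonoid.mk_add_ofLagrangian (ofLagrangians hv h2 h1) h2 h1
  have e3 := LMonoid.mk_add_ofLagrangian (ofLagrangians hv h2 h1) h1 h2
  have e4 := LMonoid.mk_add_ofLagrangian (ofLagrangians hv h1 h2) h2 h1
  change LMonoid.mk (ofLagrangians hv h1 h2) + LMonoid.mk (ofLagrangians hv h2 h2) =
    LMonoid.mk (ofLagrangians hv h1 h2) at e1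
  change LMonoid.mk (ofLagrangians hv h1 h2) + LMonoid.mk (ofLagrangians hv h2 h1) =
    LMonoid.mk (ofLagrangians hv h1 h1) at e3
  change LMonoid.mk (ofLagrangians hv h2 h1) + LMonoid.mk (ofLagrangians hv h1 h2) =
    LMonoid.mk (ofLagrangians hv h2 h2) at e4
  rw [e0, zero_add] at e1 e3
  rw [e0, add_zero, e1] at e4
  rw [e4] at e3
  exact ⟨e3.symm, e4⟩

/-- The formation `(M, ψ; K, K)` is zero. -/
theorem LMonoid.mk_self {v : QuadForm Λ ε} (hv : v.IsSimple Z) {K : BasedModule Λ}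
    {k : K →ₗ[Λ] v.mod} (hk : v.IsSimpleLagrangian Z k) :
    LMonoid.mk (ofLagrangians hv hk hk) = 0 := by
  obtain ⟨e, he⟩ := hk.exists_isometry
  have h : (ofLagrangians (Z := Z) (QuadForm.hyp_isSimple (ε := ε) K) (hyp_isSimpleLagrangian K)
      (hyp_isSimpleLagrangian K)).IsIsomorphic (ofLagrangians hv hk hk) :=
    ⟨e, .refl Λ _, .refl Λ _, .refl, .refl, he, he⟩
  rw [← LMonoid.mk_eq_mk_iff.2 (.iso h)]
  exact (LMonoid.mk_self_hyp K).1

theorem LOddSimple.zero_mem : (0 : LMonoid Z ε) ∈ LOddSimple Z ε :=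
  ⟨triv (freeMod Λ 0), hyp_isSimpleLagrangian_inr (freeMod Λ 0), rfl⟩

theorem LOddSimple.add_mem {z w : LMonoid Z ε} (hz : z ∈ LOddSimple Z ε) (hw : w ∈ LOddSimple Z ε) :
    z + w ∈ LOddSimple Z ε := by
  obtain ⟨x, hx, rfl⟩ := hz
  obtain ⟨y, hy, rfl⟩ := hw
  exact ⟨x.sum y, QuadForm.IsSimpleLagrangian.sum hx hy, rfl⟩

/-- The inverse exchanges the two Lagrangians: `(K, L) + (L, K)` equals `(K, K)`, which is zero. -/
theorem LOddSimple.exists_neg {z : LMonoid Z ε} (hz : z ∈ LOddSimple Z ε) :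
    ∃ w ∈ LOddSimple Z ε, z + w = 0 := by
  obtain ⟨x, hx, rfl⟩ := hz
  have hx : x.form.IsSimpleLagrangian Z x.j := hx
  refine ⟨LMonoid.mk (ofLagrangians x.simple hx x.lagr), ⟨ofLagrangians x.simple hx x.lagr, x.lagr, rfl⟩, ?_⟩
  have := LMonoid.mk_add_ofLagrangian (ofLagrangians x.simple hx x.lagr) x.lagr hx
  exact this.trans (LMonoid.mk_self x.simple x.lagr)

/-- Adding the class of a simple formation does not change the stable isomorphism class of the
inclusion. -/
theorem stabIso_of_add_eq {x y : QuasiFormation Z ε} {z : LMonoid Z ε} (hz : z ∈ LOddSimple Z ε)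
    (h : LMonoid.mk y = LMonoid.mk x + z) : Inclusion.StabIso Z x.incl y.incl := by
  obtain ⟨w, hw, rfl⟩ := hz
  rw [LMonoid.mk_add_mk, LMonoid.mk_eq_mk_iff] at h
  exact (h.stabIso.trans (Inclusion.stabIso_sum_lagrangian x.incl hw)).symm

/-- Here the half rank summand is `S` and the Lagrangian is `S^*`, the opposite of a trivial
formation. This lets a quasi-formation absorb exactly the summand `S ⊂ H_ε(S)` of a stable
isomorphism without changing its class. -/
theorem LMonoid.mk_sum_cotriv (x : QuasiFormation Z ε) (S : BasedModule Λ) :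
    LMonoid.mk (x.sum (ofLagrangians (QuadForm.hyp_isSimple (ε := ε) S)
      (hyp_isSimpleLagrangian_inr S) (hyp_isSimpleLagrangian S))) = LMonoid.mk x := by
  rw [← LMonoid.mk_add_mk, (LMonoid.mk_self_hyp S).2, add_zero]

/-- Quasi-formations with stably isomorphic inclusions differ by a simple formation. -/
theorem exists_add_eq_of_stabIso {x y : QuasiFormation Z ε}
    (h : Inclusion.StabIso Z x.incl y.incl) :
    ∃ z ∈ LOddSimple Z ε, LMonoid.mk y = LMonoid.mk x + z := by
  obtain ⟨S, T, ⟨f⟩⟩ := h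
  let x' := x.sum (ofLagrangians (QuadForm.hyp_isSimple (ε := ε) S)
      (hyp_isSimpleLagrangian_inr S) (hyp_isSimpleLagrangian S))
  let y' := y.sum (ofLagrangians (QuadForm.hyp_isSimple (ε := ε) T)
      (hyp_isSimpleLagrangian_inr T) (hyp_isSimpleLagrangian T))
  -- Transporting the Lagrangian of `x'` along `f` gives a second Lagrangian next to the same
  -- submodule of `y'`. The formation of the two Lagrangians is the required difference.
  have hL : y'.form.IsSimpleLagrangian Z (f.isom.toEquiv.toLinearMap.comp x'.i) :=
    x'.lagr.isometry f.isom
  have hx : LMonoid.mk x' = LMonoid.mk (y'.ofLagrangian hL) := LMonoid.mk_eq_mk_iff.2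
    (.iso ⟨f.isom, .refl Λ _, f.equiv, .refl, f.simple, fun _ => rfl, f.comm⟩)
  refine ⟨_, ⟨ofLagrangians y'.simple y'.lagr hL, hL, rfl⟩, ?_⟩
  rw [← LMonoid.mk_sum_cotriv x S, ← LMonoid.mk_sum_cotriv y T]
  refine Eq.trans ?_ (add_comm _ _)
  refine (LMonoid.mk_add_ofLagrangian y' y'.lagr hL).symm.trans ?_
  rw [← hx]

end LMonoid

/-! ### The isomorphism `f_j` and its union. -/

section Glue

variable {Λ : Type u} [Ring Λ] [StarRing Λ] {ε : ℤˣ} [InvariantBasisNumber Λ]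
  {Z : AddSubgroup (ReducedK1 Λ)} {x : QuasiFormation Z ε}

/-- If `r` retracts `M` onto `V`, then `φ⁻¹ r^*` is a section of `j^* φ`, so its kernel is a summand
and can be based. -/
theorem QuasiFormation.nonempty_annihilator (x : QuasiFormation Z ε) : Nonempty (Annihilator x) := by
  obtain ⟨φ, hφ, -⟩ := x.simple
  obtain ⟨r, hr⟩ := x.split
  obtain ⟨U, k, h⟩ := exists_isBasedExact Z ((dualMap x.j).comp x.form.sym)
    (φ.symm.toLinearMap.comp (dualMap r)) (LinearMap.ext fun f => Dual.ext fun a => by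
      change x.form.sym (φ.symm (dualMap r f)) (x.j a) = f a
      rw [← hφ]
      change φ (φ.symm (dualMap r f)) (x.j a) = f a
      rw [φ.apply_symm_apply]
      exact congrArg f (LinearMap.congr_fun hr a))
  exact ⟨⟨U, k, h⟩⟩

/-- The isomorphism `(v, u, w) ↦ (t, k t + σ w + j v)` with `t = u + f (v, w)`. -/
theorem exists_glueEquiv {V U M W : Type u} [AddCommGroup V] [Module Λ V] [AddCommGroup U]
    [Module Λ U] [AddCommGroup M] [Module Λ M] [AddCommGroup W] [Module Λ W] [Based Λ V] [Based Λ U]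
    [Based Λ M] [Based Λ W] {e : (V × W) ≃ₗ[Λ] M} (he : IsSimple Z e) (f : (V × W) →ₗ[Λ] U)
    (k : U →ₗ[Λ] M) : ∃ h : (V × (U × W)) ≃ₗ[Λ] (U × M), IsSimple Z h ∧
      ∀ v u w, h (v, (u, w)) = (u + f (v, w), e (v, w) + k (u + f (v, w))) := by
  refine ⟨((LinearEquiv.refl Λ V).prodCongr (LinearEquiv.prodComm Λ U W)).trans
    ((LinearEquiv.prodAssoc Λ V W U).symm.trans ((shear f).trans
      ((LinearEquiv.prodComm Λ (V × W) U).trans (((LinearEquiv.refl Λ U).prodCongr e).trans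
        (shear k))))), ?_, fun v u w => rfl⟩
  exact (IsSimple.refl.prod .prodComm).trans (IsSimple.prodAssoc.symm.trans
    ((IsSimple.shear f).trans (IsSimple.prodComm.trans ((IsSimple.refl.prod he).trans
      (.shear k)))))

theorem Annihilator.exists_section (hZ : StarInvariant Z) (A : Annihilator x) :
    ∃ σ : Dual Λ A.U →ₗ[Λ] x.form.mod, (dualMap A.k).comp (x.form.sym.comp σ) = LinearMap.id :=
  (A.based.annihilator hZ x.simple).exists_section

theorem Annihilator.exists_glueEquiv (hZ : StarInvariant Z) (A : Annihilator x)
    {σ : Dual Λ A.U →ₗ[Λ] x.form.mod} (hσ : (dualMap A.k).comp (x.form.sym.comp σ) = LinearMap.id)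
    (ρ : Sesq Λ x.form.mod) : ∃ h : (x.V × (A.U × Dual Λ A.U)) ≃ₗ[Λ] (A.U × x.form.mod),
      IsSimple Z h ∧ (∀ v u w, (h (v, (u, w))).1 =
        -codual σ (adj x.form.sym (x.j v)) + u - codual σ (adj ρ (σ w))) ∧
      ∀ v u w, (h (v, (u, w))).2 = A.k (h (v, (u, w))).1 + σ w + x.j v := by
  obtain ⟨e, he, h1⟩ := (A.based.annihilator hZ x.simple).exists_equiv σ (LinearMap.congr_fun hσ)
  obtain ⟨h, hh, h2⟩ := EpsQuad.exists_glueEquiv he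
    ((-(codual σ).comp ((adj x.form.sym).comp x.j)).coprod (-(codual σ).comp ((adj ρ).comp σ))) A.k
  have h3 (v : x.V) (u : A.U) (w : Dual Λ A.U) : u + ((-(codual σ).comp ((adj x.form.sym).comp x.j)).coprod
      (-(codual σ).comp ((adj ρ).comp σ))) (v, w) =
        -codual σ (adj x.form.sym (x.j v)) + u - codual σ (adj ρ (σ w)) := by
    change u + (-codual σ (adj x.form.sym (x.j v)) + -codual σ (adj ρ (σ w))) = _
    abel
  refine ⟨h, hh, fun v u w => ?_, fun v u w => ?_⟩
  · rw [h2, h3]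
  · rw [h2, h1]
    abel_nf

theorem QuasiFormation.nonempty_glueData (hZ : StarInvariant Z) (x : QuasiFormation Z ε) :
    Nonempty (GlueData x) := by
  obtain ⟨A⟩ := x.nonempty_annihilator
  obtain ⟨σ, hσ⟩ := A.exists_section hZ
  obtain ⟨ρ, hρ⟩ := QGroup.mk_surjective ε x.form.ψ
  obtain ⟨h, -, h1, h2⟩ := A.exists_glueEquiv hZ hσ ρ
  obtain ⟨φ, hφ, -⟩ := x.simple
  obtain ⟨φ', hφ', -⟩ := QuadForm.hyp_isSimple (ε := ε) (Z := Z) A.U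
  exact ⟨⟨A, ρ, hρ, σ, hσ, h, h1, h2, φ, hφ, φ', hφ'⟩⟩

namespace GlueData

variable (d : GlueData x)

theorem sym_σ_k (w : Dual Λ d.U) (t : d.U) : x.form.sym (d.σ w) (d.k t) = w t :=
  DFunLike.congr_fun (LinearMap.congr_fun d.section_σ w) t

theorem sym_k_j (t : d.U) (v : x.V) : x.form.sym (d.k t) (x.j v) = 0 :=
  DFunLike.congr_fun (d.based.comp_eq_zero t) v

/-- The defining formulas determine `h`, so it coincides with the composition of shears and simple
splittings built before. -/
theorem simple_h (hZ : StarInvariant Z) : IsSimple Z d.h := by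
  obtain ⟨h, hs, h1, h2⟩ := d.exists_glueEquiv hZ d.section_σ d.ρ
  have e : d.h = h := LinearEquiv.ext fun ⟨v, u, w⟩ => by
    have e1 : (d.h (v, (u, w))).1 = (h (v, (u, w))).1 := (d.h_fst v u w).trans (h1 v u w).symm
    refine Prod.ext e1 ?_
    rw [d.h_snd, h2, e1]
  rw [e]
  exact hs

/-- The map `(v, u, w) ↦ t`. -/
def shift : (x.V × (d.U × Dual Λ d.U)) →ₗ[Λ] d.U :=
  (LinearMap.fst Λ d.U x.form.mod).comp d.h.toLinearMap

theorem apply_shift (y : Dual Λ d.U) (p : x.V × (d.U × Dual Λ d.U)) : y (d.shift p) =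
    -x.form.sym (d.σ y) (x.j p.1) + y p.2.1 - d.ρ (d.σ y) (d.σ p.2.2) := by
  have h1 : d.shift p = -codual d.σ (adj x.form.sym (x.j p.1)) + p.2.1 -
    codual d.σ (adj d.ρ (d.σ p.2.2)) := d.h_fst p.1 p.2.1 p.2.2
  rw [h1, map_sub, map_add, map_neg, apply_codual, apply_codual, adj_apply, adj_apply, star_star,
    star_star]

/-- The isometry `h : (W, θ) ⊕ H_ε(W^⊥) ≅ (W^⊥, -θ^⊥) ⊕ (M, ψ)`. -/
def isometry (hZ : StarInvariant Z) :
    Isometry Z (x.left.sum (.hyp ε d.U)) (d.right.sum x.form) where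
  toEquiv := d.h
  simple := d.simple_h hZ
  pull_eq := by
    let N := x.V × (d.U × Dual Λ d.U)
    let p₁ : N →ₗ[Λ] x.V := LinearMap.fst Λ _ _
    let p₃ : N →ₗ[Λ] d.U × Dual Λ d.U := LinearMap.snd Λ _ _
    let w : N →ₗ[Λ] Dual Λ d.U := (LinearMap.snd Λ _ _).comp p₃
    let B : N →ₗ[Λ] x.form.mod := d.σ.comp w + x.j.comp p₁
    have e2 : (LinearMap.snd Λ d.U x.form.mod).comp d.h.toLinearMap = d.k.comp d.shift + B :=
      LinearMap.ext fun p => (d.h_snd p.1 p.2.1 p.2.2).trans (add_assoc _ _ _)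
    refine (map_add (QGroup.pull _) _ _).trans ?_
    rw [QGroup.pull_pull, QGroup.pull_pull, e2, map_neg, QGroup.pull_add_map, QGroup.pull_pull,
      QGroup.pull_add_map (d.σ.comp w)]
    have e3 : Sesq.cross (d.k.comp d.shift) B x.form.ψ.sym =
        Teps ε ((dualMap d.shift).comp w) := by
      refine LinearMap.ext fun p => Dual.ext fun q => ?_
      change x.form.sym (d.k (d.shift p)) (d.σ q.2.2 + x.j q.1) = (ε : ℤ) • star (q.2.2 (d.shift p))
      rw [map_add, d.sym_k_j, add_zero, x.form.sym_comm, d.sym_σ_k]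
    -- This identity is the reason for the formula for `t`: its last two corrections cancel the
    -- value of `ρ` on the section and the pairing of the section with `V`, leaving the hyperbolic
    -- form.
    have e4 : (dualMap d.shift).comp w + Sesq.pull (d.σ.comp w) d.ρ +
        Sesq.cross (d.σ.comp w) (x.j.comp p₁) x.form.ψ.sym = Sesq.pull p₃ (QuadForm.hypSesq d.U) := by
      refine LinearMap.ext fun p => Dual.ext fun q => ?_
      change p.2.2 (d.shift q) + d.ρ (d.σ p.2.2) (d.σ q.2.2) + x.form.sym (d.σ p.2.2) (x.j q.1) =
        p.2.2 q.2.1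
      rw [d.apply_shift]
      abel
    rw [e3, QGroup.mk_Teps]
    change _ = (x.form.ψ.pull x.j).pull p₁ + QGroup.mk ε (Sesq.pull p₃ (QuadForm.hypSesq d.U))
    rw [← e4, map_add, map_add, ← QGroup.pull_mk, d.mk_ρ, QGroup.pull_pull]
    change -x.form.ψ.pull (d.k.comp d.shift) + _ = _
    abel

theorem map_isIso (hZ : StarInvariant Z) : d.map.IsIso Z := by
  obtain ⟨φ, hφ, hs⟩ := x.simple
  obtain ⟨φ', hφ', hs'⟩ := QuadForm.hyp_isSimple (ε := ε) (Z := Z) d.U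
  -- The data record isomorphisms with the right underlying maps but not their simplicity.
  -- Identifying them with the simple witnesses supplies it.
  obtain rfl : φ = d.φ := LinearEquiv.toLinearMap_injective (hφ.trans d.coe_φ.symm)
  obtain rfl : φ' = d.φ' := LinearEquiv.toLinearMap_injective (hφ'.trans d.coe_φ'.symm)
  have hb (v : QuadForm Λ ε) := SplitFormation.boundary_isFormation (Z := Z) v
  refine ((SplitMap.IsIso.id (hb _)).sum (.ofSimple hφ hs)).comp (.comp (.of_zero rfl
    ((hb _).sum (hb _)) ((hb _).sum (hb _)) (d.simple_h hZ) (d.simple_h hZ) (fun _ => rfl)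
    (fun p q => ?_) (d.isometry hZ).pull_eq.symm) ((SplitMap.IsIso.id (hb _)).sum
      (SplitMap.IsIso.ofSimple hφ' hs').symm))
  have h1 := (d.isometry hZ).sym_eq p q
  rw [QuadForm.sum_sym, QuadForm.sum_sym] at h1
  exact h1

theorem apply_corner (y : Dual Λ d.U) (v : x.V) :
    y (d.map.corner v) = -x.form.sym (d.σ y) (x.j v) := by
  refine (d.apply_shift y (v, 0)).trans ?_
  change -x.form.sym (d.σ y) (x.j v) + y 0 - d.ρ (d.σ y) (d.σ 0) = _
  rw [map_zero, map_zero, map_zero, add_zero, sub_zero]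

theorem cornerQ_eq : d.map.cornerQ = -x.form.ψ.pull d.σ := by
  -- The contribution of `(M, ψ)` to `α ν α^*` is supported on `M^*`, so it disappears on the dual
  -- of the annihilator. Only the contribution of the hyperbolic form remains.
  have h1 : ((SplitMap.id (.boundary d.right)).sum (SplitMap.ofSimple x.form d.φ)).conu.pull
      (dualMap (LinearMap.fst Λ d.U x.form.mod)) = 0 := by
    rw [SplitMap.conu_sum, SplitMap.conu_id, map_zero, zero_add, QGroup.pull_pull]
    have : (dualMap (LinearMap.inr Λ d.U x.form.mod)).comp
        (dualMap (LinearMap.fst Λ d.U x.form.mod)) = 0 :=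
      LinearMap.ext fun y => Dual.ext fun a => map_zero y
    exact (congrArg (fun g => QGroup.pull g _) this).trans (QGroup.pull_zero_map _)
  have h2 : (SplitMap.ofSimple (.hyp ε d.U) d.φ').symm.conu =
      QGroup.mk ε (Sesq.pull d.φ'.symm.toLinearMap (QuadForm.hypSesq d.U)) := by
    rw [SplitMap.conu_symm]
    exact neg_neg _
  -- The remaining form is the hyperbolic form pulled back along `g`. Pairing `g y` with arbitrary
  -- `(u, w)` determines its components: the second is `y`, the first is dual to `-ρ` on the
  -- section.
  let g : Dual Λ d.U →ₗ[Λ] d.U × Dual Λ d.U := d.φ'.symm.toLinearMap.comp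
    ((dualMap (LinearMap.inr Λ x.V (d.U × Dual Λ d.U))).comp (dualMap d.shift))
  have hg (y : Dual Λ d.U) (u : d.U) (w : Dual Λ d.U) : (g y).2 u + (ε : ℤ) • star (w (g y).1) =
      y u - d.ρ (d.σ y) (d.σ w) := by
    have e1 : d.φ' (g y) (u, w) = y (d.shift (0, (u, w))) :=
      DFunLike.congr_fun (d.φ'.apply_symm_apply _) (u, w)
    have e2 : d.φ' (g y) = (QuadForm.hyp ε d.U).sym (g y) := LinearMap.congr_fun d.coe_φ' _
    rw [e2, d.apply_shift] at e1
    refine (QuadForm.hyp_sym d.U (g y) (u, w)).symm.trans (e1.trans ?_)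
    rw [map_zero, map_zero, neg_zero, zero_add]
  have hg2 (y : Dual Λ d.U) : (g y).2 = y := Dual.ext fun u => by
    have := hg y u 0
    rw [map_zero, map_zero] at this
    simpa using this
  have hg1 (y w : Dual Λ d.U) : w (g y).1 = -((ε : ℤ) • star (d.ρ (d.σ y) (d.σ w))) := by
    have := hg y 0 w
    rw [map_zero, map_zero, zero_add, zero_sub] at this
    have e := congrArg (fun z => star ((ε : ℤ) • z)) this
    simp only [eps_smul_eps_smul, star_star] at e
    rw [e]
    rcases Int.units_eq_one_or ε with rfl | rfl <;> simp
  have h3 : Sesq.pull g (QuadForm.hypSesq d.U) = -Teps ε (Sesq.pull d.σ d.ρ) := by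
    refine LinearMap.ext fun y => Dual.ext fun y' => ?_
    change (g y).2 (g y').1 = -((ε : ℤ) • star (d.ρ (d.σ y') (d.σ y)))
    rw [hg2, hg1]
  unfold SplitMap.cornerQ map
  rw [SplitMap.conu_comp, SplitMap.conu_comp, SplitMap.conu_sum (SplitMap.id _), SplitMap.conu_id,
    h2, map_add, h1, map_zero, zero_add, add_zero]
  rw [SplitMap.conu_of_ν_eq_zero (f := (⟨d.h, d.h, 0⟩ : SplitMap
        ((SplitFormation.boundary x.left).sum (.boundary (.hyp ε d.U)))
        ((SplitFormation.boundary d.right).sum (.boundary x.form)))) rfl, add_zero]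
  refine Eq.trans ?_ ((congrArg (QGroup.mk ε) h3).trans ?_)
  · rfl
  · rw [map_neg, QGroup.mk_Teps, ← d.mk_ρ]
    rfl

/-- The isomorphism `f_j` is presented by the inclusion `j`. -/
theorem presents (hZ : StarInvariant Z) :
    Presents Z x.left d.right d.map.corner d.map.cornerQ x.form x.j (-d.k) := by
  obtain ⟨e, he, h1⟩ := (d.based.annihilator hZ x.simple).exists_equiv d.σ
    (LinearMap.congr_fun d.section_σ)
  -- The second summand is embedded by `-σ`, since the corner of `f_j` is minus the adjoint of `σ`
  -- on `V`. The same sign makes the presentation use `-k`.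
  let f := ((LinearEquiv.refl Λ x.V).prodCongr (LinearEquiv.neg Λ : Dual Λ d.U ≃ₗ[Λ] _)).trans e
  have hf (v : x.V) (y : Dual Λ d.U) : f (v, y) = x.j v - d.σ y := by
    refine (h1 v (-y)).trans ?_
    rw [map_neg, sub_eq_add_neg]
  have hfl (v : x.V) : f (v, 0) = x.j v := by rw [hf, map_zero, sub_zero]
  have hfr (y : Dual Λ d.U) : f (0, y) = (-d.σ) y := by rw [hf, map_zero, zero_sub]; rfl
  refine ⟨⟨f, (IsSimple.refl.prod .neg).trans he, ?_⟩, hfl, fun t p => ?_⟩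
  · refine QGroup.prod_ext ?_ ?_ fun v y => ?_
    · rw [QGroup.pull_pull, show f.toLinearMap.comp (LinearMap.inl Λ x.V (Dual Λ d.U)) = x.j from
        LinearMap.ext hfl]
      exact (unionOf_pull_inl (v := x.left) (v' := d.right) (a := d.map.corner)).symm
    · rw [QGroup.pull_pull, show f.toLinearMap.comp (LinearMap.inr Λ x.V (Dual Λ d.U)) = -d.σ from
        LinearMap.ext hfr, QGroup.pull_neg_map, unionOf_pull_inr (v := x.left) (v' := d.right) (a := d.map.corner),
        d.cornerQ_eq]
      exact (neg_neg _).symm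
    · rw [QGroup.sym_pull_apply]
      refine (congrArg₂ (fun a b => x.form.sym a b) (hfl v) (hfr y)).trans ?_
      refine Eq.trans ?_ (unionOf_sym (v := x.left) (v' := d.right) (v, 0) (0, y)).symm
      change x.form.sym (x.j v) (-d.σ y) = x.left.sym v 0 + (ε : ℤ) • star (y (d.map.corner v)) +
        0 - d.map.cornerQ.sym 0 y
      rw [map_zero, map_zero, d.apply_corner, x.form.sym_comm (x.j v), map_neg]
      change _ = 0 + _ + 0 - 0
      rw [zero_add, add_zero, sub_zero]
      rfl
  · change x.form.sym (-d.k t) (f p) = _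
    have e1 : f p = x.j p.1 - d.σ p.2 := hf p.1 p.2
    rw [e1, map_neg, Dual.neg_apply, map_sub, d.sym_k_j, x.form.sym_comm, d.sym_σ_k, zero_sub,
      neg_neg]

end GlueData

end Glue

/-! ### Boundary isomorphisms classified by inclusions. -/

section Comparison

variable {Λ : Type u} [Ring Λ] [StarRing Λ] {ε : ℤˣ} [InvariantBasisNumber Λ]
  {Z : AddSubgroup (ReducedK1 Λ)}

/-- Stable isomorphisms of inclusions can be realised with free modules. -/
theorem Inclusion.StabIso.exists_free (hZ : StarInvariant Z) {x y : Inclusion Λ ε}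
    (h : StabIso Z x y) : ∃ a b : ℕ,
      Nonempty (Iso Z (x.sum (.hyp ε (freeMod Λ a))) (y.sum (.hyp ε (freeMod Λ b)))) := by
  obtain ⟨S, T, ⟨f⟩⟩ := h
  obtain ⟨n₁, h₁⟩ := IsSimple.exists_stably_free S Z
  obtain ⟨n₂, h₂⟩ := IsSimple.exists_stably_free T Z
  -- Large enough for both stable freeness statements and for `rank + t` to be nonnegative, so
  -- `toNat` loses nothing.
  let t := n₁ + n₂ + (rank Λ S).natAbs + (rank Λ T).natAbs
  obtain ⟨e₁, he₁⟩ := h₁ t (rank Λ S + t).toNat (by omega) (by omega)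
  obtain ⟨e₂, he₂⟩ := h₂ t (rank Λ T + t).toNat (by omega) (by omega)
  have g (z : Inclusion Λ ε) {R : BasedModule Λ} {n : ℕ} (e : (R × (Fin t → Λ)) ≃ₗ[Λ] (Fin n → Λ))
      (he : IsSimple Z e) :
      Iso Z ((z.sum (.hyp ε R)).sum (.hyp ε (freeMod Λ t))) (z.sum (.hyp ε (freeMod Λ n))) :=
    (Iso.stabStab Z z R (freeMod Λ t)).trans ((Iso.refl Z z).sum
      (Iso.hyp hZ ε (S := .of Λ (R × (Fin t → Λ))) (T := freeMod Λ n) e he))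
  exact ⟨_, _, ⟨(g x e₁ he₁).symm.trans ((f.sum (.refl Z _)).trans (g y e₂ he₂))⟩⟩

/-- Change of the source of an inclusion. -/
def Inclusion.Iso.reparam {m : QuadForm Λ ε} {W U : BasedModule Λ} (j : W →ₗ[Λ] m.mod)
    (e : W ≃ₗ[Λ] U) (he : IsSimple Z e) :
    Iso Z ⟨m, W, j⟩ ⟨m, U, j.comp e.symm.toLinearMap⟩ :=
  ⟨.refl Z m, e, he, fun a => (congrArg j (e.symm_apply_apply a)).symm⟩

variable {w w' u u' : QuadForm Λ ε}

/-- The inclusion of the first form in the union along a stable isomorphism of boundaries. -/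
abbrev StableIso.incl (f : StableIso Z (.boundary w) (.boundary w')) : Inclusion Λ ε :=
  ⟨unionOf w w' f.map.corner f.map.cornerQ, w.mod, LinearMap.inl Λ w.mod (Dual Λ w'.mod)⟩

theorem StableIso.isAnnihilator (hZ : StarInvariant Z)
    (f : StableIso Z (.boundary w) (.boundary w')) : f.incl.IsAnnihilator Z f.map.unionPerp :=
  f.isIso.unionPerp_based hZ

theorem Presents.nonempty_iso {f : StableIso Z (.boundary w) (.boundary w')} {m : QuadForm Λ ε}
    {j : w.mod →ₗ[Λ] m.mod} {k : w'.mod →ₗ[Λ] m.mod}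
    (h : Presents Z w w' f.map.corner f.map.cornerQ m j k) :
    Nonempty (Inclusion.Iso Z f.incl ⟨m, w.mod, j⟩) := by
  obtain ⟨e, h1, -⟩ := h
  exact ⟨⟨e, .refl Λ _, .refl, h1⟩⟩

theorem Presents.act (hZ : StarInvariant Z) {f : StableIso Z (.boundary w) (.boundary w')}
    {m : QuadForm Λ ε} {j : w.mod →ₗ[Λ] m.mod} {k : w'.mod →ₗ[Λ] m.mod}
    (h : Presents Z w w' f.map.corner f.map.cornerQ m j k) (K : Isometry Z w u)
    (L : Isometry Z w' u') : Presents Z u u'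
      (((SplitMap.boundary L.toEquiv).sum (SplitMap.id (.triv f.P'))).comp
        (f.map.comp ((SplitMap.boundary K.toEquiv).symm.sum (SplitMap.id (.triv f.P))))).corner
      (((SplitMap.boundary L.toEquiv).sum (SplitMap.id (.triv f.P'))).comp
        (f.map.comp ((SplitMap.boundary K.toEquiv).symm.sum (SplitMap.id (.triv f.P))))).cornerQ
      m (j.comp K.toEquiv.symm.toLinearMap) (k.comp L.toEquiv.symm.toLinearMap) := by
  rw [SplitMap.corner_congr, SplitMap.cornerQ_congr]
  exact h.congr hZ K L

theorem Presents.push (hZ : StarInvariant Z) {P P' : BasedModule Λ}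
    {f : SplitMap ((SplitFormation.boundary w).sum (.triv P))
      ((SplitFormation.boundary w').sum (.triv P'))}
    {m : QuadForm Λ ε} {j : w.mod →ₗ[Λ] m.mod} {k : w'.mod →ₗ[Λ] m.mod}
    (h : Presents Z w w' f.corner f.cornerQ m j k) (R : BasedModule Λ)
    (K : Isometry Z (w.sum (.zero R)) u) (L : Isometry Z (w'.sum (.zero R)) u') :
    Presents Z u u' (f.push R K L).corner (f.push R K L).cornerQ (m.sum (.hyp ε R))
      ((j.prodMap (LinearMap.inl Λ R (Dual Λ R))).comp K.toEquiv.symm.toLinearMap)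
      ((k.prodMap (LinearMap.inl Λ R (Dual Λ R))).comp L.toEquiv.symm.toLinearMap) := by
  rw [SplitMap.corner_push, SplitMap.cornerQ_push]
  exact (h.stab R).congr hZ K L

theorem Presents.nonempty_iso_push (hZ : StarInvariant Z) {P P' : BasedModule Λ}
    {f : SplitMap ((SplitFormation.boundary w).sum (.triv P))
      ((SplitFormation.boundary w').sum (.triv P'))}
    {m : QuadForm Λ ε} {j : w.mod →ₗ[Λ] m.mod} {k : w'.mod →ₗ[Λ] m.mod}
    (h : Presents Z w w' f.corner f.cornerQ m j k) (R : BasedModule Λ)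
    (K : Isometry Z (w.sum (.zero R)) u) (L : Isometry Z (w'.sum (.zero R)) u')
    (hf : (f.push R K L).IsIso Z) :
    Nonempty (Inclusion.Iso Z (StableIso.mk P P' (f.push R K L) hf).incl
      ((Inclusion.mk m w.mod j).sum (.hyp ε R))) := by
  obtain ⟨g⟩ := Presents.nonempty_iso (f := StableIso.mk P P' (f.push R K L) hf)
    (h.push hZ R K L)
  exact ⟨g.trans (Inclusion.Iso.reparam (m := m.sum (.hyp ε R)) (W := .of Λ (w.mod × R)) (U := u.mod)
    (j.prodMap (LinearMap.inl Λ R (Dual Λ R))) K.toEquiv K.simple).symm⟩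

/-- A homotopy shears the union and fixes `V`; the action of a pair of automorphisms leaves the form
alone and only reparametrises `V` and its annihilator. -/
theorem BIsoRel.nonempty_iso (hZ : StarInvariant Z) {f f' : StableIso Z (.boundary w) (.boundary w')}
    (h : BIsoRel w w' f f') : Nonempty (Inclusion.Iso Z f.incl f'.incl) := by
  cases h with
  | homotopy h =>
    obtain ⟨δ, hδ⟩ := h.exists_unionShear
    exact ⟨⟨⟨unionShear w w' δ, isSimple_unionShear δ, hδ⟩, .refl Λ _, .refl, fun a => by
      rw [unionShear_apply]
      exact Prod.ext ((congrArg (a + ·) (map_zero δ)).trans (add_zero a)) rfl⟩⟩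
  | act g h hf =>
    obtain ⟨e⟩ := Presents.nonempty_iso (f := ⟨f.P, f.P', _, hf⟩) (f.isIso.presents.act hZ g h)
    exact ⟨(e.trans (Inclusion.Iso.reparam _ g.toEquiv g.simple).symm).symm⟩

/-- Stable isomorphisms of boundaries with isomorphic unions define the same boundary isomorphism. -/
theorem BIso.mk_eq_mk_of_iso (hZ : StarInvariant Z) {f f' : StableIso Z (.boundary w) (.boundary w')}
    (g : Inclusion.Iso Z f.incl f'.incl) : BIso.mk f = BIso.mk f' := by
  have h := f.isIso.presents
  have h' := f'.isIso.presents
  -- An isomorphism of inclusions also matches the annihilators. Restricted to `V` and to `V'` it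
  -- yields automorphisms `A` and `B` of the two forms, by which `f` can be moved within its orbit.
  obtain ⟨g', hg'⟩ := (f.isAnnihilator hZ).exists_iso hZ (f'.isAnnihilator hZ) g
  have hA := g.pull_eq
  have hB := g'.pull_eq
  rw [h.pull_left, h'.pull_left] at hA
  rw [(h.perp hZ f.isIso).2.1, (h'.perp hZ f'.isIso).2.1, map_neg, neg_inj] at hB
  let A : Isometry Z w w := ⟨g.equiv, g.simple, hA⟩
  let B : Isometry Z w' w' := ⟨g'.equiv, g'.simple, hB⟩
  have hb (t : QuadForm Λ ε) := SplitFormation.boundary_isFormation (Z := Z) t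
  have ht (P : BasedModule Λ) := SplitFormation.triv_isFormation (ε := ε) (Z := Z) P
  have hf : (((SplitMap.boundary B.toEquiv).sum (SplitMap.id (.triv f.P'))).comp
        (f.map.comp ((SplitMap.boundary A.toEquiv).symm.sum (SplitMap.id (.triv f.P))))).IsIso Z :=
    ((SplitMap.IsIso.boundary B).sum (.id (ht _))).comp
      (f.isIso.comp ((SplitMap.IsIso.boundary A).symm.sum (.id (ht _))))
  refine (Quot.sound (BIsoRel.act f A B hf)).trans (Quot.sound (.homotopy ?_))
  -- After the action by `A` and `B`, the moved isomorphism and `f'` present the same form with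
  -- literally the same two inclusions, so they are stably homotopic.
  have h2 := (h.act hZ A B).isometry g.isom
  have e1 : g.isom.toEquiv.toLinearMap.comp
      ((LinearMap.inl Λ w.mod (Dual Λ w'.mod)).comp A.toEquiv.symm.toLinearMap) =
      LinearMap.inl Λ w.mod (Dual Λ w'.mod) := LinearMap.ext fun a =>
    (g.comm (A.toEquiv.symm a)).trans (congrArg f'.incl.j (A.toEquiv.apply_symm_apply a))
  have e2 : g.isom.toEquiv.toLinearMap.comp
      (f.map.unionPerp.comp B.toEquiv.symm.toLinearMap) = f'.map.unionPerp := LinearMap.ext fun a =>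
    (congrArg (fun i => Isometry.toEquiv i (f.map.unionPerp (B.toEquiv.symm a))) hg'.symm).trans
      ((g'.comm (B.toEquiv.symm a)).trans
        (congrArg f'.map.unionPerp (B.toEquiv.apply_symm_apply a)))
  rw [e1, e2] at h2
  exact Presents.stablyHomotopic hZ (f := ⟨f.P, f.P', _, hf⟩) h2 h'

variable {v v' : QuadForm Λ ε}

/-- The identification `(v ⊕ Λ^k) ⊕ Λ^a = v ⊕ Λ^n`. -/
theorem QuadForm.exists_stab_stab (Z : AddSubgroup (ReducedK1 Λ)) {k a n : ℕ} (h : k + a = n) :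
    ∃ e : ((Fin k → Λ) × (Fin a → Λ)) ≃ₗ[Λ] (Fin n → Λ), ∀ v : QuadForm Λ ε,
      ∃ K : Isometry Z ((v.stab k).stab a) (v.stab n), ∀ x a b, K.toEquiv ((x, a), b) =
        (x, e (a, b)) := by
  obtain ⟨e, he⟩ := IsSimple.exists_free_sum (Λ := Λ) (Z := Z) h
  exact ⟨e, fun v => ⟨(Isometry.sumZeroSum Z v (freeMod Λ k) (freeMod Λ a)).trans
    ((Isometry.refl Z v).sum (Isometry.zero (S := .of Λ ((Fin k → Λ) × (Fin a → Λ)))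
      (T := freeMod Λ n) e he)), fun _ _ _ => rfl⟩⟩

/-- Representatives at different levels of the direct limit are compared by raising them to a common
level; the price is a standard hyperbolic summand in the inclusion. -/
theorem SBIso.exists_stab (hZ : StarInvariant Z) {k a n : ℕ} (h : k + a = n)
    (f : StableIso Z (.boundary (v.stab k)) (.boundary (v'.stab k))) :
    ∃ f' : StableIso Z (.boundary (v.stab n)) (.boundary (v'.stab n)),
      SBIso.mk k f = SBIso.mk n f' ∧
        Nonempty (Inclusion.Iso Z f'.incl (f.incl.sum (.hyp ε (freeMod Λ a)))) := by
  obtain ⟨e, he⟩ := QuadForm.exists_stab_stab (Λ := Λ) (ε := ε) Z h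
  obtain ⟨K, hK⟩ := he v
  obtain ⟨K', hK'⟩ := he v'
  have ht (P : BasedModule Λ) := SplitFormation.triv_isFormation (ε := ε) (Z := Z) P
  have hf := f.isIso.push (ht _) (ht _) (freeMod Λ a) K K'
  exact ⟨⟨_, _, _, hf⟩, Quot.sound (.stab e K K' hK hK' f hf),
    f.isIso.presents.nonempty_iso_push hZ (freeMod Λ a) K K' hf⟩

/-- Stable isomorphism as an equivalence relation. -/
def Inclusion.setoid (Z : AddSubgroup (ReducedK1 Λ)) (ε : ℤˣ) : Setoid (Inclusion Λ ε) :=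
  ⟨StabIso Z, .refl, .symm, .trans⟩

/-- The stable class of the inclusion of the first form in the union. -/
def SBIso.inclClass (hZ : StarInvariant Z) : SBIso Z v v' → Quotient (Inclusion.setoid Z ε) :=
  Quot.lift (fun p => Quot.lift (fun f => Quotient.mk _ f.incl) (fun f f' h => by
      obtain ⟨g⟩ := h.nonempty_iso hZ
      exact Quotient.sound (s := Inclusion.setoid Z ε) (.of_iso g)) p.2) (by
    intro p p' h
    cases h with
    | @stab k m n e K K' hK hK' f hf =>
      obtain ⟨g⟩ := f.isIso.presents.nonempty_iso_push hZ (freeMod Λ m) K K' hf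
      exact Quotient.sound (s := Inclusion.setoid Z ε) (((Inclusion.StabIso.of_iso g).trans
        (Inclusion.stabIso_sum_hyp f.incl _)).symm))

/-- An element of `sbIso(v, v')` is determined by the stable class of the inclusion of the first form
in the union. -/
theorem SBIso.mk_eq_mk_iff (hZ : StarInvariant Z) {k n : ℕ}
    {f : StableIso Z (.boundary (v.stab k)) (.boundary (v'.stab k))}
    {f' : StableIso Z (.boundary (v.stab n)) (.boundary (v'.stab n))} :
    SBIso.mk k f = SBIso.mk n f' ↔ Inclusion.StabIso Z f.incl f'.incl := by
  refine ⟨fun h => Quotient.exact (s := Inclusion.setoid Z ε) (congrArg (SBIso.inclClass hZ) h),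
    fun h => ?_⟩
  obtain ⟨a, b, ⟨g⟩⟩ := h.exists_free hZ
  -- Comparing the ranks of the sources gives `k + a = n + b`, so the two stabilised representatives
  -- live at the same level.
  have hr := rank_eq_of_equiv (Λ := Λ) g.equiv
  rw [rank_prod, rank_prod, rank_prod, rank_prod, rank_free, rank_free, rank_free, rank_free] at hr
  obtain ⟨f₁, h₁, ⟨g₁⟩⟩ := SBIso.exists_stab hZ (rfl : k + a = k + a) f
  obtain ⟨f₂, h₂, ⟨g₂⟩⟩ := SBIso.exists_stab hZ (show n + b = k + a by omega) f'
  rw [h₁, h₂]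
  unfold SBIso.mk
  rw [BIso.mk_eq_mk_of_iso hZ (g₁.trans (g.trans g₂.symm))]

theorem SBIso.exists_rep (η : SBIso Z v v') : ∃ (k : ℕ) (f : StableIso Z (.boundary (v.stab k))
    (.boundary (v'.stab k))), η = SBIso.mk k f := by
  induction η using Quot.ind with
  | mk p =>
    obtain ⟨k, η⟩ := p
    induction η using Quot.ind with
    | mk f => exact ⟨k, f, rfl⟩

end Comparison

/-! ### The maps `b`, `κ`, `δ` and exactness. -/

section Maps

variable {Λ : Type u} [Ring Λ] [StarRing Λ] {ε : ℤˣ} [InvariantBasisNumber Λ]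
  {Z : AddSubgroup (ReducedK1 Λ)} {v v' : QuadForm Λ ε}

theorem exists_function {α : Sort*} {β : Sort*} {r : α → β → Prop} (h : ∀ a, ∃ b, r a b)
    (h' : ∀ a b b', r a b → r a b' → b = b') : ∃ f : α → β, ∀ a b, f a = b ↔ r a b := by
  choose f hf using h
  exact ⟨f, fun a b => ⟨fun h => h ▸ hf a, fun h => h' a _ _ (hf a) h⟩⟩

theorem StableIso.union_isSimple {w w' : QuadForm Λ ε} (hZ : StarInvariant Z)
    (f : StableIso Z (.boundary w) (.boundary w')) : (union f.map).IsSimple Z := by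
  rw [SplitMap.union_eq]
  exact f.isIso.unionOf_isSimple hZ

theorem IsKappa.exists (hZ : StarInvariant Z) (η : SBIso Z v v') : ∃ c, IsKappa v v' η c := by
  obtain ⟨k, f, rfl⟩ := η.exists_rep
  exact ⟨_, k, f, f.union_isSimple hZ, rfl, rfl⟩

/-- The class of the union is what is left of the stable inclusion after forgetting `V`. -/
theorem IsKappa.unique (hZ : StarInvariant Z) (η : SBIso Z v v') (c c' : LEven Z ε)
    (h : IsKappa v v' η c) (h' : IsKappa v v' η c') : c = c' := by
  obtain ⟨k, f, hf, rfl, rfl⟩ := h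
  obtain ⟨n, f', hf', he, rfl⟩ := h'
  obtain ⟨S, T, ⟨g⟩⟩ := (SBIso.mk_eq_mk_iff hZ).1 he
  refine LEven.mk_eq_mk_iff.2 ⟨S, T, ?_⟩
  rw [SplitMap.union_eq, SplitMap.union_eq]
  exact ⟨g.isom⟩

theorem IsB.exists (ξ : LMonoid Z ε) : ∃ c, IsB ξ c := by
  induction ξ using LMonoid.ind with
  | h x =>
    obtain ⟨A⟩ := x.nonempty_annihilator
    exact ⟨_, x, A, rfl, rfl⟩

/-- Stabilising an inclusion by `S ⊂ H_ε(S)` adds a zero form both to the induced form and to that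
of the annihilator, which `0`-stabilised classes do not see. Hence `b` is also a function of the
invariant, and is constant on orbits. -/
theorem IsB.eq_of_stabIso (hZ : StarInvariant Z) {x y : QuasiFormation Z ε} (A : Annihilator x)
    (B : Annihilator y) (h : Inclusion.StabIso Z x.incl y.incl) :
    (ZeroStab.mk Z x.left, ZeroStab.mk Z A.right) =
      (ZeroStab.mk Z y.left, ZeroStab.mk Z B.right) := by
  have h1 : ZeroStab.mk Z x.left = ZeroStab.mk Z y.left := h.zeroStab_eq
  have h2 : ZeroStab.mk Z A.right = ZeroStab.mk Z B.right :=
    Inclusion.StabIso.zeroStab_annihilator_eq (x := x.incl) (y := y.incl) (U := A.U) (U' := B.U)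
      (k := A.k) (k' := B.k) hZ A.based B.based h
  rw [h1, h2]

theorem IsB.unique (hZ : StarInvariant Z) (ξ : LMonoid Z ε) (c c' : ZeroStab Z ε × ZeroStab Z ε)
    (h : IsB ξ c) (h' : IsB ξ c') : c = c' := by
  obtain ⟨x, A, rfl, rfl⟩ := h
  obtain ⟨y, B, he, rfl⟩ := h'
  exact IsB.eq_of_stabIso hZ A B (LMonoid.mk_eq_mk_iff.1 he).stabIso

theorem IsB.add (hZ : StarInvariant Z) {ξ z : LMonoid Z ε} (hz : z ∈ LOddSimple Z ε)
    {c : ZeroStab Z ε × ZeroStab Z ε} (h : IsB ξ c) : IsB (ξ + z) c := by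
  obtain ⟨x, A, rfl, rfl⟩ := h
  obtain ⟨y, hy⟩ : ∃ y, LMonoid.mk y = LMonoid.mk x + z := by
    induction z using LMonoid.ind with
    | h w => exact ⟨x.sum w, rfl⟩
  obtain ⟨B⟩ := y.nonempty_annihilator
  exact ⟨y, B, hy.symm, IsB.eq_of_stabIso hZ A B (stabIso_of_add_eq hz hy)⟩

/-- All the choices in the construction of `δ` disappear here: whatever they are, the result has the
stable inclusion of the quasi-formation. Well-definedness and the description of the fibres rest on
this alone. -/
theorem IsDelta.exists_stabIso (hZ : StarInvariant Z) {ξ : LMonoid Z ε} {η : SBIso Z v v'}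
    (h : IsDelta v v' ξ η) : ∃ (x : QuasiFormation Z ε) (k : ℕ)
      (f : StableIso Z (.boundary (v.stab k)) (.boundary (v'.stab k))),
      ξ = LMonoid.mk x ∧ η = SBIso.mk k f ∧ Inclusion.StabIso Z x.incl f.incl := by
  obtain ⟨x, d, Q, p, k, l, hf, hξ, hη⟩ := h
  obtain ⟨g⟩ := (d.presents hZ).nonempty_iso_push hZ Q k l hf
  exact ⟨x, p, _, hξ, hη,
    ((Inclusion.StabIso.of_iso g).trans (Inclusion.stabIso_sum_hyp x.incl Q)).symm⟩

theorem IsDelta.unique (hZ : StarInvariant Z) (ξ : LMonoid Z ε) (η η' : SBIso Z v v')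
    (h : IsDelta v v' ξ η) (h' : IsDelta v v' ξ η') : η = η' := by
  obtain ⟨x, k, f, rfl, rfl, hx⟩ := h.exists_stabIso hZ
  obtain ⟨y, n, f', he, rfl, hy⟩ := h'.exists_stabIso hZ
  exact (SBIso.mk_eq_mk_iff hZ).2 (hx.symm.trans ((LMonoid.mk_eq_mk_iff.1 he).stabIso.trans hy))

/-- The fibres of `δ`. -/
theorem IsDelta.eq_iff (hZ : StarInvariant Z) {ξ ξ' : LMonoid Z ε} {η η' : SBIso Z v v'}
    (h : IsDelta v v' ξ η) (h' : IsDelta v v' ξ' η') :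
    η = η' ↔ ∃ z ∈ LOddSimple Z ε, ξ' = ξ + z := by
  obtain ⟨x, k, f, rfl, rfl, hx⟩ := h.exists_stabIso hZ
  obtain ⟨y, n, f', rfl, rfl, hy⟩ := h'.exists_stabIso hZ
  rw [SBIso.mk_eq_mk_iff hZ]
  constructor
  · intro h
    exact exists_add_eq_of_stabIso (hx.trans (h.trans hy.symm))
  · rintro ⟨z, hz, he⟩
    exact hx.symm.trans ((stabIso_of_add_eq hz he).trans hy)

theorem Annihilator.rank_eq {x : QuasiFormation Z ε} (A : Annihilator x) :
    EpsQuad.rank Λ A.U = EpsQuad.rank Λ x.V := by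
  obtain ⟨e, -⟩ := A.based
  have h := rank_eq_of_equiv (Λ := Λ) e
  rw [rank_prod, rank_dual] at h
  have h2 := x.half
  unfold QuadForm.rank at h2
  linarith

theorem IsDelta.exists (hZ : StarInvariant Z) (hr : v.rank = v'.rank) {ξ : LMonoid Z ε}
    (h : IsB ξ (ZeroStab.mk Z v, ZeroStab.mk Z v')) : ∃ η, IsDelta v v' ξ η := by
  obtain ⟨x, -, rfl, -⟩ := id h
  obtain ⟨d⟩ := x.nonempty_glueData hZ
  have hc := IsB.unique hZ _ _ _ h ⟨x, d.toAnnihilator, rfl, rfl⟩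
  obtain ⟨Q, P, ⟨e⟩⟩ := ZeroStab.mk_eq_mk_iff.1 (congrArg Prod.fst hc).symm
  obtain ⟨Q', P', ⟨e'⟩⟩ := ZeroStab.mk_eq_mk_iff.1 (congrArg Prod.snd hc).symm
  have h1 := rank_eq_of_equiv (Λ := Λ) e.toEquiv
  have h2 := rank_eq_of_equiv (Λ := Λ) e'.toEquiv
  rw [rank_prod, rank_prod] at h1 h2
  have h3 := d.rank_eq
  -- The definition of `δ` demands one zero form and one exponent for both isometries. As `V` and
  -- its annihilator have equal rank, and so do `v` and `v'`, the differences of ranks agree and a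
  -- common stabilisation exists.
  obtain ⟨a, b, m, n, ⟨e₁, h₁⟩, ⟨e₂, h₂⟩, ⟨e₃, h₃⟩, ⟨e₄, h₄⟩⟩ :=
    exists_common_stabilisation Z Q P Q' P' (by
      unfold QuadForm.rank at hr
      change _ = EpsQuad.rank Λ v.mod + EpsQuad.rank Λ P at h1
      change _ = EpsQuad.rank Λ v'.mod + EpsQuad.rank Λ P' at h2
      change EpsQuad.rank Λ x.V + EpsQuad.rank Λ Q = _ at h1
      change EpsQuad.rank Λ d.U + EpsQuad.rank Λ Q' = _ at h2
      linarith)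
  have key (t s : QuadForm Λ ε) (A B : BasedModule Λ) (c : ℕ) (e : Isometry Z (t.sum (.zero A)) (s.sum (.zero B)))
      (f : (A × (Fin c → Λ)) ≃ₗ[Λ] (Fin m → Λ)) (hf : IsSimple Z f)
      (g : (B × (Fin c → Λ)) ≃ₗ[Λ] (Fin n → Λ)) (hg : IsSimple Z g) :
      Isometry Z (t.sum (.zero (freeMod Λ m))) (s.stab n) :=
    (((Isometry.sumZeroSum Z t A (freeMod Λ c)).trans ((Isometry.refl Z t).sum
      (Isometry.zero (S := .of Λ (A × (Fin c → Λ))) (T := freeMod Λ m) f hf))).symm).trans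
      ((e.sum (.refl Z _)).trans ((Isometry.sumZeroSum Z s B (freeMod Λ c)).trans
        ((Isometry.refl Z s).sum
      (Isometry.zero (S := .of Λ (B × (Fin c → Λ))) (T := freeMod Λ n) g hg))))
  have ht (P : BasedModule Λ) := SplitFormation.triv_isFormation (ε := ε) (Z := Z) P
  exact ⟨_, x, d, freeMod Λ m, n, key _ _ _ _ a e e₁ h₁ e₃ h₃, key _ _ _ _ b e' e₂ h₂ e₄ h₄,
    (d.map_isIso hZ).push (ht _) (ht _) _ _ _, rfl, rfl⟩

/-- The composition of `δ` and `κ` vanishes. -/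
theorem IsDelta.kappa_eq_zero (hZ : StarInvariant Z) {ξ : LMonoid Z ε} {η : SBIso Z v v'}
    (h : IsDelta v v' ξ η) : IsKappa v v' η 0 := by
  obtain ⟨x, k, f, -, rfl, S, T, ⟨g⟩⟩ := h.exists_stabIso hZ
  -- Up to stabilisation the union is `M`, which is `H_ε(L)` because of its Lagrangian. The summand
  -- `Λ^0` occurs since zero is represented by `H_ε(Λ^0)`.
  refine ⟨k, f, f.union_isSimple hZ, rfl, (LEven.mk_eq_mk_iff.2
    ⟨.of Λ (T × freeMod Λ 0), .of Λ (x.L × S), ?_⟩).symm⟩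
  obtain ⟨e, -⟩ := x.lagr.exists_isometry
  rw [SplitMap.union_eq]
  exact ⟨(Isometry.sumHypSum Z _ T (freeMod Λ 0)).symm.trans (((g.isom.symm.trans
    ((e.symm.sum (.refl Z _)).trans (Isometry.hypSum Z ε x.L S))).sum (.refl Z _)).trans
      (Isometry.sumComm _ _))⟩

/-- The kernel of `κ` is contained in the image of `δ`. -/
theorem IsKappa.exists_delta (hZ : StarInvariant Z) (hr : v.rank = v'.rank) {η : SBIso Z v v'}
    (h : IsKappa v v' η 0) : ∃ ξ : LMonoid Z ε, IsB ξ (ZeroStab.mk Z v, ZeroStab.mk Z v') ∧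
      IsDelta v v' ξ η := by
  obtain ⟨k, f, hs, rfl, h0⟩ := h
  obtain ⟨Q, P, he⟩ := LEven.mk_eq_mk_iff.1 h0
  rw [SplitMap.union_eq] at he
  obtain ⟨e⟩ := he
  -- Vanishing of `κ` means that the union becomes hyperbolic after adding some `H_ε(P)`. The
  -- standard Lagrangian is carried over by `e'` and serves as the Lagrangian of the
  -- quasi-formation, while `V` is the first form of the union together with `P`.
  let e' := (Isometry.hypSum Z ε (freeMod Λ 0) Q).symm.trans e
  have hL := (QuasiFormation.hyp_isSimpleLagrangian (Z := Z)
    (BasedModule.of Λ (freeMod Λ 0 × Q))).isometry e'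
  have hA := (f.isAnnihilator hZ).sum (Inclusion.isAnnihilator_hyp P)
  have hM : (f.incl.sum (.hyp ε P)).form.IsSimple Z :=
    (f.isIso.unionOf_isSimple hZ).sum (QuadForm.hyp_isSimple P)
  let x : QuasiFormation Z ε :=
    { form := (f.incl.sum (.hyp ε P)).form
      simple := hM
      L := .of Λ (freeMod Λ 0 × Q)
      i := e'.toEquiv.toLinearMap.comp (LinearMap.inl Λ (freeMod Λ 0 × Q) _)
      lagr := hL
      V := (f.incl.sum (.hyp ε P)).V
      j := (f.incl.sum (.hyp ε P)).j
      split := (hA.annihilator hZ hM).exists_retraction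
      -- The union has rank `rank v + rank v'` before stabilisation, so the summand has half rank
      -- exactly because `v` and `v'` have equal ranks.
      half := by
        unfold QuadForm.rank at hr ⊢
        change 2 * rank Λ ((v.mod × freeMod Λ k) × P) =
          rank Λ (((v.mod × freeMod Λ k) × Dual Λ (v'.mod × freeMod Λ k)) × (P × Dual Λ P))
        simp only [rank_prod, rank_dual, hr]
        ring }
  let A : Annihilator x := ⟨_, _, hA⟩
  have hx : Inclusion.StabIso Z x.incl f.incl := Inclusion.stabIso_sum_hyp f.incl P
  have hB : IsB (LMonoid.mk x) (ZeroStab.mk Z v, ZeroStab.mk Z v') := by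
    refine ⟨x, A, rfl, Prod.ext ?_ ?_⟩
    · refine Eq.trans ?_ hx.zeroStab_eq.symm
      have h1 := f.isIso.presents.pull_left
      refine ZeroStab.mk_eq_mk_iff.2 ⟨.of Λ (freeMod Λ k × freeMod Λ 0), freeMod Λ 0, ⟨?_⟩⟩
      refine (Isometry.sumZeroSum Z v (freeMod Λ k) (freeMod Λ 0)).symm.trans ?_
      exact (Isometry.mk (v := v.stab k) (w := f.incl.induced) (.refl Λ _) .refl
        ((QGroup.pull_id _).trans h1)).sum (.refl Z _)
    · refine Eq.trans ?_ (hx.zeroStab_annihilator_eq hZ hA (f.isAnnihilator hZ)).symm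
      have h1 := (f.isIso.presents.perp hZ f.isIso).2.1
      refine ZeroStab.mk_eq_mk_iff.2 ⟨.of Λ (freeMod Λ k × freeMod Λ 0), freeMod Λ 0, ⟨?_⟩⟩
      refine (Isometry.sumZeroSum Z v' (freeMod Λ k) (freeMod Λ 0)).symm.trans ?_
      exact (Isometry.mk (v := v'.stab k)
        (w := (Inclusion.mk f.incl.form (v'.stab k).mod f.map.unionPerp).coinduced)
        (.refl Λ _) .refl ((QGroup.pull_id _).trans ((congrArg Neg.neg h1).trans (neg_neg _)))).sum
          (.refl Z _)
  refine ⟨_, hB, ?_⟩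
  -- The construction of `δ` on this class makes its own choices, unrelated to `f`. Its value still
  -- has the same stable inclusion as `f`, and hence is the class of `f`.
  obtain ⟨η, hη⟩ := IsDelta.exists hZ hr hB
  obtain ⟨y, n, f', he', rfl, hy⟩ := hη.exists_stabIso hZ
  rw [(SBIso.mk_eq_mk_iff hZ).2 (hx.symm.trans ((LMonoid.mk_eq_mk_iff.1 he').stabIso.trans hy))]
  exact hη

end Maps

end

end EpsQuad

theorem theorem4 (Λ : Type u) [Ring Λ] [StarRing Λ] [InvariantBasisNumber Λ]
    (Z : AddSubgroup (EpsQuad.ReducedK1 Λ)) (hZ : EpsQuad.StarInvariant Z) (q : ℕ)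
    (v v' : EpsQuad.QuadForm Λ ((-1 : ℤˣ) ^ q)) (hvv' : EpsQuad.StablyEquivalent Z v v') :
    -- `L^s_{2q+1}(Λ)` is a group, contained in the monoid `l_{2q+1}(Λ)`
    ((0 : EpsQuad.LMonoid Z ((-1 : ℤˣ) ^ q)) ∈ EpsQuad.LOddSimple Z ((-1 : ℤˣ) ^ q) ∧
      (∀ z ∈ EpsQuad.LOddSimple Z ((-1 : ℤˣ) ^ q), ∀ w ∈ EpsQuad.LOddSimple Z ((-1 : ℤˣ) ^ q),
        z + w ∈ EpsQuad.LOddSimple Z ((-1 : ℤˣ) ^ q)) ∧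
      (∀ z ∈ EpsQuad.LOddSimple Z ((-1 : ℤˣ) ^ q),
        ∃ w ∈ EpsQuad.LOddSimple Z ((-1 : ℤˣ) ^ q), z + w = 0)) ∧
    -- the map `b`, whose fibre over `([v], [v'])` is `l_{2q+1}(v, v')`
    ∃ b : EpsQuad.LMonoid Z ((-1 : ℤˣ) ^ q) →
        EpsQuad.ZeroStab Z ((-1 : ℤˣ) ^ q) × EpsQuad.ZeroStab Z ((-1 : ℤˣ) ^ q),
      (∀ ξ c, b ξ = c ↔ EpsQuad.IsB ξ c) ∧
      -- the maps `δ` and `κ`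
      ∃ (δ : {ξ // b ξ = (EpsQuad.ZeroStab.mk Z v, EpsQuad.ZeroStab.mk Z v')} →
          EpsQuad.SBIso Z v v')
        (κ : EpsQuad.SBIso Z v v' → EpsQuad.LEven Z ((-1 : ℤˣ) ^ q)),
        (∀ ξ η, δ ξ = η ↔ EpsQuad.IsDelta v v' ξ.1 η) ∧
        (∀ η c, κ η = c ↔ EpsQuad.IsKappa v v' η c) ∧
        -- `ρ` is an action on `l_{2q+1}(v, v')`, and its orbits are the fibres of `δ`
        (∀ ξ, b ξ = (EpsQuad.ZeroStab.mk Z v, EpsQuad.ZeroStab.mk Z v') →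
          ∀ z ∈ EpsQuad.LOddSimple Z ((-1 : ℤˣ) ^ q),
            b (ξ + z) = (EpsQuad.ZeroStab.mk Z v, EpsQuad.ZeroStab.mk Z v')) ∧
        (∀ ξ ξ', δ ξ = δ ξ' ↔
          ∃ z ∈ EpsQuad.LOddSimple Z ((-1 : ℤˣ) ^ q), ξ'.1 = ξ.1 + z) ∧
        -- the image of `δ` is `κ⁻¹(0)`
        Set.range δ = κ ⁻¹' {0} := by
  obtain ⟨b, hb⟩ := EpsQuad.exists_function
    (EpsQuad.IsB.exists (Z := Z) (ε := (-1 : ℤˣ) ^ q)) (EpsQuad.IsB.unique hZ)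
  obtain ⟨κ, hκ⟩ := EpsQuad.exists_function (EpsQuad.IsKappa.exists (v := v) (v' := v') hZ)
    (EpsQuad.IsKappa.unique hZ)
  obtain ⟨δ, hδ⟩ := EpsQuad.exists_function
    (α := {ξ // b ξ = (EpsQuad.ZeroStab.mk Z v, EpsQuad.ZeroStab.mk Z v')})
    (r := fun ξ η => EpsQuad.IsDelta v v' ξ.1 η)
    (fun ξ => EpsQuad.IsDelta.exists hZ hvv'.1 ((hb _ _).1 ξ.2))
    (fun ξ => EpsQuad.IsDelta.unique hZ ξ.1)
  refine ⟨⟨EpsQuad.LOddSimple.zero_mem, fun z hz w hw => EpsQuad.LOddSimple.add_mem hz hw,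
    fun z hz => EpsQuad.LOddSimple.exists_neg hz⟩, b, hb, δ, κ, hδ, hκ,
    fun ξ hξ z hz => (hb _ _).2 (((hb _ _).1 hξ).add hZ hz), fun ξ ξ' => ?_, Set.ext fun η => ?_⟩
  · exact EpsQuad.IsDelta.eq_iff hZ ((hδ ξ _).1 rfl) ((hδ ξ' _).1 rfl)
  · refine ⟨?_, fun h => ?_⟩
    · rintro ⟨ξ, rfl⟩
      exact (hκ _ _).2 (((hδ ξ _).1 rfl).kappa_eq_zero hZ)
    · obtain ⟨ξ, hB, hD⟩ := ((hκ η 0).1 h).exists_delta hZ hvv'.1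
      exact ⟨⟨ξ, (hb _ _).2 hB⟩, (hδ _ _).2 hD⟩
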